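/- **Setting.** On $\mathbb T^3=\mathbb R^3/\mathbb Z^3$ write $x=(x',z)$ with $x'\in\mathbb T^2$. For $f$ with Fourier coefficients $\hat f_k$, $k\in 2\pi\mathbb Z^3$, let $\widehat{(Af)}_k=|k|\hat f_k$, and for $\sigma>0$, $\phi\ge 0$ put $$\|f\|_{\mathcal G_\phi^{\sigma,1}}^2=\sum_k\bigl(1+e^{2\phi|k|}|k|^{2\sigma}\bigr)|\hat f_k|^2,\qquad \|f\|_{\dot{\mathcal G}_\phi^{\sigma,1}}^2=\sum_k e^{2\phi|k|}|k|^{2\sigma}|\hat f_k|^2;$$ $\mathcal G_\phi^{\sigma,1}$ is the class of $f$ with $\|f\|_{\mathcal G_\phi^{\sigma,1}}<\infty$. Let $\bar f(x')=\int_0^1 f(x',z)\,dz$, $\tilde f=f-\bar f$. Let $H$ be the space of fields $f:\mathbb T^3\to\mathbb R^2$ in $L^2$ that are even in $z$, have zero mean, and satisfy $\nabla_h\cdot\bar f=0$, where $\nabla_h=(\partial_{x_1},\partial_{x_2})$. Put $\mathcal P f=\bar f-\nabla_h\Delta_h^{-1}\nabla_h\cdot\bar f+\tilde f$, $w(U)=-\int_0^z\nabla_h\cdot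 U(x',\tilde z)\,d\tilde z$, and $Q(U,V)=U\cdot\nabla_hV+w(U)\partial_zV$. Let $\Omega=\{\omega\in C([0,\infty);\mathbb R):\omega(0)=0\}$, $W_t(\omega)=\omega(t)$, and for $\alpha,\beta,\nu>0$ let $\Omega_{\alpha,\beta,\nu}=\{\omega\in\Omega:\alpha+\beta t-\nu W_t\ge 0\text{ for all }t\ge0\}$. With $\Gamma(t)=e^{-\nu W_t}$, consider for a fixed $\omega$ the damped random PDE $$\partial_tU+\Gamma^{-1}\mathcal PQ(U,U)=-\tfrac12\nu^2U,\qquad U(0)=U_0. \tag{1}$$ **Proposition.** Let $\sigma>\frac52$. There is a constant $C_\sigma>0$, depending only on $\sigma$, such that $$\bigl|\langle e^{\phi A}A^\sigma Q(U,U),e^{\phi A}A^\sigma U\rangle\bigr|\le C_\sigma\|U\|_{\dot{\mathcal G}_\phi^{\sigma,1}}\|U\|_{\dot{\mathcal G}_\phi^{\sigma+\frac12,1}}^2\qquad\text{for all }\phi\ge0,\ U\in H\cap\mathcal G_\phi^{\sigma+\frac12,1}, \tag{2}$$ and for every $C_\sigma>0$ for which (2) holds the following is true. Let $\phi_0,\alpha,\beta,\nu>0$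 satisfy $(\nu^2-2\beta)\phi_0>4C_\sigma$. Let $\omega\in\Omega_{\alpha,\beta,\nu}$, and let $U_0\in H\cap\mathcal G_{\phi_0}^{\sigma,1}$ satisfy $$e^\alpha\|U_0\|_{\mathcal G_{\phi_0}^{\sigma,1}}\le\frac{(\nu^2-2\beta)\phi_0}{4C_\sigma}-1.$$ Then the radius $$\phi(t)=\phi_0-\frac{4C_\sigma}{\nu^2-2\beta}\Bigl(e^\alpha\|U_0\|_{\mathcal G_{\phi_0}^{\sigma,1}}+1\Bigr)\Bigl(1-e^{-(\frac{\nu^2}2-\beta)t}\Bigr)$$ is positive for all $t\ge0$, and (1) has a unique global solution $U\in C([0,\infty);H\cap\mathcal G_\phi^{\sigma,1})$. Here $U\in C([0,\infty);H\cap\mathcal G_\phi^{\sigma,1})$ means that $U(t)\in H\cap\mathcal G_{\phi(t)}^{\sigma,1}$ for all $t\ge0$ and that $U$ and $t\mapsto e^{\phi(t)A}A^\sigma U(t)$ are continuous from $[0,\infty)$ to $L^2$. -/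

import Mathlib

noncomputable section

namespace PE

open MeasureTheory Filter Topology

/-- The torus `𝕋³ = ℝ³/ℤ³`; coordinates `0, 1` are horizontal and coordinate `2` is vertical. -/
abbrev T3 : Type := UnitAddTorus (Fin 3)

/-- The horizontal torus `𝕋² = ℝ²/ℤ²`. -/
abbrev T2 : Type := UnitAddTorus (Fin 2)

/-- Horizontal velocity fields `𝕋³ → ℝ²`. The fields considered here lie in Gevrey classes of
regularity above `5/2`, so each of them is given by its continuous representative. -/
abbrev Field : Type := C(T3, Fin 2 → ℝ)

/-- The horizontal part `x'` of `x = (x', z)`. -/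
def hor (x : T3) : T2 := fun j => x j.castSucc

/-- The point `(x', z)`. -/
def pt (x' : T2) (z : UnitAddCircle) : T3 := Fin.snoc (α := fun _ => UnitAddCircle) x' z

/-! ### Differential operators, barotropic part, vertical velocity -/

/-- The classical partial derivative `∂_j f` at the point `x` of a torus. -/
def pd {d : ℕ} (j : Fin d) (f : UnitAddTorus (Fin d) → ℝ) (x : UnitAddTorus (Fin d)) : ℝ :=
  deriv (fun s : ℝ => f (x + Pi.single j (s : UnitAddCircle))) 0

/-- The horizontal divergence `∇_h · F` of a field on `𝕋³`. -/
def divH (F : T3 → Fin 2 → ℝ) (x : T3) : ℝ :=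
  ∑ j : Fin 2, pd j.castSucc (fun y => F y j) x

/-- The divergence `∇_h · g` of a field on `𝕋²`. -/
def div2 (g : T2 → Fin 2 → ℝ) (x' : T2) : ℝ :=
  ∑ j : Fin 2, pd j (fun y => g y j) x'

/-- The barotropic part `f̄(x') = ∫₀¹ f(x', z) dz`. -/
def barotropic (F : T3 → Fin 2 → ℝ) (x' : T2) (i : Fin 2) : ℝ :=
  ∫ z in (0 : ℝ)..1, F (pt x' (z : UnitAddCircle)) i

/-- The baroclinic part `f̃ = f - f̄`. -/
def baroclinic (F : T3 → Fin 2 → ℝ) (x : T3) (i : Fin 2) : ℝ :=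
  F x i - barotropic F (hor x) i

/-- The representative in `[0, 1)` of a point of the circle. -/
def rep (z : UnitAddCircle) : ℝ := (AddCircle.equivIco 1 0 z : ℝ)

/-- The vertical velocity `w(U)(x', z) = -∫₀^z ∇_h · U(x', z̃) dz̃`. -/
def vertVel (U : T3 → Fin 2 → ℝ) (x : T3) : ℝ :=
  -∫ s in (0 : ℝ)..(rep (x 2)), divH U (pt (hor x) (s : UnitAddCircle))

/-- The bilinear form `Q(U, V) = U · ∇_h V + w(U) ∂_z V`. -/
def Q (U V : T3 → Fin 2 → ℝ) (x : T3) (i : Fin 2) : ℝ :=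
  (∑ j : Fin 2, U x j * pd j.castSucc (fun y => V y i) x)
    + vertVel U x * pd 2 (fun y => V y i) x

/-! ### Fourier coefficients, Gevrey norm, the space `H` -/

/-- The length `|2π n|` of the frequency `k = 2π n ∈ 2πℤ^d`. -/
def freq {d : ℕ} (n : Fin d → ℤ) : ℝ := 2 * Real.pi * √(∑ j, (n j : ℝ) ^ 2)

/-- The Fourier coefficient, at the frequency `2π n`, of the `i`-th component of a field. -/
def coeff (F : T3 → Fin 2 → ℝ) (n : Fin 3 → ℤ) (i : Fin 2) : ℂ :=
  UnitAddTorus.mFourierCoeff (fun x => (F x i : ℂ)) n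

/-- `|f̂_k|²`, at the frequency `k = 2π n`. -/
def coeffSq (F : T3 → Fin 2 → ℝ) (n : Fin 3 → ℤ) : ℝ := ∑ i : Fin 2, ‖coeff F n i‖ ^ 2

/-- The `n`-th term of the series for the squared Gevrey norm of order one. -/
def gevreyTerm (σ φ : ℝ) (F : T3 → Fin 2 → ℝ) (n : Fin 3 → ℤ) : ℝ :=
  (1 + Real.exp (2 * φ * freq n) * freq n ^ (2 * σ)) * coeffSq F n

/-- `F ∈ 𝒢_φ^{σ,1}`: the Gevrey norm is finite. -/
def MemGevrey (σ φ : ℝ) (F : Field) : Prop := Summable (gevreyTerm σ φ F)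

/-- The Gevrey norm
`‖F‖_{𝒢_φ^{σ,1}} = (∑_k (1 + e^{2φ|k|} |k|^{2σ}) |F̂_k|²)^{1/2}`, for `F ∈ 𝒢_φ^{σ,1}`. -/
def gevreyNorm (σ φ : ℝ) (F : Field) : ℝ := √(∑' n, gevreyTerm σ φ F n)

/-- The homogeneous Gevrey norm
`‖F‖ = (∑_k e^{2φ|k|} |k|^{2σ} |F̂_k|²)^{1/2}`, for `F ∈ 𝒢_φ^{σ,1}`. -/
def gevreyDotNorm (σ φ : ℝ) (F : Field) : ℝ :=
  √(∑' n, Real.exp (2 * φ * freq n) * freq n ^ (2 * σ) * coeffSq F n)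

/-- The space `H` together with the symmetry that is part of the boundary conditions: `F` has zero
mean over `𝕋³`, its barotropic part is divergence free, and `F` is even in `z`. -/
structure MemH (F : Field) : Prop where
  mean_zero : ∀ i, ∫ x : T3, F x i = 0
  div_free : ∀ x' : T2, div2 (barotropic F) x' = 0
  even : ∀ (x' : T2) (z : UnitAddCircle), F (pt x' (-z)) = F (pt x' z)

/-- The moving-radius distance
`‖e^{aA} A^σ F - e^{bA} A^σ G‖²_{L²} + ‖F - G‖²_{L²}`, written on the Fourier side, for
`F ∈ 𝒢_a^{σ,1}` and `G ∈ 𝒢_b^{σ,1}`. -/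
def movingDistSq (σ a b : ℝ) (F G : Field) : ℝ :=
  ∑' n : Fin 3 → ℤ, ∑ i : Fin 2,
    (‖((Real.exp (a * freq n) * freq n ^ σ : ℝ) : ℂ) * coeff F n i
        - ((Real.exp (b * freq n) * freq n ^ σ : ℝ) : ℂ) * coeff G n i‖ ^ 2
      + ‖coeff F n i - coeff G n i‖ ^ 2)

/-- `U ∈ C([0,∞); H ∩ 𝒢_φ^{σ,1})` for a time-dependent radius `φ = φ(t)`: each `U(t)` lies in
`H ∩ 𝒢_{φ(t)}^{σ,1}`, and `U` and `e^{φ(t)A} A^σ U(t)` are continuous in time with values in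
`L²`. -/
structure ContGevrey (σ : ℝ) (φ : ℝ → ℝ) (U : ℝ → Field) : Prop where
  memH : ∀ t, 0 ≤ t → MemH (U t)
  memGevrey : ∀ t, 0 ≤ t → MemGevrey σ (φ t) (U t)
  cont : ∀ t, 0 ≤ t →
    Tendsto (fun s => movingDistSq σ (φ s) (φ t) (U s) (U t)) (𝓝[Set.Ici 0] t) (𝓝 0)

/-! ### The hydrostatic Leray projection -/

/-- The inverse Laplacian on `𝕋²`: the Fourier multiplier `-|k|⁻²` for `k ≠ 0`, and `0` at
`k = 0`. -/
def invLap (g : T2 → ℝ) (x' : T2) : ℝ :=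
  (∑' n : Fin 2 → ℤ, (if n = 0 then 0 else -((freq n : ℂ) ^ 2)⁻¹)
    * UnitAddTorus.mFourierCoeff (fun y => (g y : ℂ)) n * UnitAddTorus.mFourier n x').re

/-- The two-dimensional Leray projection `𝒫_h g = g - ∇_h Δ_h⁻¹ ∇_h · g`. -/
def leray2 (g : T2 → Fin 2 → ℝ) (x' : T2) (i : Fin 2) : ℝ :=
  g x' i - pd i (invLap (div2 g)) x'

/-- The hydrostatic Leray projection `𝒫 F = 𝒫_h F̄ + F̃`. -/
def hydroLeray (F : T3 → Fin 2 → ℝ) (x : T3) (i : Fin 2) : ℝ :=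
  leray2 (barotropic F) (hor x) i + baroclinic F x i

/-! ### The nonlinear estimate that fixes the constant `C_σ` -/

/-- The `n`-th term of the series for `⟨e^{φA} A^σ F, e^{φA} A^σ G⟩`. -/
def pairTerm (σ φ : ℝ) (F G : T3 → Fin 2 → ℝ) (n : Fin 3 → ℤ) : ℂ :=
  ((Real.exp (2 * φ * freq n) * freq n ^ (2 * σ) : ℝ) : ℂ)
    * ∑ i : Fin 2, coeff F n i * (starRingEnd ℂ) (coeff G n i)

/-- `C` is an admissible constant `C_σ` in the nonlinear estimate
`|⟨e^{φA} A^σ Q(U,U), e^{φA} A^σ U⟩| ≤ C ‖U‖ ‖U‖₊²` (homogeneous Gevrey norms of order `σ` and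
`σ + 1/2`), for all `φ ≥ 0` and `U ∈ H ∩ 𝒢_φ^{σ+1/2,1}`; in particular the pairing converges. -/
def NonlinearEstimate (σ C : ℝ) : Prop :=
  ∀ φ : ℝ, 0 ≤ φ → ∀ U : Field, MemH U → MemGevrey (σ + 1 / 2) φ U →
    Summable (pairTerm σ φ (Q U U) U) ∧
    ‖∑' n, pairTerm σ φ (Q U U) U n‖
      ≤ C * gevreyDotNorm σ φ U * gevreyDotNorm (σ + 1 / 2) φ U ^ 2

/-! ### Wiener space, the damped random equation -/

/-- The canonical Wiener space `Ω = {ω ∈ C([0,∞); ℝ) : ω(0) = 0}`. -/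
def WienerSpace : Type := {ω : C(NNReal, ℝ) // ω 0 = 0}

/-- The coordinate process `W_t(ω) = ω(t)`, for `t ≥ 0`. -/
def W (ω : WienerSpace) (t : ℝ) : ℝ := ω.1 t.toNNReal

/-- `Ω_{α,β,ν} = {ω ∈ Ω : α + β t - ν W_t ≥ 0 for all t ≥ 0}`. -/
def goodSet (α β ν : ℝ) : Set WienerSpace := {ω | ∀ t, 0 ≤ t → 0 ≤ α + β * t - ν * W ω t}

/-- `Γ(t) = e^{-ν W_t}`. -/
def Gam (ν : ℝ) (ω : WienerSpace) (t : ℝ) : ℝ := Real.exp (-ν * W ω t)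

/-- `U` solves `∂_t U + Γ⁻¹ 𝒫 Q(U,U) = -½ ν² U`, `U(0) = U₀`, for all `t ≥ 0` and `x ∈ 𝕋³`
(one-sided time derivative at `t = 0`). -/
structure Solves (ν : ℝ) (ω : WienerSpace) (U₀ : Field) (U : ℝ → Field) : Prop where
  init : U 0 = U₀
  eqn : ∀ t, 0 ≤ t → ∀ (x : T3) (i : Fin 2),
    HasDerivWithinAt (fun s => U s x i)
      (-((Gam ν ω t)⁻¹ * hydroLeray (Q (U t) (U t)) x i) - 1 / 2 * ν ^ 2 * U t x i)
      (Set.Ici 0) t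

/-- The analytic radius
`φ(t) = φ₀ - 4C/(ν² - 2β) (e^α N + 1) (1 - e^{-(ν²/2 - β) t})`, where `N` stands for the norm of
the initial datum. -/
def radius (φ₀ C α β ν N t : ℝ) : ℝ :=
  φ₀ - 4 * C / (ν ^ 2 - 2 * β) * (Real.exp α * N + 1) * (1 - Real.exp (-(ν ^ 2 / 2 - β) * t))

end PE

end

/-!
# Global existence for a damped random hydrostatic Euler equation in a shrinking analytic class

Everything is done on the Fourier side. A field of `H` of Gevrey order above `5/2` is the sum of an
absolutely convergent Fourier series, and so are its first derivatives (`MemH.coefH`); classical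
derivatives, the vertical velocity, the barotropic average and the hydrostatic Leray projection then
act on coefficients by explicit symbols (`Q_eq_fser`, `hydroLeray_eq_fser`). The equation becomes a
system of ordinary differential equations for the modes, with the quadratic term `nl`.

*The nonlinear estimate* (`exists_nonlinearEstimate`). The bilinear form loses one derivative on each
factor: `|Q(U, V)_k| ≤ 3 ∑ |j| |U_j| |k - j| |V_{k-j}|`. Half a derivative is gained on the test field
and half on one factor, and the other factor is summable, since `σ > 5/2` in dimension three.

*Existence* (`exists_solution`). The function `V = e^{ν²t/2} U` solves an equation without damping,
whose nonlinear term has the coefficient `g(t) = Γ⁻¹ e^{-ν²t/2} ≤ e^{α - (ν²/2 - β)t}` on the event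
`Ω_{α,β,ν}`. For Galerkin approximations, half the time derivative of the squared homogeneous norm
at radius `ψ(t)` is at most `(ψ' + g C ‖V‖) ‖V‖₊²`, so that the norm does not increase if `ψ` decreases
fast enough (`exists_galerkin`). The constant `3C` in place of `4C` in the formula for the radius is
already sufficient. This gives a radius `ψ` which exceeds the stated radius `φ` at positive times and
agrees with it at time zero. Compactness gives the solution at the radius `ψ` (`exists_limit`).
Continuity with values in the Gevrey class of radius `φ` follows from dominated convergence at
positive times, where `φ < ψ`, and at time zero from weak convergence and the bound on the norm
(`contGevrey_synth`).

*Uniqueness* (`Solves.unique`). The coefficients of a solution decay exponentially, uniformly on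
bounded time intervals, because the radius is positive (`ContGevrey.exists_expDecay`), and they solve
the equation mode by mode (`Solves.hasDerivAt_coeff`). The squared norm
`∑ e^{2ρ(t)|k|} |D_k|²` of the difference of two solutions, with `ρ` half of the radius at the end of
the interval minus a large multiple of the elapsed time, is nonincreasing: the nonlinear terms cost
half a derivative on each factor `D` (`tsum_pairing_le`), and the decrease of `ρ` pays for it. Hence
the difference vanishes for a short time whose length depends only on the uniform bounds
(`eqOn_of_eq_left`), and continuous induction concludes (`eqOn_of_eq_zero`).
-/

noncomputable section

namespace PE

open MeasureTheory Filter Topology UnitAddTorus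

variable {d : ℕ}

/-! ### Absolutely convergent trigonometric series -/

/-- The sum of the trigonometric series with coefficients `a`. -/
def fser (a : (Fin d → ℤ) → ℂ) (x : UnitAddTorus (Fin d)) : ℂ := ∑' n, a n * mFourier n x

theorem norm_mFourier_apply (n : Fin d → ℤ) (x : UnitAddTorus (Fin d)) : ‖mFourier n x‖ = 1 := by
  rw [mFourier, ContinuousMap.coe_mk, norm_prod]
  exact Finset.prod_eq_one fun _ _ => Circle.norm_coe _

theorem norm_mul_mFourier (z : ℂ) (n : Fin d → ℤ) (x : UnitAddTorus (Fin d)) :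
    ‖z * mFourier n x‖ = ‖z‖ := by
  rw [norm_mul, norm_mFourier_apply, mul_one]

theorem summable_mul_mFourier {a : (Fin d → ℤ) → ℂ} (ha : Summable a)
    (x : UnitAddTorus (Fin d)) : Summable fun n => a n * mFourier n x :=
  .of_norm (by simpa only [norm_mul_mFourier] using ha.norm)

theorem norm_fser_le {a : (Fin d → ℤ) → ℂ} (ha : Summable a) (x : UnitAddTorus (Fin d)) :
    ‖fser a x‖ ≤ ∑' n, ‖a n‖ := by
  refine (norm_tsum_le_tsum_norm (summable_mul_mFourier ha x).norm).trans_eq ?_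
  simp only [norm_mul_mFourier]

theorem hasSum_smul_mFourier {a : (Fin d → ℤ) → ℂ} (ha : Summable a) :
    HasSum (fun n => a n • (mFourier n : C(UnitAddTorus (Fin d), ℂ))) (∑' n, a n • mFourier n) := by
  refine Summable.hasSum (.of_norm ?_)
  simpa only [norm_smul, mFourier_norm, mul_one] using ha.norm

theorem tsum_smul_mFourier_apply {a : (Fin d → ℤ) → ℂ} (ha : Summable a)
    (x : UnitAddTorus (Fin d)) :
    (∑' n, a n • (mFourier n : C(UnitAddTorus (Fin d), ℂ))) x = fser a x := by
  have := (ContinuousMap.evalCLM ℂ x).hasSum (hasSum_smul_mFourier ha)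
  exact this.tsum_eq.symm

theorem continuous_fser {a : (Fin d → ℤ) → ℂ} (ha : Summable a) : Continuous (fser a) := by
  have : fser a = (∑' n, a n • (mFourier n : C(UnitAddTorus (Fin d), ℂ)) : C(_, ℂ)) :=
    funext fun x => (tsum_smul_mFourier_apply ha x).symm
  rw [this]; exact ContinuousMap.continuous _

theorem mFourierCoeff_fser {a : (Fin d → ℤ) → ℂ} (ha : Summable a) (n : Fin d → ℤ) :
    mFourierCoeff (fser a) n = a n := by
  set S : C(UnitAddTorus (Fin d), ℂ) := ∑' n, a n • mFourier n
  have hS : (S : UnitAddTorus (Fin d) → ℂ) = fser a := funext (tsum_smul_mFourier_apply ha)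
  rw [← hS, ← mFourierCoeff_toLp, ← mFourierBasis_repr]
  have h1 := (ContinuousMap.toLp (E := ℂ) 2
    (Measure.pi fun _ : Fin d => AddCircle.haarAddCircle) ℂ).hasSum (hasSum_smul_mFourier ha)
  have h2 := (innerSL ℂ (mFourierLp 2 n)).hasSum h1
  have h3 : ∀ m, innerSL ℂ (mFourierLp (d := Fin d) 2 n)
      (ContinuousMap.toLp (E := ℂ) 2 (Measure.pi fun _ : Fin d => AddCircle.haarAddCircle) ℂ
        (a m • mFourier m)) = if m = n then a n else 0 := by
    intro m
    rw [map_smul, map_smul, innerSL_apply_apply]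
    have := orthonormal_iff_ite.mp (orthonormal_mFourier (d := Fin d)) n m
    refine (congrArg (a m • ·) this).trans ?_
    by_cases h : m = n
    · simp [h]
    · simp [h, Ne.symm h]
  simp only [h3] at h2
  have h4 := h2.unique (hasSum_ite_eq n (a n))
  rw [mFourierBasis.repr_apply_apply, coe_mFourierBasis, ← h4]
  rfl

theorem fser_injective {a b : (Fin d → ℤ) → ℂ} (ha : Summable a) (hb : Summable b)
    (h : ∀ x, fser a x = fser b x) : a = b := by
  funext n
  rw [← mFourierCoeff_fser ha, ← mFourierCoeff_fser hb, funext h]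

theorem eq_fser (f : C(UnitAddTorus (Fin d), ℂ)) (h : Summable (mFourierCoeff f))
    (x : UnitAddTorus (Fin d)) : f x = fser (mFourierCoeff f) x :=
  ((hasSum_mFourier_series_apply_of_summable h x).tsum_eq).symm

theorem mFourier_add_single (n : Fin d → ℤ) (x : UnitAddTorus (Fin d)) (j : Fin d) (s : ℝ) :
    mFourier n (x + Pi.single j (s : UnitAddCircle)) =
      mFourier n x * Complex.exp (2 * Real.pi * Complex.I * n j * s) := by
  have h : mFourier n (x + Pi.single j (s : UnitAddCircle))
      = ∏ i, (fourier (n i) (x i) * fourier (n i) ((Pi.single j (s : UnitAddCircle) : UnitAddTorus (Fin d)) i)) := by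
    simp [mFourier, fourier_apply, smul_add, AddCircle.toCircle_add]
  rw [h, Finset.prod_mul_distrib, mFourier, ContinuousMap.coe_mk]
  congr 1
  rw [Finset.prod_eq_single j (fun i _ hi => by rw [Pi.single_eq_of_ne hi, fourier_eval_zero])
    (by simp), Pi.single_eq_same, fourier_coe_apply]
  simp

/-- Termwise differentiation of a trigonometric series in one real variable. -/
theorem hasDerivAt_tsum_mul_cexp {ι : Type*} {c : ι → ℂ} {k : ι → ℤ} (hc : Summable c)
    (hk : Summable fun n => (k n : ℂ) * c n) :
    HasDerivAt (fun s : ℝ => ∑' n, c n * Complex.exp (2 * Real.pi * Complex.I * k n * s))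
      (∑' n, 2 * Real.pi * Complex.I * k n * c n) 0 := by
  have hE : ∀ n (s : ℝ), ‖Complex.exp (2 * Real.pi * Complex.I * k n * s)‖ = 1 := fun n s => by
    rw [show (2 * Real.pi * Complex.I * k n * s : ℂ) = ((2 * Real.pi * k n * s : ℝ) : ℂ) * Complex.I by
      push_cast; ring, Complex.norm_exp_ofReal_mul_I]
  have hu : Summable fun n => 2 * Real.pi * ‖(k n : ℂ) * c n‖ := hk.norm.mul_left _
  have h := hasDerivAt_tsum (𝕜 := ℝ) (F := ℂ) (y₀ := (0 : ℝ))
    (g := fun n (s : ℝ) => c n * Complex.exp (2 * Real.pi * Complex.I * k n * s))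
    (g' := fun n (s : ℝ) => 2 * Real.pi * Complex.I * k n * c n *
      Complex.exp (2 * Real.pi * Complex.I * k n * s)) hu ?_ ?_ (by simpa using hc) 0
  · simpa using h
  · intro n s
    have h1 : HasDerivAt (fun s : ℝ => Complex.exp (2 * Real.pi * Complex.I * k n * s))
        (Complex.exp (2 * Real.pi * Complex.I * k n * s) * (2 * Real.pi * Complex.I * k n * 1)) s :=
      (((hasDerivAt_id s).ofReal_comp).const_mul (2 * Real.pi * Complex.I * k n : ℂ)).cexp
    exact (h1.const_mul (c n)).congr_deriv (by ring)
  · intro n s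
    rw [norm_mul, hE]
    simp [abs_of_pos Real.pi_pos, mul_assoc]

theorem hasDerivAt_fser {a : (Fin d → ℤ) → ℂ} (j : Fin d) (ha : Summable a)
    (ha' : Summable fun n => (n j : ℂ) * a n) (x : UnitAddTorus (Fin d)) :
    HasDerivAt (fun s : ℝ => fser a (x + Pi.single j (s : UnitAddCircle)))
      (fser (fun n => 2 * Real.pi * Complex.I * n j * a n) x) 0 := by
  simp only [fser, mFourier_add_single, ← mul_assoc]
  refine (hasDerivAt_tsum_mul_cexp (summable_mul_mFourier ha x) ?_).congr_deriv
    (tsum_congr fun n => by ring)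
  simpa only [mul_assoc] using summable_mul_mFourier ha' x

/-- The classical partial derivative of a real field is the termwise derivative of its series. -/
theorem pd_eq_fser {f : UnitAddTorus (Fin d) → ℝ} {a : (Fin d → ℤ) → ℂ} (j : Fin d)
    (hf : ∀ x, (f x : ℂ) = fser a x) (ha : Summable a)
    (ha' : Summable fun n => (n j : ℂ) * a n) (x : UnitAddTorus (Fin d)) :
    (pd j f x : ℂ) = fser (fun n => 2 * Real.pi * Complex.I * n j * a n) x := by
  have h := hasDerivAt_fser j ha ha' x
  simp only [← hf] at h
  have hre := Complex.reCLM.hasFDerivAt.comp_hasDerivAt (0 : ℝ) h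
  have hre' : HasDerivAt (fun s : ℝ => f (x + Pi.single j (s : UnitAddCircle)))
      (fser (fun n => 2 * Real.pi * Complex.I * n j * a n) x).re 0 := by simpa using! hre
  rw [pd, hre'.deriv]
  exact hre'.ofReal_comp.unique h

/-- The convolution of two sequences of coefficients. -/
def cauchy (a b : (Fin d → ℤ) → ℂ) (n : Fin d → ℤ) : ℂ := ∑' j, a j * b (n - j)

/-- The change of variables `(n, j) ↦ (j, n - j)`. -/
def subEquiv (G : Type*) [AddCommGroup G] : G × G ≃ G × G where
  toFun p := (p.2, p.1 - p.2)
  invFun p := (p.1 + p.2, p.1)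
  left_inv p := by simp
  right_inv p := by simp

theorem summable_mul_sub {G R : Type*} [AddCommGroup G] [NormedRing R] [CompleteSpace R] {a b : G → R}
    (ha : Summable fun n => ‖a n‖) (hb : Summable fun n => ‖b n‖) :
    Summable fun p : G × G => a p.2 * b (p.1 - p.2) :=
  (subEquiv G).summable_iff.mpr (summable_mul_of_summable_norm ha hb)

theorem summable_cauchy {a b : (Fin d → ℤ) → ℂ} (ha : Summable a) (hb : Summable b) :
    Summable (cauchy a b) :=
  (summable_mul_sub ha.norm hb.norm).prod

theorem fser_mul_fser {a b : (Fin d → ℤ) → ℂ} (ha : Summable a) (hb : Summable b)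
    (x : UnitAddTorus (Fin d)) : fser a x * fser b x = fser (cauchy a b) x := by
  have ha' := (summable_mul_mFourier ha x)
  have hb' := (summable_mul_mFourier hb x)
  rw [fser, fser, tsum_mul_tsum_of_summable_norm ha'.norm hb'.norm,
    ← (subEquiv (Fin d → ℤ)).tsum_eq]
  refine (summable_mul_sub ha'.norm hb'.norm).tsum_prod.trans ?_
  refine tsum_congr fun n => ?_
  rw [cauchy, ← tsum_mul_right]
  refine tsum_congr fun j => ?_
  have : mFourier n x = mFourier j x * mFourier (n - j) x := by
    rw [← mFourier_add]; simp
  rw [this]; ring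

/-! ### Frequencies -/

theorem freq_eq_norm (n : Fin d → ℤ) :
    freq n = 2 * Real.pi * ‖WithLp.toLp 2 (fun j => (n j : ℝ))‖ := by
  simp [freq, EuclideanSpace.norm_eq]

theorem freq_nonneg (n : Fin d → ℤ) : 0 ≤ freq n := by unfold freq; positivity

@[simp] theorem freq_zero : freq (0 : Fin d → ℤ) = 0 := by simp [freq]

@[simp] theorem freq_neg (n : Fin d → ℤ) : freq (-n) = freq n := by simp [freq]

theorem freq_add_le (m n : Fin d → ℤ) : freq (m + n) ≤ freq m + freq n := by
  simp only [freq_eq_norm, ← mul_add]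
  refine mul_le_mul_of_nonneg_left ?_ (by positivity)
  refine le_trans (le_of_eq ?_) (norm_add_le _ _)
  congr 1; ext j; simp

theorem freq_le_add (n j : Fin d → ℤ) : freq n ≤ freq j + freq (n - j) := by
  simpa using freq_add_le j (n - j)

theorem two_pi_mul_abs_le_freq (n : Fin d → ℤ) (j : Fin d) :
    2 * Real.pi * |(n j : ℝ)| ≤ freq n := by
  refine mul_le_mul_of_nonneg_left ?_ (by positivity)
  refine Real.le_sqrt_of_sq_le ?_
  rw [sq_abs]
  exact Finset.single_le_sum (f := fun j => (n j : ℝ) ^ 2) (fun _ _ => sq_nonneg _) (Finset.mem_univ j)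

theorem six_mul_abs_le_freq (n : Fin d → ℤ) (j : Fin d) : 6 * |(n j : ℝ)| ≤ freq n :=
  le_trans (mul_le_mul_of_nonneg_right (by linarith [Real.pi_gt_three]) (abs_nonneg _))
    (two_pi_mul_abs_le_freq n j)

theorem abs_le_freq (n : Fin d → ℤ) (j : Fin d) : |(n j : ℝ)| ≤ freq n := by
  linarith [six_mul_abs_le_freq n j, abs_nonneg (n j : ℝ)]

theorem one_le_freq {n : Fin d → ℤ} (hn : n ≠ 0) : 1 ≤ freq n := by
  obtain ⟨j, hj⟩ := Function.ne_iff.mp hn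
  have h1 : (1 : ℝ) ≤ |(n j : ℝ)| := by exact_mod_cast Int.one_le_abs hj
  linarith [six_mul_abs_le_freq n j]

theorem freq_pos {n : Fin d → ℤ} (hn : n ≠ 0) : 0 < freq n := lt_of_lt_of_le one_pos (one_le_freq hn)

theorem freq_sq (n : Fin d → ℤ) : freq n ^ 2 = 4 * Real.pi ^ 2 * ∑ j, (n j : ℝ) ^ 2 := by
  rw [freq, mul_pow, Real.sq_sqrt (Finset.sum_nonneg fun _ _ => sq_nonneg _)]; ring

/-- The lattice sum `∑ |k|^{-s}` converges for `s > 3`. -/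
theorem summable_freq_rpow {s : ℝ} (hs : 3 < s) :
    Summable fun n : Fin 3 → ℤ => freq n ^ (-s) := by
  let b := Pi.basisFun ℝ (Fin 3)
  let L : Submodule ℤ (Fin 3 → ℝ) := Submodule.span ℤ (Set.range b)
  have hfr : Module.finrank ℤ L = 3 := by
    rw [ZLattice.rank ℝ L]; simp
  have h := ZLattice.summable_norm_rpow L (-s) (by rw [hfr]; push_cast; linarith)
  have hmem : ∀ n : Fin 3 → ℤ, (fun j => (n j : ℝ)) ∈ L := by
    intro n
    have : (fun j => (n j : ℝ)) = ∑ j, n j • b j := by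
      funext k; simp [b, Pi.single_apply]
    rw [this]
    exact Submodule.sum_mem _ fun j _ => Submodule.smul_mem _ _ (Submodule.subset_span ⟨j, rfl⟩)
  have hinj : Function.Injective fun n : Fin 3 → ℤ => (⟨fun j => (n j : ℝ), hmem n⟩ : L) := by
    intro m n hmn
    funext j
    have h1 : (m j : ℝ) = n j := congrFun (congrArg Subtype.val hmn) j
    exact_mod_cast h1
  refine Summable.of_nonneg_of_le (fun n => Real.rpow_nonneg (freq_nonneg n) _) (fun n => ?_)
    (h.comp_injective hinj)
  by_cases hn : n = 0
  · subst hn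
    simp
  · simp only [Function.comp_apply]
    have hle : ‖(⟨fun j => (n j : ℝ), hmem n⟩ : L)‖ ≤ freq n := by
      change ‖fun j => (n j : ℝ)‖ ≤ _
      exact (pi_norm_le_iff_of_nonneg (freq_nonneg n)).mpr fun j => by simpa using abs_le_freq n j
    have hpos : 0 < ‖(⟨fun j => (n j : ℝ), hmem n⟩ : L)‖ := by
      rw [norm_pos_iff]
      intro h0
      exact hn (hinj (h0.trans (by ext; simp)))
    exact Real.rpow_le_rpow_of_nonpos hpos hle (by linarith)

/-- Exponential weights beat every power. -/
theorem summable_exp_freq {ε : ℝ} (hε : 0 < ε) (p : ℕ) :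
    Summable fun n : Fin 3 → ℤ => (1 + freq n) ^ p * Real.exp (-ε * freq n) := by
  -- four more powers still give a bounded function, and they pay for the lattice sum
  have hK : ∃ K : ℝ, ∀ x : ℝ, 0 ≤ x → (1 + x) ^ (p + 4) * Real.exp (-ε * x) ≤ K := by
    refine ⟨(p + 4).factorial * (1 / ε) ^ (p + 4) * Real.exp ε, fun x hx => ?_⟩
    have h := Real.pow_div_factorial_le_exp (ε * (1 + x)) (by positivity) (p + 4)
    rw [div_le_iff₀ (by positivity), mul_pow] at h
    have e1 : Real.exp (ε * (1 + x)) = Real.exp ε * Real.exp (ε * x) := by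
      rw [← Real.exp_add]; ring_nf
    have e2 : Real.exp (-ε * x) * Real.exp (ε * x) = 1 := by rw [← Real.exp_add]; simp
    have e3 : (1 / ε) ^ (p + 4) * ε ^ (p + 4) = 1 := by rw [← mul_pow]; simp [hε.ne']
    calc (1 + x) ^ (p + 4) * Real.exp (-ε * x)
        = (1 / ε) ^ (p + 4) * (ε ^ (p + 4) * (1 + x) ^ (p + 4)) * Real.exp (-ε * x) := by
          rw [← mul_assoc ((1 / ε) ^ (p + 4)), e3, one_mul]
      _ ≤ (1 / ε) ^ (p + 4) * (Real.exp (ε * (1 + x)) * (p + 4).factorial) * Real.exp (-ε * x) := by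
          gcongr
      _ = (p + 4).factorial * (1 / ε) ^ (p + 4) * Real.exp ε *
            (Real.exp (-ε * x) * Real.exp (ε * x)) := by rw [e1]; ring
      _ = _ := by rw [e2, mul_one]
  obtain ⟨K, hK⟩ := hK
  refine Summable.of_norm_bounded_eventually (g := fun n => K * freq n ^ (-4 : ℝ))
    ((summable_freq_rpow (by norm_num)).mul_left K) ?_
  rw [Filter.eventually_cofinite]
  refine (Set.finite_singleton (0 : Fin 3 → ℤ)).subset fun n hn => ?_
  by_contra h0
  apply hn
  have h1 := one_le_freq (n := n) h0
  have h2 := freq_nonneg n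
  rw [Real.norm_of_nonneg (by positivity), Real.rpow_neg h2,
    show (4 : ℝ) = (4 : ℕ) by norm_num, Real.rpow_natCast, ← div_eq_mul_inv,
    le_div_iff₀ (by positivity)]
  refine le_trans ?_ (hK (freq n) h2)
  rw [pow_add]
  calc (1 + freq n) ^ p * Real.exp (-ε * freq n) * freq n ^ 4
      ≤ (1 + freq n) ^ p * Real.exp (-ε * freq n) * (1 + freq n) ^ 4 := by gcongr; linarith
    _ = _ := by ring

/-! ### Coordinates on the torus -/

theorem pt_castSucc (x' : T2) (z : UnitAddCircle) (j : Fin 2) : pt x' z j.castSucc = x' j := by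
  unfold pt; exact Fin.snoc_castSucc (α := fun _ => UnitAddCircle) z x' j

theorem hor_pt (x' : T2) (z : UnitAddCircle) : hor (pt x' z) = x' := funext (pt_castSucc x' z)

theorem pt_hor (x : T3) : pt (hor x) (x 2) = x := Fin.snoc_init_self (α := fun _ => UnitAddCircle) x

theorem coe_rep (z : UnitAddCircle) : (rep z : UnitAddCircle) = z := AddCircle.coe_equivIco

/-- The horizontal part of a frequency. -/
def nhor (n : Fin 3 → ℤ) : Fin 2 → ℤ := fun j => n j.castSucc

/-- The frequency `(m, k)`. -/
def npt (m : Fin 2 → ℤ) (k : ℤ) : Fin 3 → ℤ := Fin.snoc (α := fun _ => ℤ) m k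

/-- The reflection `(m, k) ↦ (m, -k)` of frequencies. -/
def nflip (n : Fin 3 → ℤ) : Fin 3 → ℤ := npt (nhor n) (-n 2)

@[simp] theorem npt_castSucc (m : Fin 2 → ℤ) (k : ℤ) (j : Fin 2) : npt m k j.castSucc = m j :=
  Fin.snoc_castSucc (α := fun _ => ℤ) k m j

@[simp] theorem npt_two (m : Fin 2 → ℤ) (k : ℤ) : npt m k 2 = k := Fin.snoc_last (α := fun _ => ℤ) k m

@[simp] theorem npt_zero (m : Fin 2 → ℤ) (k : ℤ) : npt m k 0 = m 0 := npt_castSucc m k 0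

@[simp] theorem npt_one (m : Fin 2 → ℤ) (k : ℤ) : npt m k 1 = m 1 := npt_castSucc m k 1

@[simp] theorem nhor_npt (m : Fin 2 → ℤ) (k : ℤ) : nhor (npt m k) = m := funext (npt_castSucc m k)

theorem npt_nhor (n : Fin 3 → ℤ) : npt (nhor n) (n 2) = n := Fin.snoc_init_self (α := fun _ => ℤ) n

@[simp] theorem nhor_apply (n : Fin 3 → ℤ) (j : Fin 2) : nhor n j = n j.castSucc := rfl

@[simp] theorem nflip_castSucc (n : Fin 3 → ℤ) (j : Fin 2) : nflip n j.castSucc = n j.castSucc :=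
  npt_castSucc _ _ j

@[simp] theorem nhor_nflip (n : Fin 3 → ℤ) : nhor (nflip n) = nhor n := nhor_npt _ _

@[simp] theorem nflip_two (n : Fin 3 → ℤ) : nflip n 2 = -n 2 := npt_two _ _

@[simp] theorem nflip_nflip (n : Fin 3 → ℤ) : nflip (nflip n) = n := by
  rw [nflip, nhor_nflip, nflip_two, neg_neg, npt_nhor]

theorem funext_three {α : Type*} {f g : Fin 3 → α} (h : ∀ j : Fin 2, f j.castSucc = g j.castSucc)
    (h2 : f 2 = g 2) : f = g := by
  funext j
  fin_cases j
  · exact h 0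
  · exact h 1
  · exact h2

theorem nflip_sub (m n : Fin 3 → ℤ) : nflip (m - n) = nflip m - nflip n :=
  funext_three (by simp) (by simp; ring)

/-- Reflection of frequencies as a permutation. -/
def nflipEquiv : (Fin 3 → ℤ) ≃ (Fin 3 → ℤ) where
  toFun := nflip
  invFun := nflip
  left_inv := nflip_nflip
  right_inv := nflip_nflip

theorem freq_nflip (n : Fin 3 → ℤ) : freq (nflip n) = freq n := by
  have h0 := nflip_castSucc n 0
  have h1 := nflip_castSucc n 1
  simp only [Fin.castSucc_zero, Fin.castSucc_one] at h0 h1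
  simp [freq, Fin.sum_univ_three, h0, h1]

theorem mFourier_pt (n : Fin 3 → ℤ) (x' : T2) (z : UnitAddCircle) :
    mFourier n (pt x' z) = mFourier (nhor n) x' * fourier (n 2) z := by
  rw [mFourier, ContinuousMap.coe_mk, Fin.prod_univ_castSucc]
  congr 1

theorem npt_injective : Function.Injective fun m : Fin 2 → ℤ => npt m 0 := fun m m' h => by
  simpa using congrArg nhor h

/-- Integration of a character over `[0, r]`. -/
theorem integral_fourier (k : ℤ) (r : ℝ) :
    ∫ s in (0 : ℝ)..r, fourier k (s : UnitAddCircle) =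
      if k = 0 then (r : ℂ) else (fourier k (r : UnitAddCircle) - 1) / (2 * Real.pi * Complex.I * k) := by
  split_ifs with hk
  · subst hk; simp
  · have hc : (2 * Real.pi * Complex.I * k : ℂ) ≠ 0 := by
      simp [Real.pi_ne_zero, hk]
    simp only [fourier_coe_apply, Complex.ofReal_one, div_one]
    rw [integral_exp_mul_complex hc]
    simp

/-- Termwise integration of a trigonometric series in the vertical variable. -/
theorem integral_fser_pt {b : (Fin 3 → ℤ) → ℂ} (hb : Summable b) (x' : T2) (r : ℝ) :
    ∫ s in (0 : ℝ)..r, fser b (pt x' (s : UnitAddCircle)) =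
      ∑' n, b n * mFourier (nhor n) x' * ∫ s in (0 : ℝ)..r, fourier (n 2) (s : UnitAddCircle) := by
  have hcont : ∀ n : Fin 3 → ℤ, Continuous fun s : ℝ =>
      b n * mFourier n (pt x' (s : UnitAddCircle)) := fun n => by
    simp only [mFourier_pt]
    exact (((fourier (n 2)).continuous.comp (AddCircle.continuous_mk' 1)).const_mul _).const_mul _
  have h := intervalIntegral.hasSum_integral_of_dominated_convergence (μ := volume) (a := 0) (b := r)
    (F := fun n (s : ℝ) => b n * mFourier n (pt x' (s : UnitAddCircle)))
    (f := fun s : ℝ => fser b (pt x' (s : UnitAddCircle))) (fun n _ => ‖b n‖)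
    (fun n => (hcont n).aestronglyMeasurable)
    (fun n => .of_forall fun s _ => (norm_mul_mFourier _ _ _).le)
    (.of_forall fun _ _ => hb.norm) (by simp)
    (.of_forall fun s _ => (summable_mul_mFourier hb _).hasSum)
  rw [← h.tsum_eq]
  refine tsum_congr fun n => ?_
  simp only [mFourier_pt, ← mul_assoc]
  rw [intervalIntegral.integral_const_mul]

/-- The barotropic part keeps the frequencies with vanishing vertical component. -/
theorem barotropic_eq_fser {F : T3 → Fin 2 → ℝ} {i : Fin 2} {b : (Fin 3 → ℤ) → ℂ}
    (hF : ∀ x, (F x i : ℂ) = fser b x) (hb : Summable b) (x' : T2) :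
    (barotropic F x' i : ℂ) = fser (fun m => b (npt m 0)) x' := by
  rw [barotropic, ← intervalIntegral.integral_ofReal]
  simp only [hF]
  rw [integral_fser_pt hb, fser]
  have h1 : ∀ k : ℤ, ∫ s in (0 : ℝ)..1, fourier k (s : UnitAddCircle) = if k = 0 then 1 else 0 := by
    intro k
    rw [integral_fourier]
    split_ifs
    · simp
    · simp
      exact Or.inl (sub_eq_zero.mpr (Complex.exp_eq_one_iff.mpr ⟨k, by ring⟩))
  simp only [h1]
  have h2 := npt_injective.tsum_eq (f := fun n => b n * mFourier (nhor n) x' * if n 2 = 0 then 1 else 0)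
    (fun n hn => ⟨nhor n, by
      have : n 2 = 0 := by by_contra h; simp [h] at hn
      simp only; rw [← this, npt_nhor]⟩)
  rw [← h2]
  simp

/-! ### Sequences of coefficients -/

/-- Sequences of Fourier coefficients of horizontal velocity fields. -/
abbrev Coef : Type := (Fin 3 → ℤ) → Fin 2 → ℂ

/-- The sum `∑ (1 + |k|)^p |a_k|` is finite. -/
def Wt (p : ℕ) (a : Coef) : Prop := Summable fun n => (1 + freq n) ^ p * ‖a n‖

/-- The pairing `n' · a_n` of the horizontal part of the frequency with the coefficient. -/
def hdot (a : Coef) (n : Fin 3 → ℤ) : ℂ := ∑ h : Fin 2, (n h.castSucc : ℂ) * a n h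

/-- The symmetries of the Fourier coefficients of fields in `H`: reality, zero mean, evenness in
the vertical variable, and vanishing divergence of the barotropic part. -/
structure CoefH (a : Coef) : Prop where
  real : ∀ n i, a (-n) i = (starRingEnd ℂ) (a n i)
  zero : a 0 = 0
  even : ∀ n, a (nflip n) = a n
  div : ∀ n : Fin 3 → ℤ, n 2 = 0 → hdot a n = 0

theorem Wt.mono {p q : ℕ} {a : Coef} (h : Wt p a) (hqp : q ≤ p) : Wt q a := by
  refine Summable.of_nonneg_of_le (fun n => ?_) (fun n => ?_) h
  · have := freq_nonneg n; positivity
  · have := freq_nonneg n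
    gcongr
    linarith

theorem Wt.summable_mul {p : ℕ} {a : Coef} (h : Wt p a) (i : Fin 2) {c : (Fin 3 → ℤ) → ℂ}
    {K : ℝ} (hc : ∀ n, ‖c n‖ ≤ K * (1 + freq n) ^ p) : Summable fun n => c n * a n i := by
  refine Summable.of_norm_bounded (h.mul_left K) fun n => ?_
  rw [norm_mul, ← mul_assoc]
  have h0 : 0 ≤ K * (1 + freq n) ^ p := (norm_nonneg _).trans (hc n)
  exact mul_le_mul (hc n) (norm_le_pi_norm _ _) (norm_nonneg _) h0

theorem Wt.summable {p : ℕ} {a : Coef} (h : Wt p a) (i : Fin 2) : Summable fun n => a n i := by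
  simpa using (h.mono (Nat.zero_le p)).summable_mul i (c := fun _ => 1) (K := 1) (by simp)

theorem norm_intCast_le_freq (n : Fin d → ℤ) (j : Fin d) : ‖(n j : ℂ)‖ ≤ freq n := by
  simpa using abs_le_freq n j

theorem Wt.summable_intCast_mul {a : Coef} (h : Wt 1 a) (i : Fin 2) (j : Fin 3) :
    Summable fun n => (n j : ℂ) * a n i :=
  h.summable_mul i (K := 1) fun n => by
    rw [pow_one, one_mul]; linarith [norm_intCast_le_freq n j]

theorem Wt.summable_deriv {a : Coef} (h : Wt 1 a) (i : Fin 2) (j : Fin 3) :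
    Summable fun n => 2 * Real.pi * Complex.I * n j * a n i := by
  simpa only [mul_assoc] using (h.summable_intCast_mul i j).mul_left (2 * Real.pi * Complex.I)

theorem norm_hdot_le (a : Coef) (n : Fin 3 → ℤ) : ‖hdot a n‖ ≤ 1 / 3 * freq n * ‖a n‖ := by
  refine (norm_sum_le _ _).trans ?_
  rw [Fin.sum_univ_two]
  have h : ∀ h : Fin 2, ‖(n h.castSucc : ℂ) * a n h‖ ≤ 1 / 6 * freq n * ‖a n‖ := fun h => by
    rw [norm_mul]
    refine mul_le_mul ?_ (norm_le_pi_norm _ _) (norm_nonneg _) (by linarith [freq_nonneg n])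
    have := six_mul_abs_le_freq n h.castSucc
    simp only [Complex.norm_intCast]
    linarith
  linarith [h 0, h 1]

/-- The Fourier coefficients `-(n' · a_n) / n₃` of the vertical velocity; for `n₃ = 0` the
convention `x / 0 = 0` gives the right value, as `w(U)` is odd in the vertical variable. -/
def wc (a : Coef) (n : Fin 3 → ℤ) : ℂ := -hdot a n / n 2

theorem norm_wc_le (a : Coef) (n : Fin 3 → ℤ) : ‖wc a n‖ ≤ 1 / 3 * freq n * ‖a n‖ := by
  rw [wc, norm_div, norm_neg]
  by_cases h : n 2 = 0
  · have := freq_nonneg n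
    simp only [h, Int.cast_zero, norm_zero, div_zero]; positivity
  · have : (1 : ℝ) ≤ ‖(n 2 : ℂ)‖ := by
      rw [Complex.norm_intCast]; exact_mod_cast Int.one_le_abs h
    exact (div_le_self (norm_nonneg _) this).trans (norm_hdot_le a n)

theorem Wt.summable_wc {a : Coef} (h : Wt 1 a) : Summable (wc a) := by
  refine Summable.of_norm_bounded (g := fun n => (1 + freq n) ^ 1 * ‖a n‖) h fun n => ?_
  refine (norm_wc_le a n).trans (mul_le_mul_of_nonneg_right ?_ (norm_nonneg _))
  linarith [freq_nonneg n]

/-! ### Reality of trigonometric series -/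

theorem conj_fser (c : (Fin d → ℤ) → ℂ) (x : UnitAddTorus (Fin d)) :
    (starRingEnd ℂ) (fser c x) = fser (fun n => (starRingEnd ℂ) (c (-n))) x := by
  rw [fser, Complex.conj_tsum, fser, ← (Equiv.neg (Fin d → ℤ)).tsum_eq]
  refine tsum_congr fun n => ?_
  rw [Equiv.neg_apply, map_mul, mFourier_neg, Complex.conj_conj]

/-- Hermitian coefficients give a real function. -/
theorem ofReal_re_fser {c : (Fin d → ℤ) → ℂ} (hc : ∀ n, c (-n) = (starRingEnd ℂ) (c n))
    (x : UnitAddTorus (Fin d)) : ((fser c x).re : ℂ) = fser c x := by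
  refine Complex.conj_eq_iff_re.mp ?_
  rw [conj_fser]
  congr 1
  funext n
  rw [hc, Complex.conj_conj]

/-- Real functions have Hermitian coefficients. -/
theorem coeff_neg_of_real {f : UnitAddTorus (Fin d) → ℝ} {c : (Fin d → ℤ) → ℂ}
    (hf : ∀ x, (f x : ℂ) = fser c x) (hc : Summable c) (n : Fin d → ℤ) :
    c (-n) = (starRingEnd ℂ) (c n) := by
  have hc' : Summable fun n => (starRingEnd ℂ) (c (-n)) :=
    .of_norm (by simpa using ((Equiv.neg (Fin d → ℤ)).summable_iff.mpr hc).norm)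
  have h := fser_injective hc hc' fun x => by rw [← conj_fser, ← hf, Complex.conj_ofReal]
  simpa using congrFun h (-n)

/-- A series over the horizontal torus is a series over `𝕋³`. -/
theorem fser_hor (e : (Fin 2 → ℤ) → ℂ) (x : T3) :
    fser e (hor x) = fser (fun n : Fin 3 → ℤ => if n 2 = 0 then e (nhor n) else 0) x := by
  rw [fser, fser]
  have h2 := npt_injective.tsum_eq
    (f := fun n => (if n 2 = 0 then e (nhor n) else 0) * mFourier n x) (fun n hn => ⟨nhor n, by
      have : n 2 = 0 := by by_contra h; simp [h] at hn
      simp only; rw [← this, npt_nhor]⟩)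
  rw [← h2]
  refine tsum_congr fun m => ?_
  conv_rhs => rw [← pt_hor x]
  rw [mFourier_pt]
  simp

/-! ### The vertical velocity and the bilinear form -/

theorem divH_eq_fser {F : T3 → Fin 2 → ℝ} {a : Coef} (hF : ∀ x i, (F x i : ℂ) = fser (a · i) x)
    (ha : Wt 1 a) (x : T3) :
    (divH F x : ℂ) = fser (fun n => 2 * Real.pi * Complex.I * hdot a n) x := by
  have hs := fun j : Fin 2 => summable_mul_mFourier (ha.summable_deriv j j.castSucc) x
  simp only [divH, Complex.ofReal_sum]
  rw [Finset.sum_congr rfl fun j _ => pd_eq_fser (f := fun y => F y j) j.castSucc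
    (fun y => hF y j) (ha.summable j) (ha.summable_intCast_mul j j.castSucc) x]
  simp only [fser]
  rw [← Summable.tsum_finsetSum fun j _ => hs j]
  refine tsum_congr fun n => ?_
  simp only [hdot, Finset.mul_sum, Finset.sum_mul, mul_assoc]

/-- The vertical velocity on the Fourier side. The integral from `0` to `z` of each mode is a
difference of two characters; evenness makes the contributions at `z = 0` cancel. -/
theorem vertVel_eq_fser {F : T3 → Fin 2 → ℝ} {a : Coef}
    (hF : ∀ x i, (F x i : ℂ) = fser (a · i) x) (ha : Wt 1 a) (hH : CoefH a) (x : T3) :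
    (vertVel F x : ℂ) = fser (wc a) x := by
  have hd : Summable fun n => 2 * Real.pi * Complex.I * hdot a n := by
    refine Summable.mul_left _ (.of_norm_bounded (g := fun n => (1 + freq n) ^ 1 * ‖a n‖) ha fun n => ?_)
    refine (norm_hdot_le a n).trans (mul_le_mul_of_nonneg_right ?_ (norm_nonneg _))
    linarith [freq_nonneg n]
  rw [vertVel, Complex.ofReal_neg, ← intervalIntegral.integral_ofReal]
  simp only [divH_eq_fser hF ha]
  rw [integral_fser_pt hd]
  have hterm : ∀ n : Fin 3 → ℤ, 2 * Real.pi * Complex.I * hdot a n * mFourier (nhor n) (hor x) *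
      ∫ s in (0 : ℝ)..rep (x 2), fourier (n 2) (s : UnitAddCircle)
      = wc a n * mFourier (nhor n) (hor x) - wc a n * mFourier n x := by
    intro n
    conv_rhs => rw [← pt_hor x, mFourier_pt, hor_pt]
    rw [integral_fourier, coe_rep]
    split_ifs with h
    · simp [hH.div n h, wc]
    · have h2 : (n 2 : ℂ) ≠ 0 := by exact_mod_cast h
      have hpi : (Real.pi : ℂ) ≠ 0 := by exact_mod_cast Real.pi_ne_zero
      rw [wc]
      field_simp
      ring
  simp only [hterm]
  have hs1 : Summable fun n => wc a n * mFourier (nhor n) (hor x) :=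
    .of_norm (by simpa only [norm_mul_mFourier] using ha.summable_wc.norm)
  -- the values at `z = 0` sum to zero, because the coefficients are odd in the last frequency
  have hodd : ∑' n, wc a n * mFourier (nhor n) (hor x) = 0 := by
    have h := nflipEquiv.tsum_eq fun n => wc a n * mFourier (nhor n) (hor x)
    have h' : ∀ n, wc a (nflipEquiv n) * mFourier (nhor (nflipEquiv n)) (hor x)
        = -(wc a n * mFourier (nhor n) (hor x)) := fun n => by
      simp only [nflipEquiv, Equiv.coe_fn_mk, nhor_nflip, wc, nflip_two, hdot, hH.even,
        nflip_castSucc]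
      push_cast
      rw [div_neg]; ring
    simp only [h', tsum_neg] at h
    exact self_eq_neg.mp h.symm
  rw [hs1.tsum_sub (summable_mul_mFourier ha.summable_wc x), hodd, zero_sub, neg_neg, fser]

/-- The symbol of `U · ∇_h + w(U) ∂_z`, at the frequency `j` of `U` and the frequency `l` of the
field on which the operator acts. -/
def kern (a : Coef) (j l : Fin 3 → ℤ) : ℂ :=
  2 * Real.pi * Complex.I * (∑ h : Fin 2, a j h * l h.castSucc + wc a j * l 2)

/-- The Fourier coefficients of `Q(U, V)`. -/
def conv (a b : Coef) : Coef := fun n i => ∑' j, kern a j (n - j) * b (n - j) i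

/-- The anisotropy of the nonlinearity costs one derivative on the transporting field, through
`w(U)`, and one on the transported field. -/
theorem norm_kern_le {a : Coef} (h0 : a 0 = 0) (j l : Fin 3 → ℤ) :
    ‖kern a j l‖ ≤ 3 * freq j * ‖a j‖ * freq l := by
  by_cases hj : j = 0
  · subst hj; simp [kern, h0, wc, hdot]
  have h1 := one_le_freq hj
  have hl := freq_nonneg l
  have hpi := Real.pi_pos
  have hb : ∀ i : Fin 3, 2 * Real.pi * ‖(l i : ℂ)‖ ≤ freq l := fun i => by
    rw [Complex.norm_intCast]; exact two_pi_mul_abs_le_freq l i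
  have ha : ∀ h : Fin 2, 2 * Real.pi * ‖a j h * l h.castSucc‖ ≤ ‖a j‖ * freq l := fun h => by
    rw [norm_mul]
    calc 2 * Real.pi * (‖a j h‖ * ‖(l h.castSucc : ℂ)‖)
        = ‖a j h‖ * (2 * Real.pi * ‖(l h.castSucc : ℂ)‖) := by ring
      _ ≤ _ := mul_le_mul (norm_le_pi_norm _ _) (hb _) (by positivity) (norm_nonneg _)
  have hw : 2 * Real.pi * ‖wc a j * l 2‖ ≤ 1 / 3 * freq j * ‖a j‖ * freq l := by
    rw [norm_mul]
    calc 2 * Real.pi * (‖wc a j‖ * ‖(l 2 : ℂ)‖) = ‖wc a j‖ * (2 * Real.pi * ‖(l 2 : ℂ)‖) := by ring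
      _ ≤ _ := mul_le_mul (norm_wc_le a j) (hb _) (by positivity) (by positivity)
  have h2pi : ‖(2 * Real.pi * Complex.I : ℂ)‖ = 2 * Real.pi := by
    simp [abs_of_pos hpi]
  rw [kern, norm_mul, h2pi, Fin.sum_univ_two]
  have ht := norm_add₃_le (a := a j 0 * l (Fin.castSucc 0)) (b := a j 1 * l (Fin.castSucc 1))
    (c := wc a j * l 2)
  have hal : 0 ≤ ‖a j‖ * freq l := by positivity
  calc _ ≤ 2 * Real.pi * (‖a j 0 * l (Fin.castSucc 0)‖ + ‖a j 1 * l (Fin.castSucc 1)‖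
        + ‖wc a j * l 2‖) := by gcongr
    _ ≤ ‖a j‖ * freq l + ‖a j‖ * freq l + 1 / 3 * freq j * ‖a j‖ * freq l := by
      linarith [ha 0, ha 1]
    _ ≤ _ := by nlinarith

theorem norm_kern_mul_le {a : Coef} (h0 : a 0 = 0) (b : Coef) (n j : Fin 3 → ℤ) (i : Fin 2) :
    ‖kern a j (n - j) * b (n - j) i‖
      ≤ 3 * ((freq j * ‖a j‖) * (freq (n - j) * ‖b (n - j)‖)) := by
  rw [norm_mul]
  have := freq_nonneg j
  have := freq_nonneg (n - j)
  calc _ ≤ 3 * freq j * ‖a j‖ * freq (n - j) * ‖b (n - j)‖ :=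
        mul_le_mul (norm_kern_le h0 _ _) (norm_le_pi_norm _ _) (norm_nonneg _) (by positivity)
    _ = _ := by ring

theorem Wt.summable_freq_mul {p : ℕ} {a : Coef} (h : Wt (p + 1) a) :
    Summable fun n => (1 + freq n) ^ p * (freq n * ‖a n‖) := by
  refine Summable.of_nonneg_of_le (fun n => ?_) (fun n => ?_) h
  · have := freq_nonneg n; positivity
  · have := freq_nonneg n
    rw [← mul_assoc, pow_succ]
    gcongr
    linarith

theorem Wt.summable_kern {a b : Coef} (ha : Wt 1 a) (hb : Wt 1 b) (h0 : a 0 = 0)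
    (n : Fin 3 → ℤ) (i : Fin 2) : Summable fun j => kern a j (n - j) * b (n - j) i := by
  have ha' : Summable fun n => freq n * ‖a n‖ := by simpa using Wt.summable_freq_mul (p := 0) ha
  have hb' : Summable fun n => freq n * ‖b n‖ := by simpa using Wt.summable_freq_mul (p := 0) hb
  have hs := ((summable_mul_sub ha'.norm hb'.norm).prod_factor n).mul_left 3
  exact Summable.of_norm_bounded hs fun j => norm_kern_mul_le h0 b n j i

theorem norm_conv_le {a b : Coef} (ha : Wt 1 a) (hb : Wt 1 b) (h0 : a 0 = 0)
    (n : Fin 3 → ℤ) :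
    ‖conv a b n‖ ≤ 3 * ∑' j, (freq j * ‖a j‖) * (freq (n - j) * ‖b (n - j)‖) := by
  have ha' : Summable fun n => freq n * ‖a n‖ := by simpa using Wt.summable_freq_mul (p := 0) ha
  have hb' : Summable fun n => freq n * ‖b n‖ := by simpa using Wt.summable_freq_mul (p := 0) hb
  have hs := ((summable_mul_sub ha'.norm hb'.norm).prod_factor n).mul_left 3
  have hnn : 0 ≤ 3 * ∑' j, (freq j * ‖a j‖) * (freq (n - j) * ‖b (n - j)‖) :=
    mul_nonneg (by norm_num) (tsum_nonneg fun j => by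
      have := freq_nonneg j; have := freq_nonneg (n - j); positivity)
  refine (pi_norm_le_iff_of_nonneg hnn).mpr fun i => ?_
  rw [← tsum_mul_left]
  exact tsum_of_norm_bounded hs.hasSum fun j => norm_kern_mul_le h0 b n j i

theorem one_add_freq_pow_le (p : ℕ) (n j : Fin 3 → ℤ) :
    (1 + freq n) ^ p ≤ (1 + freq j) ^ p * (1 + freq (n - j)) ^ p := by
  have h1 := freq_nonneg j
  have h2 := freq_nonneg (n - j)
  have h3 := freq_nonneg n
  rw [← mul_pow]
  refine pow_le_pow_left₀ (by positivity) ?_ p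
  nlinarith [freq_le_add n j, mul_nonneg h1 h2]

/-- The bilinear form loses one derivative on the scale of weighted `ℓ¹` spaces. -/
theorem Wt.conv {p : ℕ} {a b : Coef} (ha : Wt (p + 1) a) (hb : Wt (p + 1) b) (h0 : a 0 = 0) :
    Wt p (conv a b) := by
  have hs := summable_mul_sub ha.summable_freq_mul.norm hb.summable_freq_mul.norm
  refine Summable.of_nonneg_of_le (fun n => ?_) (fun n => ?_) (hs.prod.mul_left 3)
  · have := freq_nonneg n; positivity
  · have hn := freq_nonneg n
    have hle := norm_conv_le (ha.mono (by omega)) (hb.mono (by omega)) h0 n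
    calc (1 + freq n) ^ p * ‖PE.conv a b n‖
        ≤ (1 + freq n) ^ p * (3 * ∑' j, (freq j * ‖a j‖) * (freq (n - j) * ‖b (n - j)‖)) := by
          gcongr
      _ = 3 * ∑' j, (1 + freq n) ^ p * ((freq j * ‖a j‖) * (freq (n - j) * ‖b (n - j)‖)) := by
          rw [tsum_mul_left]; ring
      _ ≤ _ := by
          have hle : ∀ j, (1 + freq n) ^ p * ((freq j * ‖a j‖) * (freq (n - j) * ‖b (n - j)‖))
              ≤ (1 + freq j) ^ p * (freq j * ‖a j‖) *
                ((1 + freq (n - j)) ^ p * (freq (n - j) * ‖b (n - j)‖)) := fun j => by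
            have := freq_nonneg j
            have := freq_nonneg (n - j)
            calc _ ≤ ((1 + freq j) ^ p * (1 + freq (n - j)) ^ p) *
                  ((freq j * ‖a j‖) * (freq (n - j) * ‖b (n - j)‖)) := by
                  gcongr; exact one_add_freq_pow_le p n j
              _ = _ := by ring
          have hnn : ∀ j, 0 ≤ (1 + freq n) ^ p * ((freq j * ‖a j‖) * (freq (n - j) * ‖b (n - j)‖)) :=
            fun j => by
              have := freq_nonneg j
              have := freq_nonneg (n - j)
              positivity
          gcongr 3 * ?_
          exact Summable.tsum_le_tsum hle
            (.of_nonneg_of_le hnn hle (hs.prod_factor n)) (hs.prod_factor n)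

theorem conv_eq_cauchy {a b : Coef} (ha : Wt 1 a) (hb : Wt 1 b) (n : Fin 3 → ℤ) (i : Fin 2) :
    conv a b n i =
      ∑ h : Fin 2, cauchy (a · h) (fun l => 2 * Real.pi * Complex.I * l h.castSucc * b l i) n
      + cauchy (wc a) (fun l => 2 * Real.pi * Complex.I * l 2 * b l i) n := by
  have hs : ∀ h : Fin 2, Summable fun j => a j h *
      (2 * Real.pi * Complex.I * ((n - j) h.castSucc : ℤ) * b (n - j) i) := fun h =>
    (summable_mul_sub (ha.summable h).norm (hb.summable_deriv i h.castSucc).norm).prod_factor n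
  have hw : Summable fun j => wc a j * (2 * Real.pi * Complex.I * ((n - j) 2 : ℤ) * b (n - j) i) :=
    (summable_mul_sub ha.summable_wc.norm (hb.summable_deriv i 2).norm).prod_factor n
  simp only [cauchy]
  rw [← Summable.tsum_finsetSum fun h _ => hs h, ← (summable_sum fun h _ => hs h).tsum_add hw]
  refine tsum_congr fun j => ?_
  simp only [kern, Fin.sum_univ_two]
  ring

/-- `Q(U, V)` has the Fourier coefficients `conv a b`. -/
theorem Q_eq_fser {F G : T3 → Fin 2 → ℝ} {a b : Coef}
    (hF : ∀ x i, (F x i : ℂ) = fser (a · i) x) (hG : ∀ x i, (G x i : ℂ) = fser (b · i) x)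
    (ha : Wt 1 a) (hH : CoefH a) (hb : Wt 1 b) (x : T3) (i : Fin 2) :
    (Q F G x i : ℂ) = fser (conv a b · i) x := by
  have hpd : ∀ j : Fin 3, (pd j (fun y => G y i) x : ℂ)
      = fser (fun n => 2 * Real.pi * Complex.I * n j * b n i) x := fun j =>
    pd_eq_fser j (fun y => hG y i) (hb.summable i) (hb.summable_intCast_mul i j) x
  rw [Q]
  push_cast
  simp only [hpd, vertVel_eq_fser hF ha hH, hF]
  rw [fser_mul_fser ha.summable_wc (hb.summable_deriv i 2)]
  simp only [fser_mul_fser (ha.summable _) (hb.summable_deriv i _)]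
  simp only [fser, conv_eq_cauchy ha hb, add_mul, Finset.sum_mul]
  have hs : ∀ h : Fin 2, Summable fun n => cauchy (a · h)
      (fun l => 2 * Real.pi * Complex.I * l h.castSucc * b l i) n * mFourier n x := fun h =>
    summable_mul_mFourier (summable_cauchy (ha.summable h) (hb.summable_deriv i _)) x
  rw [(summable_sum fun h _ => hs h).tsum_add (summable_mul_mFourier
    (summable_cauchy ha.summable_wc (hb.summable_deriv i 2)) x), Summable.tsum_finsetSum fun h _ => hs h]

/-! ### The hydrostatic Leray projection -/

/-- The symbol of the hydrostatic Leray projection: at horizontal frequencies, the projection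
onto the complement of the frequency (at `n = 0` the identity, as `x / 0 = 0`). -/
def lerayc (n : Fin 3 → ℤ) (v : Fin 2 → ℂ) (i : Fin 2) : ℂ :=
  if n 2 = 0 then
    v i - n i.castSucc * (∑ h : Fin 2, (n h.castSucc : ℂ) * v h) / (∑ h : Fin 2, (n h.castSucc : ℂ) ^ 2)
  else v i

theorem div2_eq_fser {g : T2 → Fin 2 → ℝ} {β : (Fin 2 → ℤ) → Fin 2 → ℂ}
    (hg : ∀ x i, (g x i : ℂ) = fser (β · i) x) (hβ : ∀ i, Summable (β · i))
    (hβ' : ∀ i j, Summable fun m => (m j : ℂ) * β m i) (x : T2) :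
    (div2 g x : ℂ) = fser (fun m => 2 * Real.pi * Complex.I * ∑ h, (m h : ℂ) * β m h) x := by
  have hs := fun j : Fin 2 => summable_mul_mFourier
    (by simpa only [mul_assoc] using (hβ' j j).mul_left (2 * Real.pi * Complex.I) :
      Summable fun m => 2 * Real.pi * Complex.I * m j * β m j) x
  simp only [div2, Complex.ofReal_sum]
  rw [Finset.sum_congr rfl fun j _ => pd_eq_fser (f := fun y => g y j) j
    (fun y => hg y j) (hβ j) (hβ' j j) x]
  simp only [fser]
  rw [← Summable.tsum_finsetSum fun j _ => hs j]
  refine tsum_congr fun n => ?_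
  simp only [Finset.mul_sum, Finset.sum_mul, mul_assoc]

theorem norm_inv_freq_sq_le (m : Fin 2 → ℤ) :
    ‖(if m = 0 then 0 else -((freq m : ℂ) ^ 2)⁻¹ : ℂ)‖ * freq m ≤ 1 := by
  split_ifs with h
  · simp
  · have h1 := one_le_freq h
    rw [norm_neg, norm_inv, norm_pow, Complex.norm_real, Real.norm_of_nonneg (freq_nonneg m), sq,
      mul_inv, mul_assoc, inv_mul_cancel₀ (by positivity), mul_one]
    exact inv_le_one_of_one_le₀ h1

/-- The gradient of `Δ_h⁻¹ ∇_h · g`. -/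
theorem pd_invLap_div2 {g : T2 → Fin 2 → ℝ} {β : (Fin 2 → ℤ) → Fin 2 → ℂ}
    (hg : ∀ x i, (g x i : ℂ) = fser (β · i) x) (hβ : ∀ i, Summable (β · i))
    (hβ' : ∀ i j, Summable fun m => (m j : ℂ) * β m i) (x : T2) (i : Fin 2) :
    (pd i (invLap (div2 g)) x : ℂ) =
      fser (fun m => m i * (∑ h, (m h : ℂ) * β m h) / ∑ h, (m h : ℂ) ^ 2) x := by
  set c : (Fin 2 → ℤ) → ℂ := fun m => (if m = 0 then 0 else -((freq m : ℂ) ^ 2)⁻¹) *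
    (2 * Real.pi * Complex.I * ∑ h, (m h : ℂ) * β m h)
  have hdiv := div2_eq_fser hg hβ hβ'
  have hD : Summable fun m : Fin 2 → ℤ => 2 * Real.pi * Complex.I * ∑ h, (m h : ℂ) * β m h :=
    (summable_sum fun h _ => hβ' h h).mul_left _
  have hc' : ∀ j : Fin 2, Summable fun m => (m j : ℂ) * c m := fun j => by
    refine Summable.of_norm_bounded hD.norm fun m => ?_
    rw [norm_mul, norm_mul, ← mul_assoc]
    refine mul_le_of_le_one_left (norm_nonneg _) ?_
    rw [mul_comm]
    exact le_trans (mul_le_mul_of_nonneg_left (norm_intCast_le_freq m j) (norm_nonneg _))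
      (norm_inv_freq_sq_le m)
  have hc : Summable c := by
    refine Summable.of_norm_bounded hD.norm fun m => ?_
    rw [norm_mul]
    refine mul_le_of_le_one_left (norm_nonneg _) ?_
    by_cases h : m = 0
    · simp [h]
    · have h1 := one_le_freq h
      have h2 := norm_inv_freq_sq_le m
      nlinarith [norm_nonneg (if m = 0 then 0 else -((freq m : ℂ) ^ 2)⁻¹ : ℂ)]
  have hcoef : ∀ m, mFourierCoeff (fun y => (div2 g y : ℂ)) m
      = 2 * Real.pi * Complex.I * ∑ h, (m h : ℂ) * β m h := fun m => by
    rw [← mFourierCoeff_fser hD m]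
    congr 1
    exact funext hdiv
  have hreal : ∀ m, c (-m) = (starRingEnd ℂ) (c m) := fun m => by
    have h1 := coeff_neg_of_real hdiv hD m
    simp only [c] at h1 ⊢
    rw [h1, map_mul]
    by_cases h : m = 0
    · simp [h]
    · simp [h]
  have hinv : ∀ y, (invLap (div2 g) y : ℂ) = fser c y := fun y => by
    rw [← ofReal_re_fser hreal, invLap]
    simp only [hcoef]
    rfl
  rw [pd_eq_fser i hinv hc (hc' i)]
  congr 1
  funext m
  simp only [c]
  by_cases h : m = 0
  · simp [h]
  · have hpi : (Real.pi : ℂ) ≠ 0 := by exact_mod_cast Real.pi_ne_zero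
    have hf : (freq m : ℂ) ^ 2 = 4 * Real.pi ^ 2 * ∑ h, (m h : ℂ) ^ 2 := by
      have := freq_sq m
      exact_mod_cast this
    have hS : (∑ h, (m h : ℂ) ^ 2) ≠ 0 := by
      intro h0
      rw [h0, mul_zero] at hf
      exact (freq_pos h).ne' (by exact_mod_cast pow_eq_zero_iff two_ne_zero |>.mp hf)
    rw [if_neg h, hf]
    field_simp
    rw [Complex.I_sq]; ring

/-- The hydrostatic Leray projection acts on coefficients by the symbol `lerayc`. -/
theorem hydroLeray_eq_fser {F : T3 → Fin 2 → ℝ} {b : Coef}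
    (hF : ∀ x i, (F x i : ℂ) = fser (b · i) x) (hb : Wt 1 b) (x : T3) (i : Fin 2) :
    (hydroLeray F x i : ℂ) = fser (fun n => lerayc n (b n) i) x := by
  have hbar : ∀ x' i, (barotropic F x' i : ℂ) = fser (fun m => b (npt m 0) i) x' := fun x' i =>
    barotropic_eq_fser (fun x => hF x i) (hb.summable i) x'
  have h1 := pd_invLap_div2 (β := fun m => b (npt m 0)) hbar
    (fun i => (hb.summable i).comp_injective npt_injective)
    (fun i j => by
      have := (hb.summable_intCast_mul i j.castSucc).comp_injective npt_injective
      simpa [Function.comp_def] using this) (hor x) i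
  have h2 : hydroLeray F x i = F x i - pd i (invLap (div2 (barotropic F))) (hor x) := by
    simp only [hydroLeray, leray2, baroclinic]; ring
  rw [h2, Complex.ofReal_sub, h1, hF, fser_hor]
  have hs : Summable fun n : Fin 3 → ℤ => if n 2 = 0 then (nhor n i : ℂ) *
      (∑ h, (nhor n h : ℂ) * b (npt (nhor n) 0) h) / ∑ h, (nhor n h : ℂ) ^ 2 else 0 := by
    refine Summable.of_norm_bounded (g := fun n => (1 + freq n) ^ 1 * ‖b n‖) hb fun n => ?_
    have hf := freq_nonneg n
    split_ifs with h
    · have e : b (npt (nhor n) 0) = b n := by rw [← h, npt_nhor]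
      by_cases hz : ∑ h, (nhor n h : ℂ) ^ 2 = 0
      · rw [hz, div_zero, norm_zero]; positivity
      have hone : (1 : ℝ) ≤ ‖∑ h, (nhor n h : ℂ) ^ 2‖ := by
        have : (∑ h, (nhor n h : ℂ) ^ 2) = ((∑ h, nhor n h ^ 2 : ℤ) : ℂ) := by push_cast; rfl
        rw [this, Complex.norm_intCast]
        exact_mod_cast Int.one_le_abs (by intro h0; exact hz (by rw [this, h0]; simp))
      have hsq : ‖(nhor n i : ℂ)‖ ≤ ‖∑ h, (nhor n h : ℂ) ^ 2‖ := by
        have : (∑ h, (nhor n h : ℂ) ^ 2) = ((∑ h, nhor n h ^ 2 : ℤ) : ℂ) := by push_cast; rfl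
        rw [this, Complex.norm_intCast, Complex.norm_intCast]
        have h3 : |nhor n i| ≤ ∑ h, nhor n h ^ 2 := by
          refine le_trans ?_ (Finset.single_le_sum (f := fun h => nhor n h ^ 2)
            (fun _ _ => sq_nonneg _) (Finset.mem_univ i))
          rw [← sq_abs]
          exact Int.le_self_sq _
        exact_mod_cast h3.trans (le_abs_self _)
      rw [e, norm_div, norm_mul, div_le_iff₀ (by linarith)]
      have h4 := norm_hdot_le b n
      have h5 : ‖hdot b n‖ ≤ (1 + freq n) ^ 1 * ‖b n‖ := by
        nlinarith [norm_nonneg (b n), mul_nonneg hf (norm_nonneg (b n))]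
      calc _ ≤ ‖∑ h, (nhor n h : ℂ) ^ 2‖ * ((1 + freq n) ^ 1 * ‖b n‖) :=
            mul_le_mul hsq h5 (norm_nonneg _) (by positivity)
        _ = _ := mul_comm _ _
    · rw [norm_zero]; positivity
  rw [fser, fser, ← (summable_mul_mFourier (hb.summable i) x).tsum_sub (summable_mul_mFourier hs x)]
  refine tsum_congr fun n => ?_
  simp only [lerayc, nhor_apply]
  split_ifs with h
  · have e : b (npt (nhor n) 0) = b n := by rw [← h, npt_nhor]
    rw [e]; ring
  · ring

theorem norm_lerayc_le (n : Fin 3 → ℤ) (v : Fin 2 → ℂ) (i : Fin 2) : ‖lerayc n v i‖ ≤ 3 * ‖v‖ := by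
  have hv := norm_le_pi_norm v
  have hv0 := norm_nonneg v
  unfold lerayc
  split_ifs with h
  · set S : ℂ := ∑ h : Fin 2, (n h.castSucc : ℂ) ^ 2 with hS
    have hSr : S = ((∑ h : Fin 2, (n h.castSucc : ℝ) ^ 2 : ℝ) : ℂ) := by rw [hS]; push_cast; rfl
    set R : ℝ := ∑ h : Fin 2, (n h.castSucc : ℝ) ^ 2 with hR
    have hR0 : 0 ≤ R := Finset.sum_nonneg fun _ _ => sq_nonneg _
    have hprod : ∀ h : Fin 2, ‖(n i.castSucc : ℂ)‖ * ‖(n h.castSucc : ℂ)‖ ≤ R := fun h => by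
      simp only [Complex.norm_intCast]
      have h1 : ∀ j : Fin 2, |(n j.castSucc : ℝ)| ^ 2 ≤ R := fun j => by
        rw [sq_abs]
        exact Finset.single_le_sum (f := fun h : Fin 2 => (n h.castSucc : ℝ) ^ 2)
          (fun _ _ => sq_nonneg _) (Finset.mem_univ j)
      nlinarith [h1 i, h1 h, sq_nonneg (|(n i.castSucc : ℝ)| - |(n h.castSucc : ℝ)|)]
    have hq : ‖(n i.castSucc : ℂ) * (∑ h : Fin 2, (n h.castSucc : ℂ) * v h) / S‖ ≤ 2 * ‖v‖ := by
      rw [norm_div, hSr, Complex.norm_real, Real.norm_of_nonneg hR0]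
      refine div_le_of_le_mul₀ hR0 (by positivity) ?_
      rw [norm_mul]
      have h2 : ∀ h : Fin 2, ‖(n i.castSucc : ℂ)‖ * ‖(n h.castSucc : ℂ) * v h‖ ≤ R * ‖v‖ := fun h => by
        rw [norm_mul, ← mul_assoc]
        exact mul_le_mul (hprod h) (hv h) (norm_nonneg _) hR0
      calc _ ≤ ‖(n i.castSucc : ℂ)‖ * ∑ h : Fin 2, ‖(n h.castSucc : ℂ) * v h‖ := by
            gcongr; exact norm_sum_le _ _
        _ ≤ _ := by
            rw [Fin.sum_univ_two, mul_add]
            linarith [h2 0, h2 1]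
    refine (norm_sub_le _ _).trans ?_
    linarith [hv i]
  · linarith [hv i]

theorem Wt.lerayc {p : ℕ} {b : Coef} (hb : Wt p b) : Wt p fun n => lerayc n (b n) := by
  refine Summable.of_nonneg_of_le (fun n => ?_) (fun n => ?_) (hb.mul_left 3)
  · have := freq_nonneg n; positivity
  · have := freq_nonneg n
    have h := (pi_norm_le_iff_of_nonneg (by positivity : 0 ≤ 3 * ‖b n‖)).mpr
      fun i => norm_lerayc_le n (b n) i
    calc _ ≤ (1 + freq n) ^ p * (3 * ‖b n‖) := by gcongr
      _ = _ := by ring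

theorem lerayc_sub (n : Fin 3 → ℤ) (v w : Fin 2 → ℂ) :
    lerayc n (v - w) = lerayc n v - lerayc n w := by
  funext i
  simp only [lerayc, Pi.sub_apply, Fin.sum_univ_two]
  split_ifs <;> ring

theorem lerayc_smul (n : Fin 3 → ℤ) (c : ℂ) (v : Fin 2 → ℂ) :
    lerayc n (c • v) = c • lerayc n v := by
  funext i
  simp only [lerayc, Pi.smul_apply, smul_eq_mul, Fin.sum_univ_two]
  split_ifs <;> ring

/-- The projection is symmetric, and it is the identity on divergence free barotropic modes. -/
theorem lerayc_inner {n : Fin 3 → ℤ} {u : Fin 2 → ℂ}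
    (hu : n 2 = 0 → ∑ h : Fin 2, (n h.castSucc : ℂ) * u h = 0) (v : Fin 2 → ℂ) :
    ∑ i, lerayc n v i * (starRingEnd ℂ) (u i) = ∑ i, v i * (starRingEnd ℂ) (u i) := by
  unfold lerayc
  split_ifs with h
  · have h1 := congrArg (starRingEnd ℂ) (hu h)
    simp only [Fin.sum_univ_two, map_add, map_mul, map_zero, map_intCast] at h1 ⊢
    linear_combination (-((n (Fin.castSucc 0) : ℂ) * v 0 + n (Fin.castSucc 1) * v 1) /
      ((n (Fin.castSucc 0) : ℂ) ^ 2 + (n (Fin.castSucc 1) : ℂ) ^ 2)) * h1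
  · rfl

/-! ### Fields and their coefficients -/

theorem fser_nflip (c : (Fin 3 → ℤ) → ℂ) (x' : T2) (z : UnitAddCircle) :
    fser (fun n => c (nflip n)) (pt x' z) = fser c (pt x' (-z)) := by
  rw [fser, ← nflipEquiv.tsum_eq, fser]
  refine tsum_congr fun n => ?_
  have : (fourier (-n 2) z : ℂ) = fourier (n 2) (-z) := by simp [fourier_apply]
  simp only [nflipEquiv, Equiv.coe_fn_mk, nflip_nflip, mFourier_pt, nhor_nflip, nflip_two, this]

/-- A field of `H` with enough regularity is the sum of its Fourier series, and its coefficients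
have the symmetries of `H`. -/
theorem MemH.coefH {U : Field} (hU : MemH U) (hw : Wt 1 (coeff U)) :
    CoefH (coeff U) ∧ ∀ x i, (U x i : ℂ) = fser (coeff U · i) x := by
  have hser : ∀ x i, (U x i : ℂ) = fser (coeff U · i) x := fun x i =>
    eq_fser (⟨fun x => (U x i : ℂ), by fun_prop⟩ : C(T3, ℂ)) (hw.summable i) x
  refine ⟨⟨fun n i => coeff_neg_of_real (fun x => hser x i) (hw.summable i) n, ?_, ?_, ?_⟩, hser⟩
  · funext i
    have h := hU.mean_zero i
    have hvol : (volume : Measure T3) = Measure.pi fun _ => AddCircle.haarAddCircle := by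
      rw [volume_pi]; congr; funext _; rw [AddCircle.volume_eq_smul_haarAddCircle]; simp
    rw [hvol] at h
    simp only [coeff, mFourierCoeff, neg_zero, mFourier_zero, ContinuousMap.one_apply, one_smul]
    refine Eq.trans ?_ (integral_ofReal.trans (congrArg Complex.ofReal h))
    rfl
  · intro n
    funext i
    have hsum := hw.summable i
    have h := fser_injective (a := fun n => coeff U (nflip n) i) (nflipEquiv.summable_iff.mpr hsum)
      hsum fun x => by
        rw [← pt_hor x, fser_nflip (coeff U · i), ← hser, ← hser, hU.even]
    exact congrFun h n
  · intro n hn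
    have hbar : ∀ x' i, (barotropic U x' i : ℂ) = fser (fun m => coeff U (npt m 0) i) x' :=
      fun x' i => barotropic_eq_fser (fun x => hser x i) (hw.summable i) x'
    have hs' : ∀ i j : Fin 2, Summable fun m : Fin 2 → ℤ => (m j : ℂ) * coeff U (npt m 0) i :=
      fun i j => by
        have := (hw.summable_intCast_mul i j.castSucc).comp_injective npt_injective
        simpa [Function.comp_def] using this
    have hd := div2_eq_fser (β := fun m => coeff U (npt m 0)) hbar
      (fun i => (hw.summable i).comp_injective npt_injective) hs'
    have h0 := fser_injective (d := 2) ((summable_sum fun h _ => hs' h h).mul_left _)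
      (summable_zero (α := ℂ)) (fun x => by
        rw [← hd, hU.div_free]; simp [fser])
    have h1 := congrFun h0 (nhor n)
    have hpi : (Real.pi : ℂ) ≠ 0 := by exact_mod_cast Real.pi_ne_zero
    have e : npt (nhor n) 0 = n := by rw [← hn, npt_nhor]
    rw [e] at h1
    exact (mul_eq_zero.mp h1).resolve_left (by simp [hpi])

/-- The field with given Fourier coefficients. -/
def synth (a : Coef) : Field where
  toFun x i := ((∑' n, a n i • mFourier n : C(T3, ℂ)) x).re
  continuous_toFun := by fun_prop

/-- The real part in `synth` is harmless for Hermitian coefficients. -/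
theorem synth_eq_fser {a : Coef} (hw : Wt 1 a) (hr : ∀ n i, a (-n) i = (starRingEnd ℂ) (a n i))
    (x : T3) (i : Fin 2) : (synth a x i : ℂ) = fser (a · i) x := by
  rw [← ofReal_re_fser (fun n => hr n i), ← tsum_smul_mFourier_apply (hw.summable i)]
  rfl

theorem coeff_eq_of_fser {F : T3 → Fin 2 → ℝ} {a : Coef}
    (hF : ∀ x i, (F x i : ℂ) = fser (a · i) x) (hw : ∀ i, Summable (a · i)) : coeff F = a := by
  funext n i
  rw [coeff, show (fun x => (F x i : ℂ)) = fser (a · i) from funext fun x => hF x i,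
    mFourierCoeff_fser (hw i)]

theorem coeff_synth {a : Coef} (hw : Wt 1 a) (hr : ∀ n i, a (-n) i = (starRingEnd ℂ) (a n i)) :
    coeff (synth a) = a :=
  coeff_eq_of_fser (synth_eq_fser hw hr) hw.summable

theorem memH_synth {a : Coef} (hw : Wt 1 a) (hH : CoefH a) : MemH (synth a) := by
  have hser := synth_eq_fser hw hH.real
  have hco := coeff_synth hw hH.real
  refine ⟨fun i => ?_, fun x' => ?_, fun x' z => ?_⟩
  · have hvol : (volume : Measure T3) = Measure.pi fun _ => AddCircle.haarAddCircle := by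
      rw [volume_pi]; congr; funext _; rw [AddCircle.volume_eq_smul_haarAddCircle]; simp
    have h : coeff (synth a) 0 i = 0 := by rw [hco, hH.zero]; rfl
    simp only [coeff, mFourierCoeff, neg_zero, mFourier_zero, ContinuousMap.one_apply, one_smul] at h
    rw [hvol]
    have h2 : ((∫ x : T3, synth a x i ∂(Measure.pi fun _ => AddCircle.haarAddCircle) : ℝ) : ℂ) = 0 :=
      integral_ofReal.symm.trans h
    exact_mod_cast h2
  · have hbar : ∀ x' i, (barotropic (synth a) x' i : ℂ) = fser (fun m => a (npt m 0) i) x' :=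
      fun x' i => barotropic_eq_fser (fun x => hser x i) (hw.summable i) x'
    have hd := div2_eq_fser (β := fun m => a (npt m 0)) hbar
      (fun i => (hw.summable i).comp_injective npt_injective)
      (fun i j => by
        have := (hw.summable_intCast_mul i j.castSucc).comp_injective npt_injective
        simpa [Function.comp_def] using this) x'
    have h0 : ∀ m : Fin 2 → ℤ, ∑ h, (m h : ℂ) * a (npt m 0) h = 0 := fun m => by
      simpa [hdot] using hH.div (npt m 0) (npt_two m 0)
    simp only [h0, mul_zero] at hd
    have : (div2 (barotropic (synth a)) x' : ℂ) = 0 := by rw [hd]; simp [fser]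
    exact_mod_cast this
  · funext i
    have h : (synth a (pt x' (-z)) i : ℂ) = synth a (pt x' z) i := by
      rw [hser, hser, ← fser_nflip (a · i)]
      simp only [hH.even]
    exact_mod_cast h

theorem field_ext_of_coeff {U V : Field} (hU : Wt 1 (coeff U)) (hV : Wt 1 (coeff V))
    (h : coeff U = coeff V) : U = V := by
  ext x i
  have h1 := eq_fser (⟨fun x => (U x i : ℂ), by fun_prop⟩ : C(T3, ℂ)) (hU.summable i) x
  have h2 := eq_fser (⟨fun x => (V x i : ℂ), by fun_prop⟩ : C(T3, ℂ)) (hV.summable i) x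
  have h3 : (U x i : ℂ) = V x i := by
    refine h1.trans (Eq.trans ?_ h2.symm)
    change fser (coeff U · i) x = fser (coeff V · i) x
    rw [h]
  exact_mod_cast h3

/-! ### A trilinear convolution estimate -/

/-- The involution `(n, j) ↦ (n, n - j)`. -/
def reflEquiv (G : Type*) [AddCommGroup G] : G × G ≃ G × G where
  toFun p := (p.1, p.1 - p.2)
  invFun p := (p.1, p.1 - p.2)
  left_inv p := by simp
  right_inv p := by simp

theorem hasSum_mul_sub {G : Type*} [AddCommGroup G] {a b : G → ℝ}
    (ha : Summable a) (hb : Summable b) (ha0 : ∀ n, 0 ≤ a n) (hb0 : ∀ n, 0 ≤ b n) :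
    HasSum (fun p : G × G => a p.2 * b (p.1 - p.2)) ((∑' n, a n) * ∑' n, b n) := by
  have h := ha.mul_of_nonneg hb ha0 hb0
  have h' := h.hasSum
  rw [← ha.tsum_mul_tsum hb h] at h'
  exact (subEquiv G).hasSum_iff.mpr h'

/-- Young's inequality for the form `∑ A_n A_j c_{n-j}`. -/
theorem summable_tri {G : Type*} [AddCommGroup G] {A c : G → ℝ} (hA : Summable fun n => A n ^ 2)
    (hc : Summable c) (hA0 : ∀ n, 0 ≤ A n) (hc0 : ∀ n, 0 ≤ c n) :
    Summable (fun p : G × G => A p.1 * A p.2 * c (p.1 - p.2)) ∧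
      ∑' p : G × G, A p.1 * A p.2 * c (p.1 - p.2) ≤ (∑' n, c n) * ∑' n, A n ^ 2 := by
  have h1 := hasSum_mul_sub hA hc (fun n => sq_nonneg _) hc0
  have h2 : HasSum (fun p : G × G => A p.1 ^ 2 * c (p.1 - p.2)) ((∑' n, A n ^ 2) * ∑' n, c n) := by
    have h := hA.mul_of_nonneg hc (fun n => sq_nonneg _) hc0
    have h' := h.hasSum
    rw [← hA.tsum_mul_tsum hc h] at h'
    exact (reflEquiv G).hasSum_iff.mpr h'
  have h3 := (h1.add h2).mul_left (1 / 2)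
  have hle : ∀ p : G × G, A p.1 * A p.2 * c (p.1 - p.2)
      ≤ 1 / 2 * (A p.2 ^ 2 * c (p.1 - p.2) + A p.1 ^ 2 * c (p.1 - p.2)) := fun p => by
    nlinarith [mul_nonneg (sq_nonneg (A p.1 - A p.2)) (hc0 (p.1 - p.2))]
  have hs : Summable (fun p : G × G => A p.1 * A p.2 * c (p.1 - p.2)) :=
    .of_nonneg_of_le (fun p => mul_nonneg (mul_nonneg (hA0 _) (hA0 _)) (hc0 _)) hle h3.summable
  refine ⟨hs, (hs.tsum_le_tsum hle h3.summable).trans_eq ?_⟩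
  rw [h3.tsum_eq]; ring

/-- If `q_n ≤ ∑_j F(n, j)` and `F(n, j) ≤ M (A_n A_j c_{n-j} + A_n c_j A_{n-j})`, then
`∑ q_n ≤ 2 M ‖c‖_{ℓ¹} ‖A‖²_{ℓ²}`. -/
theorem summable_of_le_tri {G : Type*} [AddCommGroup G] {A c q : G → ℝ} {F : G → G → ℝ} {M : ℝ}
    (hA : Summable fun n => A n ^ 2) (hc : Summable c) (hA0 : ∀ n, 0 ≤ A n) (hc0 : ∀ n, 0 ≤ c n)
    (hM0 : 0 ≤ M) (hF0 : ∀ n j, 0 ≤ F n j) (hq0 : ∀ n, 0 ≤ q n)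
    (hF : ∀ n j, F n j ≤ M * (A n * A j * c (n - j) + A n * c j * A (n - j)))
    (hq : ∀ n, q n ≤ ∑' j, F n j) :
    Summable q ∧ ∑' n, q n ≤ 2 * M * ((∑' n, c n) * ∑' n, A n ^ 2) := by
  obtain ⟨hs, hle⟩ := summable_tri hA hc hA0 hc0
  have hs' : HasSum (fun p : G × G => A p.1 * c p.2 * A (p.1 - p.2))
      (∑' p : G × G, A p.1 * A p.2 * c (p.1 - p.2)) := by
    have := (reflEquiv G).hasSum_iff.mpr hs.hasSum
    refine this.congr_fun fun p => ?_
    simp only [Function.comp_apply, reflEquiv, Equiv.coe_fn_mk, sub_sub_cancel]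
    ring
  have hM := (hs.hasSum.add hs').mul_left M
  have hFs : Summable fun p : G × G => F p.1 p.2 :=
    .of_nonneg_of_le (fun p => hF0 _ _) (fun p => hF _ _) hM.summable
  have hqs : Summable q := .of_nonneg_of_le hq0 hq hFs.prod
  refine ⟨hqs, ?_⟩
  calc ∑' n, q n ≤ ∑' n, ∑' j, F n j := hqs.tsum_le_tsum hq hFs.prod
    _ = ∑' p : G × G, F p.1 p.2 := hFs.tsum_prod.symm
    _ ≤ _ := hFs.tsum_le_tsum (fun p => hF _ _) hM.summable
    _ ≤ _ := by
      rw [hM.tsum_eq]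
      nlinarith [mul_le_mul_of_nonneg_left hle hM0]

/-- The Cauchy–Schwarz inequality for series of nonnegative terms. -/
theorem tsum_mul_le_sqrt {ι : Type*} {f g : ι → ℝ} (hf0 : ∀ i, 0 ≤ f i) (hg0 : ∀ i, 0 ≤ g i)
    (hf : Summable fun i => f i ^ 2) (hg : Summable fun i => g i ^ 2) :
    Summable (fun i => f i * g i) ∧
      ∑' i, f i * g i ≤ √(∑' i, f i ^ 2) * √(∑' i, g i ^ 2) := by
  have h := Real.summable_and_inner_le_Lp_mul_Lq_tsum_of_nonneg Real.HolderConjugate.two_two hf0 hg0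
    (by simpa using hf) (by simpa using hg)
  simpa [Real.sqrt_eq_rpow] using h

/-! ### The nonlinear estimate -/

theorem norm_sq_le_sum (v : Fin 2 → ℂ) : ‖v‖ ^ 2 ≤ ∑ i, ‖v i‖ ^ 2 := by
  have h : ‖v‖ ≤ √(∑ i, ‖v i‖ ^ 2) := by
    refine (pi_norm_le_iff_of_nonneg (Real.sqrt_nonneg _)).mpr fun i => Real.le_sqrt_of_sq_le ?_
    exact Finset.single_le_sum (f := fun i => ‖v i‖ ^ 2) (fun _ _ => sq_nonneg _)
      (Finset.mem_univ i)
  calc _ ≤ √(∑ i, ‖v i‖ ^ 2) ^ 2 := by gcongr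
    _ = _ := Real.sq_sqrt (Finset.sum_nonneg fun _ _ => sq_nonneg _)

theorem coeffSq_nonneg (F : T3 → Fin 2 → ℝ) (n : Fin 3 → ℤ) : 0 ≤ coeffSq F n :=
  Finset.sum_nonneg fun _ _ => sq_nonneg _

/-- The `n`-th term of the series for the squared homogeneous Gevrey norm. -/
def dotTerm (σ φ : ℝ) (F : T3 → Fin 2 → ℝ) (n : Fin 3 → ℤ) : ℝ :=
  Real.exp (2 * φ * freq n) * freq n ^ (2 * σ) * coeffSq F n

theorem dotTerm_nonneg (σ φ : ℝ) (F : T3 → Fin 2 → ℝ) (n : Fin 3 → ℤ) : 0 ≤ dotTerm σ φ F n :=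
  mul_nonneg (mul_nonneg (Real.exp_pos _).le (Real.rpow_nonneg (freq_nonneg n) _))
    (coeffSq_nonneg F n)

theorem dotTerm_le_gevreyTerm (σ φ : ℝ) (F : T3 → Fin 2 → ℝ) (n : Fin 3 → ℤ) :
    dotTerm σ φ F n ≤ gevreyTerm σ φ F n :=
  mul_le_mul_of_nonneg_right (by linarith) (coeffSq_nonneg F n)

theorem MemGevrey.summable_dotTerm {σ φ : ℝ} {F : Field} (h : MemGevrey σ φ F) :
    Summable (dotTerm σ φ F) :=
  .of_nonneg_of_le (dotTerm_nonneg σ φ F) (dotTerm_le_gevreyTerm σ φ F) h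

theorem gevreyDotNorm_eq (σ φ : ℝ) (F : Field) : gevreyDotNorm σ φ F = √(∑' n, dotTerm σ φ F n) := rfl

theorem gevreyDotNorm_sq (σ φ : ℝ) (F : Field) :
    gevreyDotNorm σ φ F ^ 2 = ∑' n, dotTerm σ φ F n :=
  Real.sq_sqrt (tsum_nonneg (dotTerm_nonneg σ φ F))

theorem freq_rpow_mono (n : Fin 3 → ℤ) {p q : ℝ} (hp : 0 < p) (hpq : p ≤ q) :
    freq n ^ p ≤ freq n ^ q := by
  by_cases hn : n = 0
  · subst hn; rw [freq_zero, Real.zero_rpow hp.ne', Real.zero_rpow (hp.trans_le hpq).ne']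
  · exact Real.rpow_le_rpow_of_exponent_le (one_le_freq hn) hpq

theorem dotTerm_mono {σ τ φ : ℝ} (hσ : 0 < σ) (h : σ ≤ τ) (F : T3 → Fin 2 → ℝ) (n : Fin 3 → ℤ) :
    dotTerm σ φ F n ≤ dotTerm τ φ F n := by
  refine mul_le_mul_of_nonneg_right (mul_le_mul_of_nonneg_left ?_ (Real.exp_pos _).le)
    (coeffSq_nonneg F n)
  exact freq_rpow_mono n (by linarith) (by linarith)

theorem sq_weight_le_dotTerm (σ φ : ℝ) (F : T3 → Fin 2 → ℝ) (n : Fin 3 → ℤ) :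
    (freq n ^ σ * (Real.exp (φ * freq n) * ‖coeff F n‖)) ^ 2 ≤ dotTerm σ φ F n := by
  have h1 : (freq n ^ σ) ^ 2 = freq n ^ (2 * σ) := by
    rw [← Real.rpow_natCast, ← Real.rpow_mul (freq_nonneg n)]; congr 1; push_cast; ring
  have h2 : Real.exp (φ * freq n) ^ 2 = Real.exp (2 * φ * freq n) := by
    rw [← Real.exp_nat_mul]; congr 1; push_cast; ring
  rw [mul_pow, mul_pow, h1, h2, dotTerm]
  calc _ = Real.exp (2 * φ * freq n) * freq n ^ (2 * σ) * ‖coeff F n‖ ^ 2 := by ring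
    _ ≤ _ := mul_le_mul_of_nonneg_left (norm_sq_le_sum (coeff F n))
      (mul_nonneg (Real.exp_pos _).le (Real.rpow_nonneg (freq_nonneg n) _))

/-- The `ℓ²` norm of the weight which bounds `∑ |k| e^{φ|k|} |f_k|` by the Gevrey norm of order
`σ > 5/2`. -/
def latticeConst (σ : ℝ) : ℝ := √(∑' n : Fin 3 → ℤ, (freq n ^ (1 - σ)) ^ 2)

/-- The Gevrey norm of order `σ > 5/2` controls `∑ |k| e^{φ|k|} |f_k|`, by the Cauchy–Schwarz
inequality and the convergence of `∑ |k|^{2 - 2σ}` over the lattice. -/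
theorem summable_freq_mul_exp {σ φ : ℝ} (hσ : 5 / 2 < σ) {F : Field}
    (hF : Summable (dotTerm σ φ F)) :
    Summable (fun n => freq n * (Real.exp (φ * freq n) * ‖coeff F n‖)) ∧
      ∑' n, freq n * (Real.exp (φ * freq n) * ‖coeff F n‖) ≤ latticeConst σ * gevreyDotNorm σ φ F := by
  have hs1 : Summable fun n : Fin 3 → ℤ => (freq n ^ (1 - σ)) ^ 2 := by
    refine (summable_freq_rpow (s := 2 * σ - 2) (by linarith)).congr fun n => ?_
    rw [← Real.rpow_natCast, ← Real.rpow_mul (freq_nonneg n)]; congr 1; push_cast; ring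
  have hs2 : Summable fun n => (freq n ^ σ * (Real.exp (φ * freq n) * ‖coeff F n‖)) ^ 2 :=
    .of_nonneg_of_le (fun _ => sq_nonneg _) (sq_weight_le_dotTerm σ φ F) hF
  have h := tsum_mul_le_sqrt (fun n => Real.rpow_nonneg (freq_nonneg n) _)
    (fun n => by have := freq_nonneg n; positivity) hs1 hs2
  have he : ∀ n, freq n ^ (1 - σ) * (freq n ^ σ * (Real.exp (φ * freq n) * ‖coeff F n‖))
      = freq n * (Real.exp (φ * freq n) * ‖coeff F n‖) := fun n => by
    by_cases hn : n = 0
    · subst hn; rw [freq_zero, Real.zero_rpow (by linarith)]; ring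
    · rw [← mul_assoc, ← Real.rpow_add (freq_pos hn)]; simp
  simp only [he] at h
  refine ⟨h.1, h.2.trans (mul_le_mul_of_nonneg_left ?_ (Real.sqrt_nonneg _))⟩
  exact Real.sqrt_le_sqrt (hs2.tsum_le_tsum (sq_weight_le_dotTerm σ φ F) hF)

/-- Fields of Gevrey order above `5/2` have an absolutely convergent differentiated series. -/
theorem wt_one_of_summable_dotTerm {σ φ : ℝ} (hσ : 5 / 2 < σ) (hφ : 0 ≤ φ) {F : Field}
    (hF : Summable (dotTerm σ φ F)) : Wt 1 (coeff F) := by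
  have h := (summable_freq_mul_exp hσ hF).1.mul_left 2
  have h0 : Summable fun n : Fin 3 → ℤ => if n = 0 then ‖coeff F 0‖ else 0 :=
    (hasSum_ite_eq 0 _).summable
  refine Summable.of_nonneg_of_le (fun n => ?_) (fun n => ?_) (h.add h0)
  · have := freq_nonneg n; positivity
  · by_cases hn : n = 0
    · subst hn; simp
    · rw [if_neg hn, add_zero, pow_one]
      have h1 := one_le_freq hn
      have h2 : 1 ≤ Real.exp (φ * freq n) := Real.one_le_exp (by positivity)
      have h3 := norm_nonneg (coeff F n)
      calc (1 + freq n) * ‖coeff F n‖ ≤ (2 * freq n) * (1 * ‖coeff F n‖) := by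
            rw [one_mul]; gcongr; linarith
        _ ≤ (2 * freq n) * (Real.exp (φ * freq n) * ‖coeff F n‖) := by gcongr
        _ = _ := by ring

theorem add_rpow_le {x y p : ℝ} (hx : 0 ≤ x) (hy : 0 ≤ y) (hp : 0 ≤ p) :
    (x + y) ^ p ≤ 2 ^ p * (x ^ p + y ^ p) := by
  have hm : (x + y) ^ p ≤ (2 * max x y) ^ p := by
    refine Real.rpow_le_rpow (by positivity) ?_ hp
    linarith [le_max_left x y, le_max_right x y]
  refine hm.trans ?_
  rw [Real.mul_rpow (by norm_num) (le_max_of_le_left hx)]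
  refine mul_le_mul_of_nonneg_left ?_ (by positivity)
  rcases max_cases x y with h | h <;> rw [h.1]
  · linarith [Real.rpow_nonneg hy p]
  · linarith [Real.rpow_nonneg hx p]

theorem exp_mul_freq_le {φ : ℝ} (hφ : 0 ≤ φ) (n j : Fin 3 → ℤ) :
    Real.exp (φ * freq n) ≤ Real.exp (φ * freq j) * Real.exp (φ * freq (n - j)) := by
  rw [← Real.exp_add, ← mul_add]
  exact Real.exp_le_exp.mpr (mul_le_mul_of_nonneg_left (freq_le_add n j) hφ)

/-- The nonlinear estimate. Of the weight `|k|^{2σ}`, the half `|k|^{σ + 1/2}` goes to the test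
field; the rest, `|k|^{σ - 1/2}`, is split between the two factors `|j| |a_j|` and
`|k - j| |a_{k-j}|` of the product, so that one of them reaches the order `σ + 1/2` and the other is
summable. The exponential weight is submultiplicative. -/
theorem exists_nonlinearEstimate {σ : ℝ} (hσ : 5 / 2 < σ) : ∃ C : ℝ, 0 < C ∧ NonlinearEstimate σ C := by
  -- `6` is the factor `3` of `norm_conv_le` times the two components
  set M : ℝ := 6 * 2 ^ (σ - 1 / 2) with hM
  have hL : 0 ≤ latticeConst σ := Real.sqrt_nonneg _
  have hM0 : 0 < M := by positivity
  refine ⟨2 * M * latticeConst σ + 1, by positivity, fun φ hφ U hU hmem => ?_⟩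
  set s : ℝ := σ + 1 / 2 with hs
  have hds := hmem.summable_dotTerm
  have hdσ : Summable (dotTerm σ φ U) :=
    .of_nonneg_of_le (dotTerm_nonneg σ φ U) (dotTerm_mono (by linarith) (by linarith) U) hds
  have hw := wt_one_of_summable_dotTerm hσ hφ hdσ
  obtain ⟨hH, hser⟩ := hU.coefH hw
  set a := coeff U with ha
  have hQ : coeff (Q U U) = conv a a :=
    coeff_eq_of_fser (Q_eq_fser hser hser hw hH hw) (hw.conv hw hH.zero).summable
  obtain ⟨hb, hble⟩ := summable_freq_mul_exp hσ hdσ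
  set u : (Fin 3 → ℤ) → ℝ := fun n => Real.exp (φ * freq n) * ‖a n‖ with hu
  have hu0 : ∀ n, 0 ≤ u n := fun n => by positivity
  set A : (Fin 3 → ℤ) → ℝ := fun n => freq n ^ s * u n with hA
  have hAs : Summable fun n => A n ^ 2 :=
    .of_nonneg_of_le (fun _ => sq_nonneg _) (sq_weight_le_dotTerm s φ U) hds
  have hA0 : ∀ n, 0 ≤ A n := fun n => mul_nonneg (Real.rpow_nonneg (freq_nonneg n) _) (hu0 n)
  have hAle : ∑' n, A n ^ 2 ≤ gevreyDotNorm s φ U ^ 2 := by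
    rw [gevreyDotNorm_sq]; exact hAs.tsum_le_tsum (sq_weight_le_dotTerm s φ U) hds
  have hb0 : ∀ n, 0 ≤ freq n * u n := fun n => mul_nonneg (freq_nonneg n) (hu0 n)
  have hAb : ∀ n, freq n ^ (σ - 1 / 2) * (freq n * u n) = A n := fun n => by
    rw [hA, ← mul_assoc]
    congr 1
    by_cases hn : n = 0
    · subst hn; rw [freq_zero, Real.zero_rpow (by linarith), Real.zero_rpow (by linarith)]; ring
    · rw [← Real.rpow_add_one (freq_pos hn).ne']; congr 1; ring
  have key := summable_of_le_tri (A := A) (c := fun n => freq n * u n)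
    (q := fun n => ‖pairTerm σ φ (Q U U) U n‖)
    (F := fun n j => 6 * (A n * (freq n ^ (σ - 1 / 2) * ((freq j * u j) * (freq (n - j) * u (n - j))))))
    (M := M) hAs hb hA0 hb0 hM0.le
    (fun n j => mul_nonneg (by norm_num) (mul_nonneg (hA0 n) (mul_nonneg
      (Real.rpow_nonneg (freq_nonneg n) _) (mul_nonneg (hb0 j) (hb0 (n - j))))))
    (fun n => norm_nonneg _) ?_ ?_
  · refine ⟨key.1.of_norm, (norm_tsum_le_tsum_norm key.1).trans (key.2.trans ?_)⟩
    have h1 : (∑' n, freq n * u n) * ∑' n, A n ^ 2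
        ≤ (latticeConst σ * gevreyDotNorm σ φ U) * gevreyDotNorm s φ U ^ 2 :=
      mul_le_mul hble hAle (tsum_nonneg fun _ => sq_nonneg _)
        (mul_nonneg hL (Real.sqrt_nonneg _))
    have h2 : 0 ≤ gevreyDotNorm σ φ U * gevreyDotNorm s φ U ^ 2 :=
      mul_nonneg (Real.sqrt_nonneg _) (sq_nonneg _)
    nlinarith [mul_le_mul_of_nonneg_left h1 hM0.le]
  · intro n j
    have h1 : freq n ^ (σ - 1 / 2) ≤
        2 ^ (σ - 1 / 2) * (freq j ^ (σ - 1 / 2) + freq (n - j) ^ (σ - 1 / 2)) :=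
      (Real.rpow_le_rpow (freq_nonneg n) (freq_le_add n j) (by linarith)).trans
        (add_rpow_le (freq_nonneg _) (freq_nonneg _) (by linarith))
    have h2 : 0 ≤ A n * ((freq j * u j) * (freq (n - j) * u (n - j))) :=
      mul_nonneg (hA0 n) (mul_nonneg (hb0 j) (hb0 _))
    calc _ = 6 * (freq n ^ (σ - 1 / 2) * (A n * ((freq j * u j) * (freq (n - j) * u (n - j))))) := by
          ring
      _ ≤ 6 * ((2 ^ (σ - 1 / 2) * (freq j ^ (σ - 1 / 2) + freq (n - j) ^ (σ - 1 / 2))) *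
            (A n * ((freq j * u j) * (freq (n - j) * u (n - j))))) := by gcongr
      _ = M * (A n * (freq j ^ (σ - 1 / 2) * (freq j * u j)) * (freq (n - j) * u (n - j))
            + A n * (freq j * u j) * (freq (n - j) ^ (σ - 1 / 2) * (freq (n - j) * u (n - j)))) := by
          rw [hM]; ring
      _ = _ := by rw [hAb, hAb]
  · intro n
    have hsum : Summable fun j => (freq j * ‖a j‖) * (freq (n - j) * ‖a (n - j)‖) := by
      have h := Wt.summable_freq_mul (p := 0) hw
      simp only [pow_zero, one_mul] at h
      exact (summable_mul_sub h.norm h.norm).prod_factor n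
    have hsum' : Summable fun j => (freq j * u j) * (freq (n - j) * u (n - j)) :=
      (summable_mul_sub hb.norm hb.norm).prod_factor n
    have hconv := norm_conv_le hw hw hH.zero n
    have hexp : ∑' j, Real.exp (φ * freq n) * ((freq j * ‖a j‖) * (freq (n - j) * ‖a (n - j)‖))
        ≤ ∑' j, (freq j * u j) * (freq (n - j) * u (n - j)) := by
      refine (hsum.mul_left _).tsum_le_tsum (fun j => ?_) hsum'
      have h1 := freq_nonneg j
      have h2 := freq_nonneg (n - j)
      calc _ ≤ (Real.exp (φ * freq j) * Real.exp (φ * freq (n - j))) *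
            ((freq j * ‖a j‖) * (freq (n - j) * ‖a (n - j)‖)) := by
            gcongr; exact exp_mul_freq_le hφ n j
        _ = _ := by rw [hu]; ring
    have hpair : ‖pairTerm σ φ (Q U U) U n‖ ≤
        Real.exp (2 * φ * freq n) * freq n ^ (2 * σ) * (2 * (‖conv a a n‖ * ‖a n‖)) := by
      rw [pairTerm, norm_mul, hQ, Complex.norm_real, Real.norm_of_nonneg
        (mul_nonneg (Real.exp_pos _).le (Real.rpow_nonneg (freq_nonneg n) _))]
      refine mul_le_mul_of_nonneg_left ?_
        (mul_nonneg (Real.exp_pos _).le (Real.rpow_nonneg (freq_nonneg n) _))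
      refine (norm_sum_le _ _).trans ?_
      have h1 : ∀ i : Fin 2, ‖conv a a n i * (starRingEnd ℂ) (coeff U n i)‖ ≤ ‖conv a a n‖ * ‖a n‖ :=
        fun i => by
          rw [norm_mul, RCLike.norm_conj]
          exact mul_le_mul (norm_le_pi_norm _ _) (norm_le_pi_norm _ _) (norm_nonneg _) (norm_nonneg _)
      rw [Fin.sum_univ_two]
      linarith [h1 0, h1 1]
    rw [tsum_mul_left, tsum_mul_left, tsum_mul_left]
    have hpow : freq n ^ (2 * σ) = freq n ^ s * freq n ^ (σ - 1 / 2) := by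
      by_cases hn : n = 0
      · subst hn; rw [freq_zero, Real.zero_rpow (by linarith), Real.zero_rpow (by linarith)]; ring
      · rw [← Real.rpow_add (freq_pos hn)]; congr 1; rw [hs]; ring
    have hee : Real.exp (2 * φ * freq n) = Real.exp (φ * freq n) * Real.exp (φ * freq n) := by
      rw [← Real.exp_add]; ring_nf
    rw [tsum_mul_left] at hexp
    have hp1 := Real.rpow_nonneg (freq_nonneg n) (σ - 1 / 2)
    have hp2 := Real.rpow_nonneg (freq_nonneg n) s
    calc _ ≤ _ := hpair
      _ ≤ Real.exp (2 * φ * freq n) * freq n ^ (2 * σ) * (2 *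
            ((3 * ∑' j, (freq j * ‖a j‖) * (freq (n - j) * ‖a (n - j)‖)) * ‖a n‖)) := by
          have := Real.rpow_nonneg (freq_nonneg n) (2 * σ)
          gcongr
      _ = 6 * (A n * (freq n ^ (σ - 1 / 2) * (Real.exp (φ * freq n) *
            ∑' j, (freq j * ‖a j‖) * (freq (n - j) * ‖a (n - j)‖)))) := by
          rw [hpow, hee, hA, hu]; ring
      _ ≤ _ := by
          have := hA0 n
          gcongr

/-! ### Symmetries of the nonlinear term -/

/-- The Fourier coefficients of `𝒫 Q(U, U)`. -/
def nl (a : Coef) : Coef := fun n => lerayc n (conv a a n)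

theorem hdot_neg {a : Coef} (hH : CoefH a) (n : Fin 3 → ℤ) :
    hdot a (-n) = -(starRingEnd ℂ) (hdot a n) := by
  simp [hdot, hH.real, add_comm]

theorem wc_neg {a : Coef} (hH : CoefH a) (n : Fin 3 → ℤ) : wc a (-n) = (starRingEnd ℂ) (wc a n) := by
  rw [wc, hdot_neg hH, wc]
  simp [neg_div, div_neg]

theorem hdot_nflip {a : Coef} (hH : CoefH a) (n : Fin 3 → ℤ) : hdot a (nflip n) = hdot a n := by
  simp only [hdot, hH.even, nflip_castSucc]

theorem wc_nflip {a : Coef} (hH : CoefH a) (n : Fin 3 → ℤ) : wc a (nflip n) = -wc a n := by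
  rw [wc, hdot_nflip hH, wc, nflip_two]
  push_cast
  rw [div_neg]

theorem kern_neg_neg {a : Coef} (hH : CoefH a) (j l : Fin 3 → ℤ) :
    kern a (-j) (-l) = (starRingEnd ℂ) (kern a j l) := by
  simp [kern, wc_neg hH, hH.real, map_ofNat]; ring

theorem kern_nflip {a : Coef} (hH : CoefH a) (j l : Fin 3 → ℤ) :
    kern a (nflip j) (nflip l) = kern a j l := by
  simp only [kern, wc_nflip hH, hH.even, nflip_castSucc, nflip_two]
  push_cast; ring

/-- Incompressibility of `(U, w(U))` on the Fourier side. -/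
theorem kern_neg {a : Coef} (hH : CoefH a) (j : Fin 3 → ℤ) : kern a j (-j) = 0 := by
  have h : hdot a j + wc a j * j 2 = 0 := by
    by_cases h2 : j 2 = 0
    · rw [hH.div j h2, h2]; simp
    · have : (j 2 : ℂ) ≠ 0 := by exact_mod_cast h2
      rw [wc]; field_simp; ring
  have e : ∑ h : Fin 2, a j h * ((-j) h.castSucc : ℤ) = -hdot a j := by
    rw [hdot, ← Finset.sum_neg_distrib]
    exact Finset.sum_congr rfl fun i _ => by rw [Pi.neg_apply]; push_cast; ring
  rw [kern, e, Pi.neg_apply]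
  push_cast
  linear_combination (-(2 * Real.pi * Complex.I)) * h

theorem sum_mul_lerayc {n : Fin 3 → ℤ} (h2 : n 2 = 0) (v : Fin 2 → ℂ) :
    ∑ h : Fin 2, (n h.castSucc : ℂ) * lerayc n v h = 0 := by
  simp only [lerayc, if_pos h2]
  by_cases hS : ∑ h : Fin 2, (n h.castSucc : ℂ) ^ 2 = 0
  · have h1 : ∑ h : Fin 2, n h.castSucc ^ 2 = 0 := by exact_mod_cast hS
    have h0 : ∀ h : Fin 2, n h.castSucc = 0 := fun h => by
      have := (Finset.sum_eq_zero_iff_of_nonneg (fun i _ => sq_nonneg (n i.castSucc))).mp h1 h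
        (Finset.mem_univ h)
      exact pow_eq_zero_iff two_ne_zero |>.mp this
    simp [-Fin.castSucc_zero, -Fin.castSucc_one, h0]
  · simp only [Fin.sum_univ_two] at hS ⊢
    field_simp
    ring

/-- The projected nonlinearity preserves the symmetries of `H`. -/
theorem coefH_nl {a : Coef} (hH : CoefH a) : CoefH (nl a) where
  real n i := by
    have hc : ∀ n i, conv a a (-n) i = (starRingEnd ℂ) (conv a a n i) := fun n i => by
      rw [conv, conv, Complex.conj_tsum, ← (Equiv.neg (Fin 3 → ℤ)).tsum_eq]
      refine tsum_congr fun j => ?_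
      rw [Equiv.neg_apply, show -n - -j = -(n - j) by abel, kern_neg_neg hH, hH.real, map_mul]
    simp only [nl, lerayc, hc, Pi.neg_apply, neg_eq_zero]
    split_ifs
    · simp [Fin.sum_univ_two]; ring
    · rfl
  zero := by
    have hc : conv a a 0 = 0 := by
      funext i
      simp [conv, kern_neg hH]
    funext i
    simp [nl, hc, lerayc]
  even n := by
    have hc : conv a a (nflip n) = conv a a n := by
      funext i
      rw [conv, conv, ← nflipEquiv.tsum_eq]
      refine tsum_congr fun j => ?_
      simp only [nflipEquiv, Equiv.coe_fn_mk]
      rw [← nflip_sub, kern_nflip hH, hH.even]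
    funext i
    simp only [nl, hc, lerayc, nflip_two, nflip_castSucc, neg_eq_zero]
  div n h2 := sum_mul_lerayc h2 _

/-- The Fourier truncation to the frequencies of length at most `R`. -/
def trunc (R : ℝ) (a : Coef) : Coef := fun n => if freq n ≤ R then a n else 0

theorem CoefH.trunc {a : Coef} (hH : CoefH a) (R : ℝ) : CoefH (trunc R a) where
  real n i := by
    simp only [PE.trunc, freq_neg]; split_ifs
    · exact hH.real n i
    · simp
  zero := by simp [PE.trunc, hH.zero]
  even n := by simp only [PE.trunc, freq_nflip, hH.even]
  div n h2 := by
    have := hH.div n h2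
    simp only [PE.trunc, hdot] at this ⊢
    split_ifs
    · exact this
    · simp

theorem CoefH.smul {a : Coef} (hH : CoefH a) (c : ℝ) : CoefH (fun n i => (c : ℂ) * a n i) where
  real n i := by rw [hH.real, map_mul, Complex.conj_ofReal]
  zero := by funext i; simp [hH.zero]
  even n := by simp only [hH.even]
  div n h2 := by
    have := hH.div n h2
    simp only [hdot, Fin.sum_univ_two] at this ⊢
    linear_combination (c : ℂ) * this

theorem CoefH.add {a b : Coef} (ha : CoefH a) (hb : CoefH b) : CoefH (fun n i => a n i + b n i) where
  real n i := by rw [ha.real, hb.real, map_add]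
  zero := by funext i; simp [ha.zero, hb.zero]
  even n := by simp only [ha.even, hb.even]
  div n h2 := by
    have h1 := ha.div n h2
    have h3 := hb.div n h2
    simp only [hdot, Fin.sum_univ_two] at h1 h3 ⊢
    linear_combination h1 + h3

theorem coefH_zero : CoefH (fun _ _ => 0) where
  real n i := by simp
  zero := rfl
  even n := rfl
  div n h2 := by simp [hdot]

theorem finite_freq_le (R : ℝ) : {n : Fin 3 → ℤ | freq n ≤ R}.Finite := by
  refine (Set.finite_Icc (fun _ : Fin 3 => -⌈R⌉) (fun _ => ⌈R⌉)).subset fun n hn => ?_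
  have h : ∀ j, |n j| ≤ ⌈R⌉ := fun j => by
    have h1 := (abs_le_freq n j).trans (hn.trans (Int.le_ceil R))
    exact_mod_cast h1
  exact ⟨fun j => (abs_le.mp (h j)).1, fun j => (abs_le.mp (h j)).2⟩

theorem wt_of_support {R : ℝ} {a : Coef} (ha : ∀ n, R < freq n → a n = 0) (p : ℕ) : Wt p a :=
  summable_of_hasFiniteSupport ((finite_freq_le R).subset fun n hn => by
    by_contra h
    exact hn (by simp [ha n (not_le.mp h)]))

/-! ### A differential equation in finite dimension -/

/-- Global existence for `x' = g(t) F(x)` with `F` smooth and compactly supported. -/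
theorem exists_ode_solution {E : Type*} [NormedAddCommGroup E] [NormedSpace ℝ E]
    [FiniteDimensional ℝ E] {F : E → E} (hF : ContDiff ℝ 1 F) (hc : HasCompactSupport F)
    {g : ℝ → ℝ} (hg : Continuous g) {T : ℝ} (hT : 0 ≤ T) (x₀ : E) :
    ∃ x : ℝ → E, x 0 = x₀ ∧
      ∀ t ∈ Set.Icc 0 T, HasDerivWithinAt x (g t • F (x t)) (Set.Icc 0 T) t := by
  have : CompleteSpace E := FiniteDimensional.complete ℝ E
  obtain ⟨K, hK⟩ := hF.lipschitzWith_of_hasCompactSupport hc one_ne_zero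
  obtain ⟨L, hL⟩ := hc.exists_bound_of_continuous hF.continuous
  obtain ⟨G, hG⟩ := (isCompact_Icc (a := (0 : ℝ)) (b := T)).exists_bound_of_continuousOn
    hg.continuousOn
  have hL0 : 0 ≤ L := (norm_nonneg _).trans (hL 0)
  have hG0 : 0 ≤ G := (norm_nonneg _).trans (hG 0 ⟨le_rfl, hT⟩)
  have hPL : IsPicardLindelof (fun t x => g t • F x) (tmin := 0) (tmax := T)
      ⟨0, le_rfl, hT⟩ x₀ ⟨G * L * T, by positivity⟩ 0 ⟨G * L, by positivity⟩
      ⟨G * K, by positivity⟩ := by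
    refine ⟨fun t ht => ?_, fun x _ => by fun_prop, fun t ht x _ => ?_, ?_⟩
    · refine LipschitzOnWith.of_dist_le_mul fun x _ y _ => ?_
      rw [dist_eq_norm, ← smul_sub, norm_smul, ← dist_eq_norm]
      change _ ≤ (G * K) * dist x y
      rw [mul_assoc]
      exact mul_le_mul (hG t ht) (hK.dist_le_mul x y) dist_nonneg hG0
    · rw [norm_smul]
      exact mul_le_mul (hG t ht) (hL x) (norm_nonneg _) hG0
    · simp only [sub_zero, sub_self, NNReal.coe_zero]
      rw [max_eq_left hT]; rfl
  exact hPL.exists_eq_forall_mem_Icc_hasDerivWithinAt₀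

/-! ### The Galerkin system -/

/-- The frequencies of length at most `R`. -/
def ballFreq (R : ℝ) : Finset (Fin 3 → ℤ) := (finite_freq_le R).toFinset

theorem mem_ballFreq {R : ℝ} {n : Fin 3 → ℤ} : n ∈ ballFreq R ↔ freq n ≤ R := by
  simp [ballFreq]

/-- Extension by zero of finitely many coefficients. -/
def gext {R : ℝ} (x : ballFreq R → Fin 2 → ℂ) : Coef :=
  fun n => if h : n ∈ ballFreq R then x ⟨n, h⟩ else 0

theorem gext_coe {R : ℝ} (x : ballFreq R → Fin 2 → ℂ) (n : ballFreq R) : gext x n = x n := by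
  simp [gext]

theorem gext_of_lt {R : ℝ} (x : ballFreq R → Fin 2 → ℂ) {n : Fin 3 → ℤ} (h : R < freq n) :
    gext x n = 0 := by
  rw [gext, dif_neg (by rw [mem_ballFreq]; exact not_le.mpr h)]

theorem gext_restrict (R : ℝ) (a : Coef) : gext (fun n : ballFreq R => a n) = trunc R a := by
  funext n
  simp only [gext, trunc, mem_ballFreq]
  split_ifs <;> rfl

/-- The truncated states with the symmetries of `H`. -/
def galSub (R : ℝ) : Submodule ℝ (ballFreq R → Fin 2 → ℂ) where
  carrier := {x | CoefH (gext x)}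
  zero_mem' := by
    have : gext (0 : ballFreq R → Fin 2 → ℂ) = fun _ _ => 0 := by
      funext n i; simp only [gext]; split_ifs <;> rfl
    rw [Set.mem_ofPred_eq, this]; exact coefH_zero
  add_mem' := fun {x y} hx hy => by
    have : gext (x + y) = fun n i => gext x n i + gext y n i := by
      funext n i; simp only [gext]; split_ifs <;> simp
    rw [Set.mem_ofPred_eq, this]; exact CoefH.add hx hy
  smul_mem' := fun c x hx => by
    have : gext (c • x) = fun n i => (c : ℂ) * gext x n i := by
      funext n i; simp only [gext]; split_ifs <;> simp
    rw [Set.mem_ofPred_eq, this]; exact CoefH.smul hx c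

theorem contDiff_gext {R : ℝ} (n : Fin 3 → ℤ) (i : Fin 2) :
    ContDiff ℝ 1 fun x : ballFreq R → Fin 2 → ℂ => gext x n i := by
  by_cases h : n ∈ ballFreq R
  · simp only [gext, dif_pos h]; fun_prop
  · simp only [gext, dif_neg h, Pi.zero_apply]; fun_prop

/-- On truncated states the convolution is a finite sum, so that the nonlinearity is a polynomial. -/
theorem contDiff_nl_gext {R : ℝ} (n : Fin 3 → ℤ) (i : Fin 2) :
    ContDiff ℝ 1 fun x : ballFreq R → Fin 2 → ℂ => nl (gext x) n i := by
  have hg := contDiff_gext (R := R)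
  have hd : ∀ j, ContDiff ℝ 1 fun x : ballFreq R → Fin 2 → ℂ => hdot (gext x) j := fun j => by
    simp only [hdot]
    exact ContDiff.sum fun h _ => contDiff_const.mul (hg j h)
  have hw : ∀ j, ContDiff ℝ 1 fun x : ballFreq R → Fin 2 → ℂ => wc (gext x) j := fun j => by
    simp only [wc, div_eq_mul_inv]
    exact (hd j).neg.mul contDiff_const
  have hk : ∀ j l, ContDiff ℝ 1 fun x : ballFreq R → Fin 2 → ℂ => kern (gext x) j l := fun j l => by
    simp only [kern]
    exact contDiff_const.mul ((ContDiff.sum fun h _ => (hg j h).mul contDiff_const).add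
      ((hw j).mul contDiff_const))
  have hc : ∀ i, ContDiff ℝ 1 fun x : ballFreq R → Fin 2 → ℂ => conv (gext x) (gext x) n i := by
    intro i
    have hfin : ∀ x : ballFreq R → Fin 2 → ℂ, conv (gext x) (gext x) n i =
        ∑ j ∈ ballFreq R, kern (gext x) j (n - j) * gext x (n - j) i := fun x => by
      refine tsum_eq_sum fun j hj => ?_
      have hj' : gext x j = 0 := by rw [gext, dif_neg hj]
      simp [kern, wc, hdot, hj']
    simp only [hfin]
    exact ContDiff.sum fun j _ => (hk j _).mul (hg _ i)
  simp only [nl, lerayc]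
  split_ifs
  · simp only [div_eq_mul_inv]
    exact (hc i).sub ((contDiff_const.mul (ContDiff.sum fun h _ => contDiff_const.mul (hc h))).mul
      contDiff_const)
  · exact hc i

/-- The Galerkin system, with its vector field cut off at large states. -/
theorem exists_cutoff_galerkin {a₀ : Coef} (h₀ : CoefH a₀) {g : ℝ → ℝ} (hg : Continuous g)
    {T ρ : ℝ} (hT : 0 ≤ T) (hρ : 0 < ρ) (R : ℝ) :
    ∃ (a : ℝ → Coef) (χ : ℝ → ℝ), a 0 = trunc R a₀ ∧ ∀ t ∈ Set.Icc 0 T,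
      CoefH (a t) ∧ (∀ n, R < freq n → a t n = 0) ∧ 0 ≤ χ t ∧ χ t ≤ 1 ∧
      ((∀ n, ‖a t n‖ ≤ ρ) → χ t = 1) ∧
      ∀ n i, HasDerivWithinAt (fun s => a s n i)
        (-((χ t * g t : ℝ) : ℂ) * trunc R (nl (a t)) n i) (Set.Icc 0 T) t := by
  let E := ballFreq R → Fin 2 → ℂ
  let bump : ContDiffBump (0 : galSub R) := ⟨ρ, ρ + 1, hρ, by linarith⟩
  let B : E → E := fun x n i => nl (gext x) n i
  have hB : ContDiff ℝ 1 B := contDiff_pi.mpr fun n => contDiff_pi.mpr fun i => contDiff_nl_gext n i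
  have hgB : ∀ x, gext (B x) = trunc R (nl (gext x)) := fun x => gext_restrict R (nl (gext x))
  have hBmem : ∀ x ∈ galSub R, B x ∈ galSub R := fun x hx => by
    change CoefH (gext (B x))
    rw [hgB]; exact (coefH_nl hx).trunc R
  obtain ⟨p, hp⟩ : ∃ p : E →ₗ[ℝ] galSub R, p ∘ₗ (galSub R).subtype = LinearMap.id :=
    LinearMap.exists_leftInverse_of_injective _ (Submodule.ker_subtype _)
  have hp' : ∀ x (hx : x ∈ galSub R), p x = ⟨x, hx⟩ := fun x hx => LinearMap.congr_fun hp ⟨x, hx⟩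
  let F : galSub R → galSub R := fun x => -(bump x • p.toContinuousLinearMap (B x))
  have hF : ContDiff ℝ 1 F :=
    ((bump.contDiff).smul (p.toContinuousLinearMap.contDiff.comp
      (hB.comp (galSub R).subtypeL.contDiff))).neg
  have hFc : HasCompactSupport F := by
    refine bump.hasCompactSupport.mono ?_
    intro x hx h0
    exact hx (by simp [F, h0])
  obtain ⟨x, hx0, hx⟩ := exists_ode_solution hF hFc hg hT
    (⟨fun n => a₀ n, by change CoefH (gext _); rw [gext_restrict]; exact h₀.trunc R⟩ : galSub R)
  refine ⟨fun t => gext (x t : E), fun t => bump (x t), ?_, fun t ht => ⟨(x t).2,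
    fun n hn => gext_of_lt _ hn, bump.nonneg, bump.le_one, fun h => ?_, fun n i => ?_⟩⟩
  · simp only [hx0]; exact gext_restrict R a₀
  · refine bump.one_of_mem_closedBall ?_
    rw [mem_closedBall_zero_iff]
    change ‖(x t : E)‖ ≤ ρ
    exact (pi_norm_le_iff_of_nonneg hρ.le).mpr fun n => by
      have h1 : ‖gext (x t : E) n‖ ≤ ρ := h n
      rwa [gext_coe] at h1
  · by_cases hn : n ∈ ballFreq R
    · have h1 := (galSub R).subtypeL.hasFDerivAt.comp_hasDerivWithinAt t (hx t ht)
      have h2 := hasDerivWithinAt_pi.mp (hasDerivWithinAt_pi.mp h1 ⟨n, hn⟩) i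
      simp only [gext, dif_pos hn]
      refine h2.congr_deriv ?_
      have h3 : (p.toContinuousLinearMap (B (x t)) : galSub R) = ⟨B (x t), hBmem _ (x t).2⟩ :=
        hp' _ (hBmem _ (x t).2)
      have h4 : trunc R (nl (gext (x t : E))) n i = B (x t) ⟨n, hn⟩ i := by
        simp only [trunc, if_pos (mem_ballFreq.mp hn)]; rfl
      change ((g t • F (x t) : galSub R) : E) ⟨n, hn⟩ i = -((bump (x t) * g t : ℝ) : ℂ) * trunc R (nl (gext (x t : E))) n i
      rw [h4]
      simp only [F, h3]
      simp
      ring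
    · have hn' : ¬ freq n ≤ R := fun h => hn (mem_ballFreq.mpr h)
      simp only [gext, dif_neg hn, trunc, if_neg hn', Pi.zero_apply, mul_zero]
      exact hasDerivWithinAt_const _ _ _

/-! ### The energy estimate for the Galerkin system -/

/-- The weight `e^{2φ|k|} |k|^{2σ}`. -/
def wgt (σ φ : ℝ) (n : Fin 3 → ℤ) : ℝ := Real.exp (2 * φ * freq n) * freq n ^ (2 * σ)

theorem wgt_nonneg (σ φ : ℝ) (n : Fin 3 → ℤ) : 0 ≤ wgt σ φ n :=
  mul_nonneg (Real.exp_pos _).le (Real.rpow_nonneg (freq_nonneg n) _)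

/-- The `n`-th term of the squared homogeneous Gevrey norm of a sequence of coefficients. -/
def cterm (σ φ : ℝ) (a : Coef) (n : Fin 3 → ℤ) : ℝ := wgt σ φ n * ∑ i, ‖a n i‖ ^ 2

theorem cterm_nonneg (σ φ : ℝ) (a : Coef) (n : Fin 3 → ℤ) : 0 ≤ cterm σ φ a n :=
  mul_nonneg (wgt_nonneg σ φ n) (Finset.sum_nonneg fun _ _ => sq_nonneg _)

theorem dotTerm_eq_cterm (σ φ : ℝ) (F : T3 → Fin 2 → ℝ) : dotTerm σ φ F = cterm σ φ (coeff F) := rfl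

theorem freq_mul_wgt (σ φ : ℝ) (hσ : 0 < σ) (n : Fin 3 → ℤ) :
    freq n * wgt σ φ n = wgt (σ + 1 / 2) φ n := by
  by_cases hn : n = 0
  · subst hn
    rw [wgt, wgt, freq_zero, Real.zero_rpow (by linarith), Real.zero_rpow (by linarith)]; ring
  · rw [wgt, wgt, show 2 * (σ + 1 / 2) = 2 * σ + 1 by ring, Real.rpow_add_one (freq_pos hn).ne']; ring

theorem one_le_wgt {σ φ : ℝ} (hσ : 0 < σ) (hφ : 0 ≤ φ) {n : Fin 3 → ℤ} (hn : n ≠ 0) :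
    1 ≤ wgt σ φ n := by
  have h1 : 1 ≤ Real.exp (2 * φ * freq n) :=
    Real.one_le_exp (mul_nonneg (by positivity) (freq_nonneg n))
  have h2 : 1 ≤ freq n ^ (2 * σ) := Real.one_le_rpow (one_le_freq hn) (by positivity)
  exact one_le_mul_of_one_le_of_one_le h1 h2

/-- The nonlinear estimate for truncated states. -/
theorem abs_galerkin_pairing_le {σ C : ℝ} (hNL : NonlinearEstimate σ C) {φ R : ℝ}
    (hφ : 0 ≤ φ) {a : Coef} (hH : CoefH a) (ha : ∀ n, R < freq n → a n = 0) :
    |∑ n ∈ ballFreq R, wgt σ φ n * (∑ i, nl a n i * (starRingEnd ℂ) (a n i)).re| ≤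
      C * √(∑ n ∈ ballFreq R, cterm σ φ a n) * ∑ n ∈ ballFreq R, cterm (σ + 1 / 2) φ a n := by
  have hw := wt_of_support ha 1
  have hser := synth_eq_fser hw hH.real
  have hco := coeff_synth hw hH.real
  have hz : ∀ n ∉ ballFreq R, a n = 0 := fun n hn => ha n (by
    rw [mem_ballFreq] at hn; exact not_le.mp hn)
  have hQ : coeff (Q (synth a) (synth a)) = conv a a :=
    coeff_eq_of_fser (Q_eq_fser hser hser hw hH hw) (hw.conv hw hH.zero).summable
  have hmem : MemGevrey (σ + 1 / 2) φ (synth a) :=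
    summable_of_ne_finset_zero (s := ballFreq R) fun n hn => by
      simp [gevreyTerm, coeffSq, hco, hz n hn]
  obtain ⟨-, h⟩ := hNL φ hφ (synth a) (memH_synth hw hH) hmem
  have hdot : ∀ τ, ∑' n, dotTerm τ φ (synth a) n = ∑ n ∈ ballFreq R, cterm τ φ a n := fun τ => by
    rw [dotTerm_eq_cterm, hco]
    exact tsum_eq_sum fun n hn => by simp [cterm, hz n hn]
  rw [gevreyDotNorm_sq, gevreyDotNorm_eq, hdot, hdot,
    tsum_eq_sum (s := ballFreq R) (fun n hn => by simp [pairTerm, hco, hz n hn])] at h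
  refine le_trans ?_ h
  refine le_trans (le_of_eq ?_) (Complex.abs_re_le_norm _)
  rw [Complex.re_sum]
  congr 1
  refine Finset.sum_congr rfl fun n _ => ?_
  rw [pairTerm, hQ, hco, Complex.re_ofReal_mul, nl, lerayc_inner (hH.div n)]
  rfl

/-- Galerkin approximations on `[0, T]`, bounded by `N` in the norm of radius `ψ(t)`. The decrease
of the radius contributes `ψ' ‖a‖₊²` to half the derivative of the energy, which absorbs the
nonlinear term `g C ‖a‖ ‖a‖₊²` as long as `‖a‖ ≤ N + δ`; the margin `δ` closes the continuity
argument. The same bound shows that the cut-off is never active. -/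
theorem exists_galerkin {σ C : ℝ} (hσ : 5 / 2 < σ) (hC : 0 < C) (hNL : NonlinearEstimate σ C)
    {a₀ : Coef} (h₀ : CoefH a₀) {g ψ ψ' : ℝ → ℝ} (hg : Continuous g) {T N δ : ℝ} (hT : 0 ≤ T)
    (hψ : ∀ t ∈ Set.Icc 0 T, 0 ≤ ψ t) (hψd : ∀ t, HasDerivAt ψ (ψ' t) t)
    (hg0 : ∀ t ∈ Set.Icc 0 T, 0 ≤ g t) (hN : 0 ≤ N) (hδ : 0 < δ)
    (hmargin : ∀ t ∈ Set.Icc 0 T, ψ' t + g t * C * (N + δ) ≤ 0)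
    (hs₀ : Summable (cterm σ (ψ 0) a₀)) (hN₀ : ∑' n, cterm σ (ψ 0) a₀ n ≤ N ^ 2) (R : ℝ) :
    ∃ a : ℝ → Coef, a 0 = trunc R a₀ ∧ ∀ t ∈ Set.Icc 0 T,
      CoefH (a t) ∧ (∀ n, R < freq n → a t n = 0) ∧
      ∑ n ∈ ballFreq R, cterm σ (ψ t) (a t) n ≤ N ^ 2 ∧
      ∀ n i, HasDerivWithinAt (fun s => a s n i)
        (-(g t : ℂ) * trunc R (nl (a t)) n i) (Set.Icc 0 T) t := by
  obtain ⟨a, χ, ha0, ha⟩ := exists_cutoff_galerkin h₀ hg hT (by linarith : 0 < N + 1) R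
  set Y : ℝ → ℝ := fun t => ∑ n ∈ ballFreq R, cterm σ (ψ t) (a t) n with hYdef
  set Z : ℝ → ℝ := fun t => ∑ n ∈ ballFreq R, cterm (σ + 1 / 2) (ψ t) (a t) n with hZdef
  set P : ℝ → ℝ := fun t => ∑ n ∈ ballFreq R, wgt σ (ψ t) n *
    (∑ i, nl (a t) n i * (starRingEnd ℂ) (a t n i)).re with hPdef
  have hY0 : ∀ t, 0 ≤ Y t := fun t => Finset.sum_nonneg fun n _ => cterm_nonneg _ _ _ _
  have hZ0 : ∀ t, 0 ≤ Z t := fun t => Finset.sum_nonneg fun n _ => cterm_nonneg _ _ _ _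
  have hP : ∀ t ∈ Set.Icc 0 T, |P t| ≤ C * √(Y t) * Z t := fun t ht =>
    abs_galerkin_pairing_le hNL (hψ t ht) (ha t ht).1 (ha t ht).2.1
  have hYd : ∀ t ∈ Set.Icc 0 T, HasDerivWithinAt Y (2 * ψ' t * Z t - 2 * (χ t * g t) * P t)
      (Set.Icc 0 T) t := by
    intro t ht
    obtain ⟨hH, hsupp, -, -, -, hd⟩ := ha t ht
    have hterm : ∀ n ∈ ballFreq R, HasDerivWithinAt (fun s => cterm σ (ψ s) (a s) n)
        (2 * ψ' t * cterm (σ + 1 / 2) (ψ t) (a t) n - 2 * (χ t * g t) * (wgt σ (ψ t) n *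
          (∑ i, nl (a t) n i * (starRingEnd ℂ) (a t n i)).re)) (Set.Icc 0 T) t := by
      intro n hn
      have h1 : HasDerivWithinAt (fun s => wgt σ (ψ s) n)
          (2 * ψ' t * wgt (σ + 1 / 2) (ψ t) n) (Set.Icc 0 T) t := by
        have h := ((((hψd t).const_mul 2).mul_const (freq n)).exp.mul_const
          (freq n ^ (2 * σ))).hasDerivWithinAt (s := Set.Icc 0 T)
        refine h.congr_deriv ?_
        rw [← freq_mul_wgt σ (ψ t) (by linarith), wgt]; ring
      have h2 : HasDerivWithinAt (fun s => ∑ i, ‖a s n i‖ ^ 2)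
          (∑ i, 2 * inner ℝ (a t n i) (-((χ t * g t : ℝ) : ℂ) * nl (a t) n i)) (Set.Icc 0 T) t := by
        refine HasDerivWithinAt.fun_sum fun i _ => ?_
        have := (hd n i).norm_sq
        rwa [trunc, if_pos (mem_ballFreq.mp hn)] at this
      refine (h1.mul h2).congr_deriv ?_
      have h3 : ∑ i, 2 * inner ℝ (a t n i) (-((χ t * g t : ℝ) : ℂ) * nl (a t) n i)
          = -2 * (χ t * g t) * (∑ i, nl (a t) n i * (starRingEnd ℂ) (a t n i)).re := by
        rw [Complex.re_sum, Finset.mul_sum]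
        refine Finset.sum_congr rfl fun i _ => ?_
        rw [Complex.inner, ← Complex.ofReal_neg, mul_assoc, Complex.re_ofReal_mul]; ring
      rw [h3, cterm]; ring
    refine (HasDerivWithinAt.fun_sum hterm).congr_deriv ?_
    rw [Finset.sum_sub_distrib, ← Finset.mul_sum, ← Finset.mul_sum]
  -- a state whose energy is below `(N + δ)²` does not gain energy
  have hdec : ∀ t ∈ Set.Icc 0 T, Y t ≤ (N + δ) ^ 2 →
      2 * ψ' t * Z t - 2 * (χ t * g t) * P t ≤ 0 := by
    intro t ht hYt
    obtain ⟨-, -, hχ0, hχ1, -⟩ := ha t ht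
    have h1 : √(Y t) ≤ N + δ := (Real.sqrt_le_left (by linarith)).mpr hYt
    have h2 := hP t ht
    have hgt := hg0 t ht
    have h3 : -(χ t * g t * P t) ≤ g t * (C * √(Y t) * Z t) := by
      calc -(χ t * g t * P t) ≤ |χ t * g t * P t| := neg_le_abs _
        _ = χ t * (g t * |P t|) := by
          rw [abs_mul, abs_mul, abs_of_nonneg hχ0, abs_of_nonneg hgt]; ring
        _ ≤ 1 * (g t * |P t|) := by gcongr
        _ ≤ _ := by rw [one_mul]; gcongr
    have h4 : g t * (C * √(Y t) * Z t) ≤ g t * (C * (N + δ) * Z t) := by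
      have := hZ0 t
      gcongr
    nlinarith [mul_le_mul_of_nonneg_right (hmargin t ht) (hZ0 t)]
  have hYinit : Y 0 ≤ N ^ 2 := by
    refine le_trans ?_ hN₀
    refine le_trans (le_of_eq (Finset.sum_congr rfl fun n hn => ?_))
      (hs₀.sum_le_tsum (ballFreq R) fun n _ => cterm_nonneg _ _ _ _)
    simp only [cterm, ha0, trunc, if_pos (mem_ballFreq.mp hn)]
  have hYc : ContinuousOn Y (Set.Icc 0 T) := fun t ht => (hYd t ht).continuousWithinAt
  have hYle : ∀ t ∈ Set.Icc 0 T, Y t ≤ N ^ 2 := by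
    intro t ht
    refine le_of_forall_pos_le_add fun ε hε => ?_
    -- compare with the barrier `N² + η t`, which stays below `(N + δ)²`
    set η : ℝ := min ε (δ ^ 2) / (T + 1) with hη
    have hη0 : 0 < η := by positivity
    have hηle : ∀ s ∈ Set.Icc 0 T, η * s ≤ min ε (δ ^ 2) := fun s hs => by
      rw [hη, div_mul_eq_mul_div, div_le_iff₀ (by linarith)]
      exact mul_le_mul_of_nonneg_left (by linarith [hs.2]) (by positivity)
    have h := image_le_of_deriv_right_lt_deriv_boundary' (f := Y)
      (f' := fun t => 2 * ψ' t * Z t - 2 * (χ t * g t) * P t) (B := fun s => N ^ 2 + η * s)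
      (B' := fun _ => η) (a := 0) (b := T) hYc
      (fun s hs => ((hYd s ⟨hs.1, hs.2.le⟩).mono_of_mem_nhdsWithin (Icc_mem_nhdsGE_of_mem hs)))
      (by simpa using hYinit) (by fun_prop)
      (fun s _ => by
        simpa using (((hasDerivAt_id s).const_mul η).const_add (N ^ 2)).hasDerivWithinAt)
      (fun s hs heq => by
        have hs' : s ∈ Set.Icc 0 T := ⟨hs.1, hs.2.le⟩
        refine lt_of_le_of_lt (hdec s hs' ?_) hη0
        rw [heq]
        nlinarith [hηle s hs', min_le_right ε (δ ^ 2)]) ht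
    exact h.trans (by linarith [hηle t ht, min_le_left ε (δ ^ 2)])
  refine ⟨a, ha0, fun t ht => ?_⟩
  obtain ⟨hH, hsupp, -, -, hχ, hd⟩ := ha t ht
  refine ⟨hH, hsupp, hYle t ht, ?_⟩
  have hχ1 : χ t = 1 := by
    refine hχ fun n => ?_
    by_cases hn : n = 0
    · rw [hn, hH.zero, norm_zero]; linarith
    by_cases hnR : n ∈ ballFreq R
    · have h1 : ‖a t n‖ ^ 2 ≤ N ^ 2 := by
        calc ‖a t n‖ ^ 2 ≤ ∑ i, ‖a t n i‖ ^ 2 := norm_sq_le_sum _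
          _ ≤ cterm σ (ψ t) (a t) n := le_mul_of_one_le_left
            (Finset.sum_nonneg fun _ _ => sq_nonneg _) (one_le_wgt (by linarith) (hψ t ht) hn)
          _ ≤ Y t := Finset.single_le_sum (f := fun m => cterm σ (ψ t) (a t) m)
            (fun m _ => cterm_nonneg _ _ _ _) hnR
          _ ≤ N ^ 2 := hYle t ht
      linarith [abs_le_of_sq_le_sq h1 hN, le_abs_self ‖a t n‖]
    · rw [hsupp n (by rw [mem_ballFreq] at hnR; exact not_le.mp hnR), norm_zero]; linarith
  simpa [hχ1] using hd

/-! ### Exponentially decaying coefficients -/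

/-- Zero mean and the pointwise decay `|a_k| ≤ M e^{-ε|k|}` of the coefficients. -/
structure ExpDecay (M ε : ℝ) (a : Coef) : Prop where
  zero : a 0 = 0
  le : ∀ n, ‖a n‖ ≤ M * Real.exp (-ε * freq n)

theorem ExpDecay.wt {M ε : ℝ} {a : Coef} (h : ExpDecay M ε a) (hε : 0 < ε) (p : ℕ) : Wt p a := by
  refine Summable.of_nonneg_of_le (fun n => ?_) (fun n => ?_) ((summable_exp_freq hε p).mul_left M)
  · have := freq_nonneg n; positivity
  · have := freq_nonneg n
    calc (1 + freq n) ^ p * ‖a n‖ ≤ (1 + freq n) ^ p * (M * Real.exp (-ε * freq n)) := by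
          gcongr; exact h.le n
      _ = _ := by ring

theorem ExpDecay.mono {M ε δ : ℝ} {a : Coef} (h : ExpDecay M ε a) (hM : 0 ≤ M) (hδ : δ ≤ ε) :
    ExpDecay M δ a := by
  refine ⟨h.zero, fun n => (h.le n).trans (mul_le_mul_of_nonneg_left (Real.exp_le_exp.mpr ?_) hM)⟩
  nlinarith [freq_nonneg n]

/-- A bounded Gevrey norm gives exponential decay of the coefficients. -/
theorem expDecay_of_cterm {σ φ N : ℝ} (hσ : 0 < σ) (hN : 0 ≤ N) {a : Coef} (h0 : a 0 = 0)
    (h : ∀ n, cterm σ φ a n ≤ N ^ 2) : ExpDecay N φ a := by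
  refine ⟨h0, fun n => ?_⟩
  by_cases hn : n = 0
  · rw [hn, h0, norm_zero]; positivity
  have h1 : (Real.exp (φ * freq n) * ‖a n‖) ^ 2 ≤ N ^ 2 := by
    refine le_trans ?_ (h n)
    have h2 : Real.exp (φ * freq n) ^ 2 = Real.exp (2 * φ * freq n) := by
      rw [← Real.exp_nat_mul]; congr 1; push_cast; ring
    rw [mul_pow, h2, cterm, wgt]
    have h3 : 1 ≤ freq n ^ (2 * σ) := Real.one_le_rpow (one_le_freq hn) (by positivity)
    exact mul_le_mul (le_mul_of_one_le_right (Real.exp_pos _).le h3) (norm_sq_le_sum _)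
      (sq_nonneg _) (by positivity)
  have h4 := (le_abs_self _).trans (abs_le_of_sq_le_sq h1 hN)
  have h5 : Real.exp (-φ * freq n) * Real.exp (φ * freq n) = 1 := by rw [← Real.exp_add]; simp
  calc ‖a n‖ = Real.exp (-φ * freq n) * (Real.exp (φ * freq n) * ‖a n‖) := by
        rw [← mul_assoc, h5, one_mul]
    _ ≤ Real.exp (-φ * freq n) * N := by gcongr
    _ = _ := mul_comm _ _

/-- The sequence `|k| e^{-ε|k|}`. -/
def dk (ε : ℝ) (n : Fin 3 → ℤ) : ℝ := freq n * Real.exp (-ε * freq n)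

theorem dk_nonneg (ε : ℝ) (n : Fin 3 → ℤ) : 0 ≤ dk ε n := mul_nonneg (freq_nonneg n) (Real.exp_pos _).le

theorem summable_dk {ε : ℝ} (hε : 0 < ε) : Summable (dk ε) :=
  .of_nonneg_of_le (dk_nonneg ε) (fun n => by
    rw [dk, pow_one]; gcongr; linarith) (summable_exp_freq hε 1)

theorem ExpDecay.freq_mul_le {M ε : ℝ} {a : Coef} (h : ExpDecay M ε a) (n : Fin 3 → ℤ) :
    freq n * ‖a n‖ ≤ M * dk ε n := by
  rw [dk]
  calc _ ≤ freq n * (M * Real.exp (-ε * freq n)) := mul_le_mul_of_nonneg_left (h.le n) (freq_nonneg n)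
    _ = _ := by ring

/-- The self-convolution of `|k| e^{-ε|k|}`, which dominates the nonlinear term. -/
def dkk (ε : ℝ) (n : Fin 3 → ℤ) : ℝ := ∑' j, dk ε j * dk ε (n - j)

theorem summable_dk_mul_sub {ε : ℝ} (hε : 0 < ε) (n : Fin 3 → ℤ) :
    Summable fun j => dk ε j * dk ε (n - j) :=
  (summable_mul_sub (summable_dk hε).norm (summable_dk hε).norm).prod_factor n

theorem summable_dkk {ε : ℝ} (hε : 0 < ε) : Summable (dkk ε) :=
  (summable_mul_sub (summable_dk hε).norm (summable_dk hε).norm).prod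

theorem norm_nl_le_conv (a : Coef) (n : Fin 3 → ℤ) : ‖nl a n‖ ≤ 3 * ‖conv a a n‖ :=
  (pi_norm_le_iff_of_nonneg (by positivity)).mpr fun i => norm_lerayc_le n _ i

/-- A bound for the nonlinear term which is summable and depends only on `M` and `ε`. -/
theorem ExpDecay.norm_nl_le {M ε : ℝ} {a : Coef} (h : ExpDecay M ε a) (hM : 0 ≤ M) (hε : 0 < ε)
    (n : Fin 3 → ℤ) : ‖nl a n‖ ≤ 9 * M ^ 2 * dkk ε n := by
  have hc := norm_conv_le (h.wt hε 1) (h.wt hε 1) h.zero n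
  have hle : ∀ j, (freq j * ‖a j‖) * (freq (n - j) * ‖a (n - j)‖) ≤ M ^ 2 * (dk ε j * dk ε (n - j)) :=
    fun j => by
      calc _ ≤ (M * dk ε j) * (M * dk ε (n - j)) :=
            mul_le_mul (h.freq_mul_le j) (h.freq_mul_le _)
              (mul_nonneg (freq_nonneg _) (norm_nonneg _)) (mul_nonneg hM (dk_nonneg _ _))
        _ = _ := by ring
  have hs := (summable_dk_mul_sub hε n).mul_left (M ^ 2)
  have h2 := Summable.tsum_le_tsum hle (.of_nonneg_of_le (fun j => by
    have := freq_nonneg j; have := freq_nonneg (n - j); positivity) hle hs) hs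
  rw [tsum_mul_left] at h2
  have h3 := norm_nl_le_conv a n
  rw [dkk]
  linarith

/-- The nonlinear term is continuous along pointwise convergence with uniform decay. -/
theorem tendsto_nl {α : Type*} {l : Filter α} {a : α → Coef} {b : Coef} {M ε : ℝ} (hM : 0 ≤ M)
    (hε : 0 < ε) (ha : ∀ᶠ x in l, ExpDecay M ε (a x))
    (h : ∀ n i, Tendsto (fun x => a x n i) l (𝓝 (b n i))) (n : Fin 3 → ℤ) (i : Fin 2) :
    Tendsto (fun x => nl (a x) n i) l (𝓝 (nl b n i)) := by
  have hd : ∀ j, Tendsto (fun x => hdot (a x) j) l (𝓝 (hdot b j)) := fun j =>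
    tendsto_finsetSum _ fun k _ => (h j k).const_mul _
  have hw : ∀ j, Tendsto (fun x => wc (a x) j) l (𝓝 (wc b j)) := fun j => (hd j).neg.div_const _
  have hk : ∀ j m, Tendsto (fun x => kern (a x) j m) l (𝓝 (kern b j m)) := fun j m =>
    ((tendsto_finsetSum _ fun k _ => (h j k).mul_const _).add ((hw j).mul_const _)).const_mul _
  have hc : ∀ i, Tendsto (fun x => conv (a x) (a x) n i) l (𝓝 (conv b b n i)) := fun i => by
    refine tendsto_tsum_of_dominated_convergence
      (bound := fun j => 3 * (M ^ 2 * (dk ε j * dk ε (n - j))))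
      (((summable_dk_mul_sub hε n).mul_left _).mul_left _) (fun j => (hk j _).mul (h _ i)) ?_
    filter_upwards [ha] with x hx j
    refine (norm_kern_mul_le hx.zero _ n j i).trans ?_
    calc _ ≤ 3 * ((M * dk ε j) * (M * dk ε (n - j))) := by
          have h1 := hx.freq_mul_le j
          have h2 := hx.freq_mul_le (n - j)
          have h3 := mul_nonneg (freq_nonneg (n - j)) (norm_nonneg (a x (n - j)))
          have h4 := mul_nonneg hM (dk_nonneg ε j)
          gcongr
      _ = _ := by ring
  simp only [nl, lerayc]
  split_ifs
  · exact (hc i).sub (((tendsto_finsetSum _ fun k _ => (hc k).const_mul _).const_mul _).div_const _)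
  · exact hc i

theorem coefH_of_tendsto {a : ℕ → Coef} {b : Coef} (ha : ∀ᶠ m in atTop, CoefH (a m))
    (h : ∀ n i, Tendsto (fun m => a m n i) atTop (𝓝 (b n i))) : CoefH b where
  real n i := by
    refine tendsto_nhds_unique (h (-n) i) (((Complex.continuous_conj.tendsto _).comp (h n i)).congr' ?_)
    filter_upwards [ha] with m hm
    exact (hm.real n i).symm
  zero := by
    funext i
    refine tendsto_nhds_unique (h 0 i) (tendsto_const_nhds.congr' ?_)
    filter_upwards [ha] with m hm
    rw [hm.zero]
  even n := by
    funext i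
    refine tendsto_nhds_unique (h (nflip n) i) ((h n i).congr' ?_)
    filter_upwards [ha] with m hm
    rw [hm.even]
  div n h2 := by
    have hd : Tendsto (fun m => hdot (a m) n) atTop (𝓝 (hdot b n)) :=
      tendsto_finsetSum _ fun k _ => (h n k).const_mul _
    refine tendsto_nhds_unique hd (tendsto_const_nhds.congr' ?_)
    filter_upwards [ha] with m hm
    exact (hm.div n h2).symm

/-! ### Compactness -/

/-- A sequence of functions on `[0, ∞)` which is eventually equi-Lipschitz on bounded intervals
converges pointwise when it does so at the rational times. -/
theorem cauchySeq_of_rat {f : ℕ → ℝ → ℂ}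
    (hL : ∀ T : ℝ, 0 ≤ T → ∃ L, ∀ᶠ m in atTop, ∀ s ∈ Set.Icc 0 T, ∀ t ∈ Set.Icc 0 T,
      ‖f m s - f m t‖ ≤ L * |s - t|)
    (hq : ∀ q : ℚ, 0 ≤ q → CauchySeq fun m => f m q) {t : ℝ} (ht : 0 ≤ t) :
    CauchySeq fun m => f m t := by
  obtain ⟨L, hL⟩ := hL (t + 1) (by linarith)
  obtain ⟨m₀, hm₀⟩ := eventually_atTop.mp hL
  have hL0 : 0 ≤ L := by
    have := (norm_nonneg _).trans (hm₀ m₀ le_rfl 0 ⟨le_rfl, by linarith⟩ 1 ⟨by norm_num, by linarith⟩)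
    simpa using this
  refine Metric.cauchySeq_iff.mpr fun ε hε => ?_
  obtain ⟨q, hq1, hq2⟩ := exists_rat_btwn (show t < t + min 1 (ε / (3 * (L + 1))) by
    have : 0 < min 1 (ε / (3 * (L + 1))) := by positivity
    linarith)
  have hq0 : (0 : ℝ) ≤ q := ht.trans hq1.le
  have hqT : (q : ℝ) ≤ t + 1 := hq2.le.trans (by linarith [min_le_left 1 (ε / (3 * (L + 1)))])
  have hqt : L * |t - q| < ε / 3 := by
    rw [abs_sub_comm, abs_of_pos (by linarith)]
    have h1 : (q : ℝ) - t < ε / (3 * (L + 1)) := by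
      linarith [min_le_right 1 (ε / (3 * (L + 1)))]
    rw [lt_div_iff₀ (by positivity)] at h1
    nlinarith
  obtain ⟨m₁, hm₁⟩ := Metric.cauchySeq_iff.mp (hq q (by exact_mod_cast hq0)) (ε / 3) (by positivity)
  refine ⟨max m₀ m₁, fun m hm k hk => ?_⟩
  have h1 := hm₀ m ((le_max_left _ _).trans hm) t ⟨ht, by linarith⟩ q ⟨hq0, hqT⟩
  have h2 := hm₀ k ((le_max_left _ _).trans hk) t ⟨ht, by linarith⟩ q ⟨hq0, hqT⟩
  have h3 := hm₁ m ((le_max_right _ _).trans hm) k ((le_max_right _ _).trans hk)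
  rw [dist_eq_norm] at h3 ⊢
  calc ‖f m t - f k t‖ = ‖(f m t - f m q) + (f m q - f k q) - (f k t - f k q)‖ := by ring_nf
    _ ≤ ‖f m t - f m q‖ + ‖f m q - f k q‖ + ‖f k t - f k q‖ :=
      (norm_sub_le _ _).trans (by gcongr; exact norm_add_le _ _)
    _ < ε := by linarith

/-- Arzelà–Ascoli for countably many coordinates on `[0, ∞)`. -/
theorem exists_subseq_tendsto {ι : Type*} [Countable ι] {f : ℕ → ℝ → ι → ℂ} {M : ℝ}
    (hM : ∀ q : ℚ, 0 ≤ q → ∀ᶠ m in atTop, ∀ i, ‖f m q i‖ ≤ M)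
    (hL : ∀ i, ∀ T : ℝ, 0 ≤ T → ∃ L, ∀ᶠ m in atTop, ∀ s ∈ Set.Icc 0 T, ∀ t ∈ Set.Icc 0 T,
      ‖f m s i - f m t i‖ ≤ L * |s - t|) :
    ∃ (θ : ℕ → ℕ) (F : ℝ → ι → ℂ), StrictMono θ ∧
      ∀ t, 0 ≤ t → ∀ i, Tendsto (fun m => f (θ m) t i) atTop (𝓝 (F t i)) := by
  classical
  let x : ℕ → ℚ × ι → ℂ := fun m p => if ‖f m p.1 p.2‖ ≤ M then f m p.1 p.2 else 0
  have hK : IsCompact (Set.pi Set.univ fun _ : ℚ × ι => Metric.closedBall (0 : ℂ) |M|) :=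
    isCompact_univ_pi fun _ => isCompact_closedBall _ _
  obtain ⟨y, -, θ, hθ, hlim⟩ := hK.tendsto_subseq (x := x) fun m p _ => by
    simp only [x, mem_closedBall_zero_iff]
    split_ifs with h
    · exact h.trans (le_abs_self M)
    · simp
  rw [tendsto_pi_nhds] at hlim
  have hcau : ∀ i, ∀ t : ℝ, 0 ≤ t → CauchySeq fun m => f (θ m) t i := fun i t ht => by
    refine cauchySeq_of_rat (f := fun m t => f (θ m) t i) (fun T hT => ?_) (fun q hq => ?_) ht
    · obtain ⟨L, hL⟩ := hL i T hT
      exact ⟨L, hθ.tendsto_atTop.eventually hL⟩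
    · refine ((hlim (q, i)).congr' ?_).cauchySeq
      filter_upwards [hθ.tendsto_atTop.eventually (hM q hq)] with m hm
      exact if_pos (hm i)
  choose! F hF using fun (t : ℝ) (ht : 0 ≤ t) (i : ι) => cauchySeq_tendsto_of_complete (hcau i t ht)
  exact ⟨θ, F, hθ, hF⟩

/-! ### Passage to the limit -/

/-- A function given by the integral of a function continuous on `[0, ∞)` is differentiable there. -/
theorem hasDerivWithinAt_of_eq_integral {f w : ℝ → ℂ} {c : ℂ} (hw : ContinuousOn w (Set.Ici 0))
    (hf : ∀ t, 0 ≤ t → f t = c + ∫ s in (0 : ℝ)..t, w s) {t : ℝ} (ht : 0 ≤ t) :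
    HasDerivWithinAt f (w t) (Set.Ici 0) t := by
  have hc : Continuous fun s => w (max s 0) :=
    hw.comp_continuous (by fun_prop) fun s => Set.mem_Ici.mpr (le_max_right s 0)
  have h := ((hc.integral_hasStrictDerivAt 0 t).hasDerivAt.const_add c).hasDerivWithinAt
    (s := Set.Ici 0)
  rw [max_eq_left ht] at h
  refine h.congr_of_mem (fun s hs => ?_) ht
  rw [hf s hs]
  congr 1
  refine intervalIntegral.integral_congr fun r hr => ?_
  rw [Set.uIcc_of_le hs] at hr
  simp only [max_eq_left hr.1]

/-- A global solution of `V' = -g(t) 𝒫 Q(V, V)` on the Fourier side, as a limit of Galerkin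
approximations. The bound at the decreasing radius `ψ` dominates the approximations and their time
derivatives, on bounded intervals, by fixed exponentially decaying sequences; this gives a
subsequence which converges mode by mode, and the integrated equation passes to the limit. The bound
on the norm survives by lower semicontinuity. -/
theorem exists_limit {σ C : ℝ} (hσ : 5 / 2 < σ) (hC : 0 < C) (hNL : NonlinearEstimate σ C)
    {a₀ : Coef} (h₀ : CoefH a₀) {g ψ ψ' : ℝ → ℝ} (hg : Continuous g) {N δ : ℝ}
    (hψ : ∀ t, 0 ≤ t → 0 < ψ t) (hanti : Antitone ψ) (hψd : ∀ t, HasDerivAt ψ (ψ' t) t)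
    (hg0 : ∀ t, 0 ≤ g t) (hN : 0 ≤ N) (hδ : 0 < δ)
    (hmargin : ∀ t, 0 ≤ t → ψ' t + g t * C * (N + δ) ≤ 0)
    (hs₀ : Summable (cterm σ (ψ 0) a₀)) (hN₀ : ∑' n, cterm σ (ψ 0) a₀ n ≤ N ^ 2) :
    ∃ V : ℝ → Coef, V 0 = a₀ ∧ ∀ t, 0 ≤ t →
      CoefH (V t) ∧ Summable (cterm σ (ψ t) (V t)) ∧ ∑' n, cterm σ (ψ t) (V t) n ≤ N ^ 2 ∧
      ∀ n i, HasDerivWithinAt (fun s => V s n i) (-(g t : ℂ) * nl (V t) n i) (Set.Ici 0) t := by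
  choose a ha0 ha using fun m : ℕ => exists_galerkin hσ hC hNL h₀ hg (T := m) m.cast_nonneg
    (fun t ht => (hψ t ht.1).le) hψd (fun t _ => hg0 t) hN hδ (fun t ht => hmargin t ht.1) hs₀ hN₀ m
  have hdecay : ∀ T : ℝ, ∀ m : ℕ, T ≤ m → ∀ t ∈ Set.Icc 0 T, ExpDecay N (ψ T) (a m t) := by
    intro T m hm t ht
    obtain ⟨hH, hsupp, hE, -⟩ := ha m t ⟨ht.1, ht.2.trans hm⟩
    refine (expDecay_of_cterm (σ := σ) (by linarith) hN hH.zero fun n => ?_).mono hN (hanti ht.2)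
    by_cases hn : n ∈ ballFreq (m : ℝ)
    · exact (Finset.single_le_sum (f := fun n => cterm σ (ψ t) (a m t) n)
        (fun _ _ => cterm_nonneg _ _ _ _) hn).trans hE
    · rw [mem_ballFreq] at hn
      simp [cterm, hsupp n (not_le.mp hn), sq_nonneg]
  have hbound : ∀ T : ℝ, 0 ≤ T → ∃ G, ∀ s ∈ Set.Icc 0 T, g s ≤ G := fun T _ => by
    obtain ⟨G, hG⟩ := (isCompact_Icc (a := (0 : ℝ)) (b := T)).exists_bound_of_continuousOn
      hg.continuousOn
    exact ⟨G, fun s hs => (le_abs_self _).trans (hG s hs)⟩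
  have hG0 : ∀ {T G : ℝ}, 0 ≤ T → (∀ s ∈ Set.Icc 0 T, g s ≤ G) → 0 ≤ G := fun hT hG =>
    (hg0 0).trans (hG 0 ⟨le_rfl, hT⟩)
  have htr : ∀ (m : ℕ) (b : Coef) n i, ‖trunc m b n i‖ ≤ ‖b n‖ := fun m b n i => by
    simp only [trunc]
    split_ifs
    · exact norm_le_pi_norm _ _
    · simp
  have hrhs : ∀ T : ℝ, 0 ≤ T → ∀ G, (∀ s ∈ Set.Icc 0 T, g s ≤ G) → ∀ m : ℕ, T ≤ m →
      ∀ t ∈ Set.Icc 0 T, ∀ n i,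
      ‖-(g t : ℂ) * trunc m (nl (a m t)) n i‖ ≤ G * (9 * N ^ 2 * dkk (ψ T) n) := by
    intro T hT G hG m hm t ht n i
    rw [norm_mul, norm_neg, Complex.norm_real, Real.norm_of_nonneg (hg0 t)]
    exact mul_le_mul (hG t ht) ((htr m _ n i).trans
      ((hdecay T m hm t ht).norm_nl_le hN (hψ T hT) n)) (norm_nonneg _) (hG0 hT hG)
  have hLip : ∀ n i, ∀ T : ℝ, 0 ≤ T → ∃ L, ∀ᶠ m : ℕ in atTop, ∀ s ∈ Set.Icc 0 T, ∀ t ∈ Set.Icc 0 T,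
      ‖a m s n i - a m t n i‖ ≤ L * |s - t| := by
    intro n i T hT
    obtain ⟨G, hG⟩ := hbound T hT
    refine ⟨G * (9 * N ^ 2 * dkk (ψ T) n), ?_⟩
    filter_upwards [eventually_ge_atTop ⌈T⌉₊] with m hm s hs t ht
    have hTm : T ≤ m := Nat.ceil_le.mp hm
    exact (convex_Icc 0 T).norm_image_sub_le_of_norm_hasDerivWithin_le
      (fun r hr => ((ha m r ⟨hr.1, hr.2.trans hTm⟩).2.2.2 n i).mono
        (Set.Icc_subset_Icc le_rfl hTm)) (fun r hr => hrhs T hT G hG m hTm r hr n i) ht hs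
  obtain ⟨θ, F, hθ, hF⟩ := exists_subseq_tendsto (ι := (Fin 3 → ℤ) × Fin 2)
    (f := fun m t p => a m t p.1 p.2) (M := N)
    (fun q hq => by
      filter_upwards [eventually_ge_atTop ⌈q⌉₊] with m hm p
      have hqm : (q : ℝ) ≤ m := by exact_mod_cast Nat.ceil_le.mp hm
      have hq' : (0 : ℝ) ≤ q := by exact_mod_cast hq
      have h := (hdecay q m hqm q ⟨hq', le_rfl⟩).le p.1
      refine (norm_le_pi_norm _ _).trans (h.trans (mul_le_of_le_one_right hN ?_))
      rw [Real.exp_le_one_iff]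
      nlinarith [hψ q hq', freq_nonneg p.1])
    (fun p => hLip p.1 p.2)
  set V : ℝ → Coef := fun t n i => F t (n, i) with hV
  have hlim : ∀ t, 0 ≤ t → ∀ n i, Tendsto (fun k => a (θ k) t n i) atTop (𝓝 (V t n i)) :=
    fun t ht n i => hF t ht (n, i)
  have hlarge : ∀ T : ℝ, ∀ᶠ k in atTop, T ≤ (θ k : ℝ) := fun T =>
    (tendsto_natCast_atTop_atTop.comp hθ.tendsto_atTop).eventually (eventually_ge_atTop T)
  have hVdecay : ∀ T : ℝ, ∀ t ∈ Set.Icc 0 T, ExpDecay N (ψ T) (V t) := by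
    intro T t ht
    have hvec : ∀ n, Tendsto (fun k => a (θ k) t n) atTop (𝓝 (V t n)) := fun n =>
      tendsto_pi_nhds.mpr fun i => hlim t ht.1 n i
    refine ⟨?_, fun n => le_of_tendsto (hvec n).norm ?_⟩
    · refine tendsto_nhds_unique (hvec 0) (tendsto_const_nhds.congr' ?_)
      filter_upwards [hlarge T] with k hk
      exact (hdecay T _ hk t ht).zero.symm
    · filter_upwards [hlarge T] with k hk
      exact (hdecay T _ hk t ht).le n
  have hVcont : ∀ n i, ContinuousOn (fun t => V t n i) (Set.Ici 0) := by
    intro n i t ht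
    obtain ⟨L, hL⟩ := hLip n i (t + 1) (by linarith [Set.mem_Ici.mp ht])
    have hVL : ∀ s ∈ Set.Icc 0 (t + 1), ‖V s n i - V t n i‖ ≤ L * |s - t| := fun s hs => by
      refine le_of_tendsto ((hlim s hs.1 n i).sub (hlim t ht n i)).norm ?_
      filter_upwards [hθ.tendsto_atTop.eventually hL] with k hk
      exact hk s hs t ⟨ht, by linarith⟩
    refine tendsto_iff_norm_sub_tendsto_zero.mpr (squeeze_zero' (.of_forall fun _ => norm_nonneg _)
      (g := fun s => L * |s - t|) ?_ ?_)
    · filter_upwards [inter_mem_nhdsWithin (Set.Ici 0) (Iio_mem_nhds (lt_add_one t))] with s hs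
      exact hVL s ⟨hs.1, le_of_lt hs.2⟩
    · have : Tendsto (fun s => L * |s - t|) (𝓝 t) (𝓝 (L * |t - t|)) :=
        (by fun_prop : Continuous fun s => L * |s - t|).tendsto t
      simp only [sub_self, abs_zero, mul_zero] at this
      exact this.mono_left nhdsWithin_le_nhds
  have hnlcont : ∀ n i, ContinuousOn (fun t => -(g t : ℂ) * nl (V t) n i) (Set.Ici 0) := by
    intro n i t ht
    refine (Complex.continuous_ofReal.comp hg).continuousWithinAt.neg.mul
      (tendsto_nl hN (hψ (t + 1) (by linarith [Set.mem_Ici.mp ht])) ?_ (fun n i => hVcont n i t ht) n i)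
    filter_upwards [inter_mem_nhdsWithin (Set.Ici 0) (Iio_mem_nhds (lt_add_one t))] with s hs
    exact hVdecay (t + 1) s ⟨hs.1, le_of_lt hs.2⟩
  have hV0 : V 0 = a₀ := by
    funext n i
    refine tendsto_nhds_unique (hlim 0 le_rfl n i) (tendsto_const_nhds.congr' ?_)
    filter_upwards [hlarge (freq n)] with k hk
    rw [ha0, trunc, if_pos hk]
  have hint : ∀ n i, ∀ t, 0 ≤ t → V t n i = a₀ n i + ∫ s in (0 : ℝ)..t, -(g s : ℂ) * nl (V s) n i := by
    intro n i t ht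
    obtain ⟨G, hG⟩ := hbound t ht
    have hcont : ∀ m : ℕ, t ≤ m →
        ContinuousOn (fun s => -(g s : ℂ) * nl (a m s) n i) (Set.Icc 0 t) := by
      intro m hm s hs
      refine (Complex.continuous_ofReal.comp hg).continuousWithinAt.neg.mul
        (tendsto_nl hN (hψ t ht) ?_ (fun n i => ?_) n i)
      · filter_upwards [self_mem_nhdsWithin] with r hr
        exact hdecay t m hm r hr
      · exact ((ha m s ⟨hs.1, hs.2.trans hm⟩).2.2.2 n i).continuousWithinAt.mono
          (Set.Icc_subset_Icc le_rfl hm)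
    have hm : ∀ m : ℕ, t ≤ m → freq n ≤ m →
        a m t n i = a₀ n i + ∫ s in (0 : ℝ)..t, -(g s : ℂ) * nl (a m s) n i := by
      intro m htm hnm
      have hd : ∀ s ∈ Set.Icc 0 t, HasDerivWithinAt (fun s => a m s n i)
          (-(g s : ℂ) * nl (a m s) n i) (Set.Icc 0 t) s := fun s hs => by
        have h := (ha m s ⟨hs.1, hs.2.trans htm⟩).2.2.2 n i
        rw [trunc, if_pos hnm] at h
        exact h.mono (Set.Icc_subset_Icc le_rfl htm)
      rw [intervalIntegral.integral_eq_sub_of_hasDerivAt_of_le ht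
        (fun s hs => (hd s hs).continuousWithinAt)
        (fun s hs => (hd s ⟨hs.1.le, hs.2.le⟩).hasDerivAt (Icc_mem_nhds hs.1 hs.2))
        ((hcont m htm).intervalIntegrable_of_Icc ht), ha0, trunc, if_pos hnm]
      ring
    refine tendsto_nhds_unique (hlim t ht n i) ?_
    have hconv : Tendsto (fun k => ∫ s in (0 : ℝ)..t, -(g s : ℂ) * nl (a (θ k) s) n i) atTop
        (𝓝 (∫ s in (0 : ℝ)..t, -(g s : ℂ) * nl (V s) n i)) := by
      refine intervalIntegral.tendsto_integral_filter_of_dominated_convergence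
        (fun _ => G * (9 * N ^ 2 * dkk (ψ t) n)) ?_ ?_ (by simp) ?_
      · filter_upwards [hlarge t] with k hk
        rw [Set.uIoc_of_le ht]
        exact ((hcont _ hk).mono Set.Ioc_subset_Icc_self).aestronglyMeasurable measurableSet_Ioc
      · filter_upwards [hlarge t, hlarge (freq n)] with k hk hk'
        refine .of_forall fun s hs => ?_
        rw [Set.uIoc_of_le ht] at hs
        have h := hrhs t ht G hG _ hk s (Set.Ioc_subset_Icc_self hs) n i
        rwa [trunc, if_pos hk'] at h
      · refine .of_forall fun s hs => ?_
        rw [Set.uIoc_of_le ht] at hs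
        refine (tendsto_nl hN (hψ t ht) ?_ (fun n i => hlim s hs.1.le n i) n i).const_mul _
        filter_upwards [hlarge t] with k hk
        exact hdecay t _ hk s (Set.Ioc_subset_Icc_self hs)
    refine (hconv.const_add (a₀ n i)).congr' ?_
    filter_upwards [hlarge t, hlarge (freq n)] with k hk hk'
    exact (hm _ hk hk').symm
  refine ⟨V, hV0, fun t ht => ?_⟩
  have hfin : ∀ s : Finset (Fin 3 → ℤ), ∑ n ∈ s, cterm σ (ψ t) (V t) n ≤ N ^ 2 := by
    intro s
    have hl : Tendsto (fun k => ∑ n ∈ s, cterm σ (ψ t) (a (θ k) t) n) atTop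
        (𝓝 (∑ n ∈ s, cterm σ (ψ t) (V t) n)) :=
      tendsto_finsetSum _ fun n _ =>
        (tendsto_finsetSum _ fun i _ => (hlim t ht n i).norm.pow 2).const_mul _
    refine le_of_tendsto hl ?_
    have hs : ∀ᶠ k in atTop, ∀ n ∈ s, freq n ≤ (θ k : ℝ) :=
      (Filter.eventually_all_finset s).mpr fun n _ => hlarge (freq n)
    filter_upwards [hlarge t, hs] with k hk hk'
    refine (Finset.sum_le_sum_of_subset_of_nonneg (fun n hn => mem_ballFreq.mpr (hk' n hn))
      fun n _ _ => cterm_nonneg _ _ _ _).trans (ha (θ k) t ⟨ht, hk⟩).2.2.1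
  refine ⟨coefH_of_tendsto ?_ (hlim t ht), summable_of_sum_le (fun n => cterm_nonneg _ _ _ _) hfin,
    Real.tsum_le_of_sum_le (fun n => cterm_nonneg _ _ _ _) hfin, fun n i => ?_⟩
  · filter_upwards [hlarge t] with k hk
    exact (ha _ t ⟨ht, hk⟩).1
  · exact hasDerivWithinAt_of_eq_integral (hnlcont n i) (hint n i) ht

/-! ### Continuity in time with values in a Gevrey class -/

/-- In `ℓ²`, coordinatewise convergence without gain of norm in the limit is strong convergence. -/
theorem tendsto_tsum_norm_sub_sq {α ι E : Type*} [SeminormedAddCommGroup E] {l : Filter α}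
    {x : α → ι → E} {y : ι → E} (hy : Summable fun i => ‖y i‖ ^ 2)
    (hx : ∀ᶠ s in l, Summable fun i => ‖x s i‖ ^ 2)
    (hle : ∀ᶠ s in l, ∑' i, ‖x s i‖ ^ 2 ≤ ∑' i, ‖y i‖ ^ 2)
    (hlim : ∀ i, Tendsto (fun s => x s i) l (𝓝 (y i))) :
    Tendsto (fun s => ∑' i, ‖x s i - y i‖ ^ 2) l (𝓝 0) := by
  classical
  refine (tendsto_order.mpr ⟨fun a ha => .of_forall fun s =>
    lt_of_lt_of_le ha (tsum_nonneg fun i => sq_nonneg _), fun ε hε => ?_⟩)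
  obtain ⟨F, hF⟩ := ((tendsto_order.mp hy.hasSum).1 _
    (show ∑' i, ‖y i‖ ^ 2 - ε / 9 < ∑' i, ‖y i‖ ^ 2 by linarith)).exists
  have h1 : ∀ᶠ s in l, ∑' i, ‖y i‖ ^ 2 - ε / 9 < ∑ i ∈ F, ‖x s i‖ ^ 2 :=
    (tendsto_order.mp (tendsto_finsetSum F fun i _ => ((hlim i).norm.pow 2))).1 _ hF
  have h2 : ∀ᶠ s in l, ∑ i ∈ F, ‖x s i - y i‖ ^ 2 < ε / 9 := by
    have h : Tendsto (fun s => ∑ i ∈ F, ‖x s i - y i‖ ^ 2) l (𝓝 (∑ i ∈ F, ‖y i - y i‖ ^ 2)) :=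
      tendsto_finsetSum F fun i _ => (((hlim i).sub_const (y i)).norm.pow 2)
    refine (tendsto_order.mp h).2 _ ?_
    simp; linarith
  filter_upwards [hx, hle, h1, h2] with s hxs hles h1s h2s
  have hpt : ∀ i, ‖x s i - y i‖ ^ 2 ≤ 2 * (‖x s i‖ ^ 2 + ‖y i‖ ^ 2) := fun i => by
    have := norm_sub_le (x s i) (y i)
    nlinarith [norm_nonneg (x s i - y i), sq_nonneg (‖x s i‖ - ‖y i‖)]
  have hs : Summable fun i => ‖x s i - y i‖ ^ 2 :=
    .of_nonneg_of_le (fun i => sq_nonneg _) hpt ((hxs.add hy).mul_left 2)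
  have hxc := hxs.sum_add_tsum_subtype_compl F
  have hyc := hy.sum_add_tsum_subtype_compl F
  have hsc := hs.sum_add_tsum_subtype_compl F
  have hcompl : ∑' i : {i // i ∉ F}, ‖x s i - y i‖ ^ 2 ≤
      2 * ((∑' i : {i // i ∉ F}, ‖x s i‖ ^ 2) + ∑' i : {i // i ∉ F}, ‖y i‖ ^ 2) := by
    have hxs' : Summable fun i : {i // i ∉ F} => ‖x s i‖ ^ 2 := hxs.subtype _
    have hy' : Summable fun i : {i // i ∉ F} => ‖y i‖ ^ 2 := hy.subtype _
    have hs' : Summable fun i : {i // i ∉ F} => ‖x s i - y i‖ ^ 2 := hs.subtype _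
    rw [← hxs'.tsum_add hy', ← tsum_mul_left]
    exact hs'.tsum_le_tsum (fun i => hpt i) ((hxs'.add hy').mul_left 2)
  linarith

/-- For zero mean, the inhomogeneous norm is controlled by the homogeneous one. -/
theorem gevreyTerm_le {σ φ ψ : ℝ} (hσ : 0 < σ) (hφ : 0 ≤ φ) (hφψ : φ ≤ ψ) {F : T3 → Fin 2 → ℝ}
    (h0 : coeff F 0 = 0) (n : Fin 3 → ℤ) : gevreyTerm σ φ F n ≤ 2 * cterm σ ψ (coeff F) n := by
  by_cases hn : n = 0
  · subst hn; simp [gevreyTerm, coeffSq, cterm, h0]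
  · have h1 := one_le_wgt hσ hφ hn
    have h2 : wgt σ φ n ≤ wgt σ ψ n := by
      have := freq_nonneg n
      refine mul_le_mul_of_nonneg_right (Real.exp_le_exp.mpr ?_) (Real.rpow_nonneg this _)
      gcongr
    rw [cterm, ← mul_assoc]
    refine mul_le_mul_of_nonneg_right ?_ (coeffSq_nonneg F n)
    change 1 + wgt σ φ n ≤ _
    linarith

theorem norm_weight_mul_sq (σ φ : ℝ) (n : Fin 3 → ℤ) (z : ℂ) :
    ‖((Real.exp (φ * freq n) * freq n ^ σ : ℝ) : ℂ) * z‖ ^ 2 = wgt σ φ n * ‖z‖ ^ 2 := by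
  have h1 : (freq n ^ σ) ^ 2 = freq n ^ (2 * σ) := by
    rw [← Real.rpow_natCast, ← Real.rpow_mul (freq_nonneg n)]; congr 1; push_cast; ring
  have h2 : Real.exp (φ * freq n) ^ 2 = Real.exp (2 * φ * freq n) := by
    rw [← Real.exp_nat_mul]; congr 1; push_cast; ring
  rw [norm_mul, mul_pow, Complex.norm_real, Real.norm_eq_abs, sq_abs, mul_pow, h1, h2, wgt]

theorem wgt_eq_exp_mul (σ φ ψ : ℝ) (n : Fin 3 → ℤ) :
    wgt σ φ n = Real.exp (-(2 * (ψ - φ)) * freq n) * wgt σ ψ n := by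
  rw [wgt, wgt, ← mul_assoc, ← Real.exp_add]; congr 2; ring

/-- Coefficients bounded at a radius `ψ` and continuous in time give a field which is continuous
with values in the Gevrey class of a radius `φ`, if `φ < ψ` at positive times, `φ = ψ` at time
zero, and the norm is maximal at time zero. -/
theorem contGevrey_synth {σ : ℝ} (hσ : 5 / 2 < σ) {φ ψ : ℝ → ℝ} {A : ℝ → Coef}
    (hφc : Continuous φ) (hψc : Continuous ψ) (hφ0 : ∀ t, 0 ≤ t → 0 < φ t) (h0 : φ 0 = ψ 0)
    (hlt : ∀ t, 0 < t → φ t < ψ t) (hH : ∀ t, 0 ≤ t → CoefH (A t))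
    (hs : ∀ t, 0 ≤ t → Summable (cterm σ (ψ t) (A t)))
    (hle : ∀ t, 0 ≤ t → ∑' n, cterm σ (ψ t) (A t) n ≤ ∑' n, cterm σ (ψ 0) (A 0) n)
    (hc : ∀ n i, ContinuousOn (fun t => A t n i) (Set.Ici 0)) :
    ContGevrey σ φ fun t => synth (A t) := by
  have hφψ : ∀ t, 0 ≤ t → φ t ≤ ψ t := fun t ht => by
    rcases ht.eq_or_lt with rfl | h
    · exact h0.le
    · exact (hlt t h).le
  set N : ℝ := √(∑' n, cterm σ (ψ 0) (A 0) n) with hNdef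
  have hN : 0 ≤ N := Real.sqrt_nonneg _
  have hN2 : N ^ 2 = ∑' n, cterm σ (ψ 0) (A 0) n := Real.sq_sqrt (tsum_nonneg (cterm_nonneg _ _ _))
  have hterm : ∀ t, 0 ≤ t → ∀ n, cterm σ (ψ t) (A t) n ≤ N ^ 2 := fun t ht n => by
    rw [hN2]
    exact ((hs t ht).le_tsum n fun _ _ => cterm_nonneg _ _ _ _).trans (hle t ht)
  have hdec : ∀ t, 0 ≤ t → ExpDecay N (ψ t) (A t) := fun t ht =>
    expDecay_of_cterm (by linarith) hN (hH t ht).zero (hterm t ht)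
  have hw : ∀ t, 0 ≤ t → Wt 1 (A t) := fun t ht =>
    (hdec t ht).wt ((hφ0 t ht).trans_le (hφψ t ht)) 1
  have hco : ∀ t, 0 ≤ t → coeff (synth (A t)) = A t := fun t ht =>
    coeff_synth (hw t ht) (hH t ht).real
  refine ⟨fun t ht => memH_synth (hw t ht) (hH t ht), fun t ht => ?_, fun t ht => ?_⟩
  · refine Summable.of_nonneg_of_le (fun n => ?_) (gevreyTerm_le (by linarith) (hφ0 t ht).le
      (hφψ t ht) (by rw [hco t ht]; exact (hH t ht).zero)) (((hs t ht).mul_left 2).congr fun n => by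
        rw [hco t ht])
    exact mul_nonneg (add_nonneg zero_le_one (wgt_nonneg σ (φ t) n)) (coeffSq_nonneg _ n)
  · set l := 𝓝[Set.Ici 0] t
    have hl0 : ∀ᶠ s in l, (0 : ℝ) ≤ s := self_mem_nhdsWithin
    -- the weighted coefficients, as vectors of the Hermitian space `ℂ²`
    let X : ℝ → (Fin 3 → ℤ) → EuclideanSpace ℂ (Fin 2) := fun s n =>
      WithLp.toLp 2 fun i => ((Real.exp (φ s * freq n) * freq n ^ σ : ℝ) : ℂ) * A s n i
    let Y : ℝ → (Fin 3 → ℤ) → EuclideanSpace ℂ (Fin 2) := fun s n => WithLp.toLp 2 (A s n)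
    have hXn : ∀ s n, ‖X s n‖ ^ 2 = cterm σ (φ s) (A s) n := fun s n => by
      rw [EuclideanSpace.norm_sq_eq, cterm, Finset.mul_sum]
      exact Finset.sum_congr rfl fun i _ => norm_weight_mul_sq _ _ _ _
    have hYn : ∀ s n, ‖Y s n‖ ^ 2 = ∑ i, ‖A s n i‖ ^ 2 := fun s n => EuclideanSpace.norm_sq_eq _
    have hsubsq : ∀ u v : EuclideanSpace ℂ (Fin 2), ‖u - v‖ ^ 2 ≤ 2 * (‖u‖ ^ 2 + ‖v‖ ^ 2) :=
      fun u v => by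
        have := norm_sub_le u v
        nlinarith [norm_nonneg (u - v), sq_nonneg (‖u‖ - ‖v‖)]
    have hXlim : ∀ n, Tendsto (fun s => X s n) l (𝓝 (X t n)) := fun n => by
      refine ((PiLp.continuous_toLp 2 _).tendsto _).comp (tendsto_pi_nhds.mpr fun i => ?_)
      refine Tendsto.mul ?_ (hc n i t ht)
      exact ((by fun_prop : Continuous fun s => ((Real.exp (φ s * freq n) * freq n ^ σ : ℝ) : ℂ)).tendsto
        t).mono_left nhdsWithin_le_nhds
    have hYlim : ∀ n, Tendsto (fun s => Y s n) l (𝓝 (Y t n)) := fun n =>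
      ((PiLp.continuous_toLp 2 _).tendsto _).comp (tendsto_pi_nhds.mpr fun i => hc n i t ht)
    have hXs : ∀ s, 0 ≤ s → Summable fun n => ‖X s n‖ ^ 2 := fun s hs0 => by
      simp only [hXn]
      refine .of_nonneg_of_le (cterm_nonneg _ _ _) (fun n => ?_) (hs s hs0)
      rw [cterm, cterm, wgt_eq_exp_mul σ (φ s) (ψ s) n]
      refine mul_le_mul_of_nonneg_right (mul_le_of_le_one_left (wgt_nonneg _ _ _) ?_)
        (Finset.sum_nonneg fun _ _ => sq_nonneg _)
      rw [Real.exp_le_one_iff]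
      nlinarith [freq_nonneg n, hφψ s hs0]
    have hYle : ∀ s, 0 ≤ s → ∀ n, ‖Y s n‖ ^ 2 ≤ 2 * N ^ 2 * Real.exp (-ψ s * freq n) := fun s hs0 n => by
      have h1 := (hdec s hs0).le n
      have h2 : Real.exp (-ψ s * freq n) ≤ 1 := by
        rw [Real.exp_le_one_iff]
        nlinarith [freq_nonneg n, hφψ s hs0, hφ0 s hs0]
      have h3 : ‖A s n‖ ^ 2 ≤ N ^ 2 * Real.exp (-ψ s * freq n) := by
        calc ‖A s n‖ ^ 2 ≤ (N * Real.exp (-ψ s * freq n)) ^ 2 := by gcongr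
          _ = N ^ 2 * Real.exp (-ψ s * freq n) * Real.exp (-ψ s * freq n) := by ring
          _ ≤ _ := mul_le_of_le_one_right (by positivity) h2
      have h4 : ∀ i, ‖A s n i‖ ^ 2 ≤ ‖A s n‖ ^ 2 := fun i => by
        gcongr; exact norm_le_pi_norm _ _
      rw [hYn, Fin.sum_univ_two]
      linarith [h4 0, h4 1]
    have hψt : 0 < ψ t := (hφ0 t ht).trans_le (hφψ t ht)
    have hψl : ∀ᶠ s in l, ψ t / 2 < ψ s :=
      ((hψc.tendsto t).mono_left nhdsWithin_le_nhds).eventually (lt_mem_nhds (by linarith))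
    have hYs : ∀ s, 0 ≤ s → Summable fun n => ‖Y s n‖ ^ 2 := fun s hs0 =>
      .of_nonneg_of_le (fun _ => sq_nonneg _) (hYle s hs0)
        ((by simpa using summable_exp_freq ((hφ0 s hs0).trans_le (hφψ s hs0)) 0 :
          Summable fun n : Fin 3 → ℤ => Real.exp (-ψ s * freq n)).mul_left _)
    have hdist : ∀ s, 0 ≤ s → movingDistSq σ (φ s) (φ t) (synth (A s)) (synth (A t))
        = (∑' n, ‖X s n - X t n‖ ^ 2) + ∑' n, ‖Y s n - Y t n‖ ^ 2 := fun s hs0 => by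
      have h1 : Summable fun n => ‖X s n - X t n‖ ^ 2 :=
        .of_nonneg_of_le (fun _ => sq_nonneg _) (fun n => hsubsq _ _)
          (((hXs s hs0).add (hXs t ht)).mul_left 2)
      have h2 : Summable fun n => ‖Y s n - Y t n‖ ^ 2 :=
        .of_nonneg_of_le (fun _ => sq_nonneg _) (fun n => hsubsq _ _)
          (((hYs s hs0).add (hYs t ht)).mul_left 2)
      rw [← h1.tsum_add h2, movingDistSq, hco s hs0, hco t ht]
      refine tsum_congr fun n => ?_
      rw [Finset.sum_add_distrib, EuclideanSpace.norm_sq_eq, EuclideanSpace.norm_sq_eq]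
      rfl
    have hX : Tendsto (fun s => ∑' n, ‖X s n - X t n‖ ^ 2) l (𝓝 0) := by
      rcases ht.eq_or_lt with h | h
      -- at time zero there is no room between the radii; the norm does not exceed its initial value
      · refine tendsto_tsum_norm_sub_sq (hXs t ht) ?_ ?_ hXlim
        · filter_upwards [hl0] with s hs0 using hXs s hs0
        · filter_upwards [hl0] with s hs0
          simp only [hXn]
          rw [← h, h0]
          refine le_trans ((by simpa only [hXn] using hXs s hs0 : Summable _).tsum_le_tsum
            (fun n => ?_) (hs s hs0)) (hle s hs0)
          rw [cterm, cterm, wgt_eq_exp_mul σ (φ s) (ψ s) n]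
          refine mul_le_mul_of_nonneg_right (mul_le_of_le_one_left (wgt_nonneg _ _ _) ?_)
            (Finset.sum_nonneg fun _ _ => sq_nonneg _)
          rw [Real.exp_le_one_iff]
          nlinarith [freq_nonneg n, hφψ s hs0]
      · -- near `t` the radius `ψ` exceeds `φ` by `η`, so that the tails decay exponentially
        set η : ℝ := (ψ t - φ t) / 2 with hη
        have hη0 : 0 < η := by rw [hη]; linarith [hlt t h]
        have hηl : ∀ᶠ s in l, η < ψ s - φ s :=
          (((hψc.sub hφc).tendsto t).mono_left nhdsWithin_le_nhds).eventually
            (lt_mem_nhds (show η < ψ t - φ t by linarith))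
        have hXle : ∀ s, 0 ≤ s → η ≤ ψ s - φ s → ∀ n,
            ‖X s n‖ ^ 2 ≤ N ^ 2 * Real.exp (-(2 * η) * freq n) := fun s hs0 hηs n => by
          rw [hXn, cterm, wgt_eq_exp_mul σ (φ s) (ψ s) n, mul_assoc, mul_comm]
          refine mul_le_mul (hterm s hs0 n) (Real.exp_le_exp.mpr ?_) (Real.exp_pos _).le (by positivity)
          nlinarith [freq_nonneg n]
        have hlim := tendsto_tsum_of_dominated_convergence (𝓕 := l)
          (f := fun s n => ‖X s n - X t n‖ ^ 2) (g := fun _ => (0 : ℝ))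
          (bound := fun n : Fin 3 → ℤ => 4 * N ^ 2 * Real.exp (-(2 * η) * freq n))
          ((by simpa using summable_exp_freq (ε := 2 * η) (by linarith) 0 :
            Summable fun n : Fin 3 → ℤ => Real.exp (-(2 * η) * freq n)).mul_left _)
          (fun n => by simpa using (((hXlim n).sub_const (X t n)).norm.pow 2)) (by
            filter_upwards [hl0, hηl] with s hs0 hηs n
            rw [Real.norm_of_nonneg (sq_nonneg _)]
            refine (hsubsq _ _).trans ?_
            linarith [hXle s hs0 hηs.le n, hXle t ht (by rw [hη]; linarith [hlt t h]) n])
        simpa using hlim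
    have hY : Tendsto (fun s => ∑' n, ‖Y s n - Y t n‖ ^ 2) l (𝓝 0) := by
      have hlim := tendsto_tsum_of_dominated_convergence (𝓕 := l)
        (f := fun s n => ‖Y s n - Y t n‖ ^ 2) (g := fun _ => (0 : ℝ))
        (bound := fun n : Fin 3 → ℤ => 8 * N ^ 2 * Real.exp (-(ψ t / 2) * freq n))
        ((by simpa using summable_exp_freq (ε := ψ t / 2) (by linarith) 0 :
          Summable fun n : Fin 3 → ℤ => Real.exp (-(ψ t / 2) * freq n)).mul_left _)
        (fun n => by simpa using (((hYlim n).sub_const (Y t n)).norm.pow 2)) (by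
          filter_upwards [hl0, hψl] with s hs0 hψs n
          rw [Real.norm_of_nonneg (sq_nonneg _)]
          refine (hsubsq _ _).trans ?_
          have h1 : Real.exp (-ψ s * freq n) ≤ Real.exp (-(ψ t / 2) * freq n) :=
            Real.exp_le_exp.mpr (by nlinarith [freq_nonneg n])
          have h2 : Real.exp (-ψ t * freq n) ≤ Real.exp (-(ψ t / 2) * freq n) :=
            Real.exp_le_exp.mpr (by nlinarith [freq_nonneg n])
          have h3 : 0 ≤ 2 * N ^ 2 := by positivity
          nlinarith [hYle s hs0 n, hYle t ht n, mul_le_mul_of_nonneg_left h1 h3,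
            mul_le_mul_of_nonneg_left h2 h3])
      simpa using hlim
    have hsum := hX.add hY
    rw [add_zero] at hsum
    refine hsum.congr' ?_
    filter_upwards [hl0] with s hs0
    exact (hdist s hs0).symm

/-! ### Existence -/

/-- Termwise differentiation on `[0, ∞)`, with the one-sided derivative at `0`. -/
theorem hasDerivWithinAt_tsum {ι : Type*} {f f' : ι → ℝ → ℂ} {u : ι → ℝ} {t : ℝ}
    (hu : Summable u) (hf : ∀ n, ∀ s, 0 ≤ s → HasDerivWithinAt (f n) (f' n s) (Set.Ici 0) s)
    (hf' : ∀ n, ∀ s ∈ Set.Icc 0 (t + 1), ‖f' n s‖ ≤ u n) (h0 : Summable fun n => f n 0)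
    (ht : 0 ≤ t) :
    HasDerivWithinAt (fun s => ∑' n, f n s) (∑' n, f' n t) (Set.Ici 0) t := by
  -- extend every term to negative times by its tangent at time zero
  let F : ι → ℝ → ℂ := fun n s => f n (max s 0) + (min s 0 : ℝ) * f' n 0
  have hF : ∀ n s, 0 ≤ s → F n s = f n s := fun n s hs => by
    simp only [F, max_eq_left hs, min_eq_right hs]; simp
  have hFneg : ∀ n s, s ≤ 0 → F n s = f n 0 + (s : ℂ) * f' n 0 := fun n s hs => by
    simp only [F, max_eq_right hs, min_eq_left hs]
  have hlin : ∀ n s, HasDerivAt (fun s : ℝ => f n 0 + (s : ℂ) * f' n 0) (f' n 0) s := fun n s => by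
    simpa using ((Complex.ofRealCLM.hasDerivAt (x := s)).mul_const (f' n 0)).const_add (f n 0)
  have hd : ∀ n s, HasDerivAt (F n) (f' n (max s 0)) s := fun n s => by
    rcases lt_trichotomy s 0 with hs | rfl | hs
    · rw [max_eq_right hs.le]
      refine (hlin n s).congr_of_eventuallyEq ?_
      filter_upwards [Iio_mem_nhds hs] with r hr using hFneg n r (le_of_lt hr)
    · rw [max_self]
      have h1 : HasDerivWithinAt (F n) (f' n 0) (Set.Ici 0) 0 :=
        (hf n 0 le_rfl).congr_of_mem (fun r hr => hF n r hr) Set.self_mem_Ici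
      have h2 : HasDerivWithinAt (F n) (f' n 0) (Set.Iic 0) 0 :=
        (hlin n 0).hasDerivWithinAt.congr_of_mem (fun r hr => hFneg n r hr) Set.self_mem_Iic
      have h := h1.union h2
      rwa [Set.Ici_union_Iic, hasDerivWithinAt_univ] at h
    · rw [max_eq_left hs.le]
      refine ((hf n s hs.le).hasDerivAt (Ici_mem_nhds hs)).congr_of_eventuallyEq ?_
      filter_upwards [Ioi_mem_nhds hs] with r hr using hF n r (le_of_lt hr)
  have h := hasDerivAt_tsum_of_isPreconnected (g := F) (g' := fun n s => f' n (max s 0)) hu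
    (isOpen_Ioo (a := (-1 : ℝ)) (b := t + 1)) isPreconnected_Ioo (fun n s _ => hd n s)
    (fun n s hs => hf' n _ ⟨le_max_right _ _, max_le hs.2.le (by linarith)⟩)
    (y₀ := 0) ⟨by norm_num, by linarith⟩ (h0.congr fun n => (hF n 0 le_rfl).symm)
    (y := t) ⟨by linarith, by linarith⟩
  simp only [max_eq_left ht] at h
  exact h.hasDerivWithinAt.congr_of_mem (fun s hs => tsum_congr fun n => (hF n s hs).symm) ht

/-- A family of coefficients which solves the equation mode by mode, with locally uniform decay,
gives a solution of the partial differential equation. -/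
theorem solves_synth {ν : ℝ} {ω : WienerSpace} {A : ℝ → Coef} {ψ : ℝ → ℝ} {N : ℝ} (hN : 0 ≤ N)
    (hψ : ∀ t, 0 ≤ t → 0 < ψ t) (hanti : Antitone ψ)
    (hΓ : Continuous fun t => (Gam ν ω t)⁻¹)
    (hH : ∀ t, 0 ≤ t → CoefH (A t)) (hdec : ∀ t, 0 ≤ t → ExpDecay N (ψ t) (A t))
    (hd : ∀ t, 0 ≤ t → ∀ n i, HasDerivWithinAt (fun s => A s n i)
      (-(((Gam ν ω t)⁻¹ : ℝ) : ℂ) * nl (A t) n i - ((1 / 2 * ν ^ 2 : ℝ) : ℂ) * A t n i)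
      (Set.Ici 0) t) :
    Solves ν ω (synth (A 0)) fun t => synth (A t) := by
  refine ⟨rfl, fun t ht x i => ?_⟩
  have hw : ∀ s, 0 ≤ s → ∀ p, Wt p (A s) := fun s hs p => (hdec s hs).wt (hψ s hs) p
  have hser : ∀ s, 0 ≤ s → ∀ x i, (synth (A s) x i : ℂ) = fser (A s · i) x := fun s hs =>
    synth_eq_fser (hw s hs 1) (hH s hs).real
  have hconv : Wt 1 (conv (A t) (A t)) := (hw t ht 2).conv (hw t ht 2) (hH t ht).zero
  obtain ⟨G, hG⟩ := (isCompact_Icc (a := (0 : ℝ)) (b := t + 1)).exists_bound_of_continuousOn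
    hΓ.continuousOn
  have ht1 : 0 < ψ (t + 1) := hψ _ (by linarith)
  have hG0 : 0 ≤ G := (norm_nonneg _).trans (hG 0 ⟨le_rfl, by linarith⟩)
  have hcs : ∀ s ∈ Set.Icc 0 (t + 1), ExpDecay N (ψ (t + 1)) (A s) := fun s hs =>
    (hdec s hs.1).mono hN (hanti hs.2)
  have hsum : Summable fun n : Fin 3 → ℤ =>
      G * (9 * N ^ 2 * dkk (ψ (t + 1)) n) + 1 / 2 * ν ^ 2 * (N * Real.exp (-ψ (t + 1) * freq n)) :=
    (((summable_dkk ht1).mul_left _).mul_left _).add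
      (((by simpa using summable_exp_freq ht1 0 :
        Summable fun n : Fin 3 → ℤ => Real.exp (-ψ (t + 1) * freq n)).mul_left _).mul_left _)
  have h := hasDerivWithinAt_tsum (t := t) (f := fun n s => A s n i * mFourier n x)
    (f' := fun n s => (-(((Gam ν ω s)⁻¹ : ℝ) : ℂ) * nl (A s) n i
      - ((1 / 2 * ν ^ 2 : ℝ) : ℂ) * A s n i) * mFourier n x) hsum
    (fun n s hs => (hd s hs n i).mul_const _) (fun n s hs => by
      rw [norm_mul_mFourier]
      refine (norm_sub_le _ _).trans (add_le_add ?_ ?_)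
      · rw [norm_mul, norm_neg, Complex.norm_real]
        exact mul_le_mul (hG s hs) ((norm_le_pi_norm _ i).trans ((hcs s hs).norm_nl_le hN ht1 n))
          (norm_nonneg _) hG0
      · rw [norm_mul, Complex.norm_real, Real.norm_of_nonneg (by positivity)]
        exact mul_le_mul_of_nonneg_left ((norm_le_pi_norm _ i).trans ((hcs s hs).le n))
          (by positivity)) (summable_mul_mFourier ((hw 0 le_rfl 1).summable i) x) ht
  have hnl : Summable fun n => lerayc n (conv (A t) (A t) n) i * mFourier n x :=
    summable_mul_mFourier (hconv.lerayc.summable i) x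
  have hval : ∑' n, (-(((Gam ν ω t)⁻¹ : ℝ) : ℂ) * nl (A t) n i
      - ((1 / 2 * ν ^ 2 : ℝ) : ℂ) * A t n i) * mFourier n x
      = ((-((Gam ν ω t)⁻¹ * hydroLeray (Q (synth (A t)) (synth (A t))) x i)
        - 1 / 2 * ν ^ 2 * synth (A t) x i : ℝ) : ℂ) := by
    have h1 := hydroLeray_eq_fser (Q_eq_fser (hser t ht) (hser t ht) (hw t ht 1) (hH t ht)
      (hw t ht 1)) hconv x i
    rw [Complex.ofReal_sub, Complex.ofReal_neg, Complex.ofReal_mul (Gam ν ω t)⁻¹,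
      Complex.ofReal_mul (1 / 2 * ν ^ 2), h1,
      hser t ht, fser, fser, ← tsum_mul_left, ← tsum_mul_left, ← tsum_neg,
      ← Summable.tsum_sub (hnl.mul_left _).neg
        ((summable_mul_mFourier ((hw t ht 1).summable i) x).mul_left _)]
    refine tsum_congr fun n => ?_
    rw [nl]; ring
  rw [hval] at h
  have h2 := Complex.reCLM.hasFDerivAt.comp_hasDerivWithinAt t h
  rw [Complex.reCLM_apply, Complex.ofReal_re] at h2
  refine h2.congr_of_mem (fun s hs => ?_) ht
  change _ = (fser (A s · i) x).re
  rw [← hser s hs, Complex.ofReal_re]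

theorem continuous_W (ω : WienerSpace) : Continuous (W ω) :=
  ω.1.continuous.comp continuous_real_toNNReal

theorem continuous_inv_Gam (ν : ℝ) (ω : WienerSpace) : Continuous fun t => (Gam ν ω t)⁻¹ := by
  have : Continuous fun t => Gam ν ω t :=
    Real.continuous_exp.comp ((continuous_W ω).const_mul (-ν))
  exact this.inv₀ fun t => (Real.exp_pos _).ne'

theorem nl_smul (c : ℂ) (a : Coef) (n : Fin 3 → ℤ) (i : Fin 2) :
    nl (fun n i => c * a n i) n i = c ^ 2 * nl a n i := by
  have hk : ∀ j l, kern (fun n i => c * a n i) j l = c * kern a j l := fun j l => by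
    simp only [kern, wc, hdot, Fin.sum_univ_two]; ring
  have hc : conv (fun n i => c * a n i) (fun n i => c * a n i) n = c ^ 2 • conv a a n := by
    funext i
    simp only [conv, Pi.smul_apply, smul_eq_mul, ← tsum_mul_left, hk]
    exact tsum_congr fun j => by ring
  rw [nl, hc, lerayc_smul]; rfl

theorem cterm_smul (σ φ : ℝ) (c : ℝ) (a : Coef) (n : Fin 3 → ℤ) :
    cterm σ φ (fun n i => (c : ℂ) * a n i) n = c ^ 2 * cterm σ φ a n := by
  simp only [cterm, norm_mul, Complex.norm_real, Real.norm_eq_abs, mul_pow, sq_abs,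
    ← Finset.mul_sum]
  ring

/-! ### The radius of analyticity -/

theorem hasDerivAt_radius (φ₀ C α β ν N t : ℝ) (hc : 0 < ν ^ 2 - 2 * β) :
    HasDerivAt (radius φ₀ C α β ν N)
      (-(2 * C * (Real.exp α * N + 1) * Real.exp (-(ν ^ 2 / 2 - β) * t))) t := by
  have h1 : HasDerivAt (fun t : ℝ => -(ν ^ 2 / 2 - β) * t) (-(ν ^ 2 / 2 - β)) t := by
    simpa only [id, mul_one] using (hasDerivAt_id t).const_mul (-(ν ^ 2 / 2 - β))
  refine (((h1.exp.const_sub 1).const_mul (4 * C / (ν ^ 2 - 2 * β) * (Real.exp α * N + 1))).const_sub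
    φ₀).congr_deriv ?_
  field_simp
  ring

theorem continuous_radius (φ₀ C α β ν N : ℝ) : Continuous (radius φ₀ C α β ν N) := by
  unfold radius; fun_prop

theorem antitone_radius {φ₀ C α β ν N : ℝ} (hc : 0 < ν ^ 2 - 2 * β) (hC : 0 ≤ C) (hN : 0 ≤ N) :
    Antitone (radius φ₀ C α β ν N) := by
  refine antitone_of_deriv_nonpos (fun t => (hasDerivAt_radius φ₀ C α β ν N t hc).differentiableAt)
    fun t => ?_
  rw [(hasDerivAt_radius φ₀ C α β ν N t hc).deriv, neg_nonpos]
  positivity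

theorem radius_zero (φ₀ C α β ν N : ℝ) : radius φ₀ C α β ν N 0 = φ₀ := by simp [radius]

/-- A larger constant makes the radius smaller at positive times. -/
theorem radius_lt_radius {φ₀ C C' α β ν N t : ℝ} (hc : 0 < ν ^ 2 - 2 * β) (hC : C' < C) (hN : 0 ≤ N)
    (ht : 0 < t) : radius φ₀ C α β ν N t < radius φ₀ C' α β ν N t := by
  have h1 : Real.exp (-(ν ^ 2 / 2 - β) * t) < 1 := by
    rw [Real.exp_lt_one_iff]; nlinarith
  have h2 : 0 < (Real.exp α * N + 1) * (1 - Real.exp (-(ν ^ 2 / 2 - β) * t)) :=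
    mul_pos (by positivity) (by linarith)
  have h3 : 4 * C' / (ν ^ 2 - 2 * β) < 4 * C / (ν ^ 2 - 2 * β) := by gcongr
  have h4 := mul_lt_mul_of_pos_right h3 h2
  simp only [radius, mul_assoc] at h4 ⊢
  linarith

/-- The smallness of the datum says that the total loss of radius, reached at infinite time, is at most `φ₀`. -/
theorem radius_pos {φ₀ C α β ν N t : ℝ} (hc : 0 < ν ^ 2 - 2 * β) (hC : 0 < C) (hN : 0 ≤ N)
    (hsmall : Real.exp α * N ≤ (ν ^ 2 - 2 * β) * φ₀ / (4 * C) - 1) :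
    0 < radius φ₀ C α β ν N t := by
  have h1 : 4 * C / (ν ^ 2 - 2 * β) * (Real.exp α * N + 1) ≤ φ₀ := by
    rw [div_mul_eq_mul_div, div_le_iff₀ hc]
    have h : Real.exp α * N + 1 ≤ (ν ^ 2 - 2 * β) * φ₀ / (4 * C) := by linarith
    rw [le_div_iff₀ (by positivity)] at h
    linarith
  have h2 : 0 < 4 * C / (ν ^ 2 - 2 * β) * (Real.exp α * N + 1) * Real.exp (-(ν ^ 2 / 2 - β) * t) := by
    positivity
  rw [radius]
  linarith

theorem gevreyDotNorm_le_gevreyNorm {σ φ : ℝ} {F : Field} (h : MemGevrey σ φ F) :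
    gevreyDotNorm σ φ F ≤ gevreyNorm σ φ F :=
  Real.sqrt_le_sqrt (h.summable_dotTerm.tsum_le_tsum (dotTerm_le_gevreyTerm σ φ F) h)

/-- Existence. The unknown `V = e^{ν²t/2} U` satisfies an equation without damping, whose nonlinear
term carries the factor `Γ⁻¹ e^{-ν²t/2} ≤ e^{α - (ν²/2 - β)t}`. It is solved at the radius which
belongs to the constant `3C/4`; this radius exceeds the stated one at positive times. -/
theorem exists_solution {σ C : ℝ} (hσ : 5 / 2 < σ) (hC : 0 < C) (hNL : NonlinearEstimate σ C)
    {φ₀ α β ν : ℝ} (hc : 0 < ν ^ 2 - 2 * β) {ω : WienerSpace} (hω : ω ∈ goodSet α β ν)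
    {U₀ : Field} (hφ₀ : 0 < φ₀) (hU₀ : MemH U₀) (hG : MemGevrey σ φ₀ U₀)
    (hsmall : Real.exp α * gevreyNorm σ φ₀ U₀ ≤ (ν ^ 2 - 2 * β) * φ₀ / (4 * C) - 1) :
    ∃ U : ℝ → Field, ContGevrey σ (radius φ₀ C α β ν (gevreyNorm σ φ₀ U₀)) U ∧
      Solves ν ω U₀ U := by
  set N := gevreyNorm σ φ₀ U₀ with hNdef
  set N' := gevreyDotNorm σ φ₀ U₀ with hN'def
  have hN : 0 ≤ N := Real.sqrt_nonneg _
  have hN' : 0 ≤ N' := Real.sqrt_nonneg _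
  have hNN : N' ≤ N := gevreyDotNorm_le_gevreyNorm hG
  set φ := radius φ₀ C α β ν N with hφdef
  set ψ := radius φ₀ (3 / 4 * C) α β ν N with hψdef
  have hφpos : ∀ t, 0 ≤ t → 0 < φ t := fun t _ => radius_pos hc hC hN hsmall
  have hlt : ∀ t, 0 < t → φ t < ψ t := fun t ht => radius_lt_radius hc (by linarith) hN ht
  have h0 : φ 0 = ψ 0 := by rw [hφdef, hψdef, radius_zero, radius_zero]
  have hψ0 : ψ 0 = φ₀ := radius_zero _ _ _ _ _ _
  have hψpos : ∀ t, 0 ≤ t → 0 < ψ t := fun t ht => by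
    rcases ht.eq_or_lt with rfl | h
    · rw [hψ0]; exact hφ₀
    · exact (hφpos t ht).trans (hlt t h)
  have hanti : Antitone ψ := antitone_radius hc (by positivity) hN
  have hsum : Summable (cterm σ φ₀ (coeff U₀)) := hG.summable_dotTerm
  have hw₀ : Wt 1 (coeff U₀) := wt_one_of_summable_dotTerm hσ hφ₀.le hG.summable_dotTerm
  have hN'2 : N' ^ 2 = ∑' n, cterm σ φ₀ (coeff U₀) n := gevreyDotNorm_sq σ φ₀ U₀
  obtain ⟨hH₀, -⟩ := hU₀.coefH hw₀
  have hΓ := continuous_inv_Gam ν ω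
  have hd2 : ∀ t : ℝ, HasDerivAt (fun t : ℝ => -(ν ^ 2 / 2) * t) (-(ν ^ 2 / 2)) t := fun t => by
    simpa using (hasDerivAt_id t).const_mul (-(ν ^ 2 / 2))
  set e : ℝ → ℝ := fun t => Real.exp (-(ν ^ 2 / 2) * t) with he
  have hepos : ∀ t, 0 < e t := fun t => Real.exp_pos _
  have hgle : ∀ t, 0 ≤ t → (Gam ν ω t)⁻¹ * e t ≤ Real.exp α * Real.exp (-(ν ^ 2 / 2 - β) * t) := by
    intro t ht
    rw [Gam, ← Real.exp_neg, he, ← Real.exp_add, ← Real.exp_add]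
    refine Real.exp_le_exp.mpr ?_
    linarith [hω t ht]
  obtain ⟨V, hV0, hV⟩ := exists_limit hσ hC hNL hH₀ (g := fun t => (Gam ν ω t)⁻¹ * e t)
    (by fun_prop) hψpos hanti (fun t => hasDerivAt_radius _ _ _ _ _ _ t hc)
    (fun t => mul_nonneg (inv_nonneg.mpr (Real.exp_pos _).le) (hepos t).le) hN'
    (Real.exp_pos (-α)) (fun t ht => by
      have h1 := mul_le_mul_of_nonneg_right (hgle t ht)
        (show 0 ≤ C * (N' + Real.exp (-α)) by positivity)
      have h2 : Real.exp α * Real.exp (-α) = 1 := by rw [← Real.exp_add]; simp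
      have h3 : 0 < C * Real.exp (-(ν ^ 2 / 2 - β) * t) := by positivity
      have h4 : Real.exp α * N' ≤ Real.exp α * N := by gcongr
      have h5 : 0 ≤ Real.exp α * N := by positivity
      have h6 : Real.exp α * (N' + Real.exp (-α)) ≤ Real.exp α * N + 1 := by linarith
      have h7 := mul_le_mul_of_nonneg_left h6 h3.le
      have h8 : 0 ≤ C * Real.exp (-(ν ^ 2 / 2 - β) * t) * (Real.exp α * N + 1) := by positivity
      linarith) (by rw [hψ0]; exact hsum) (by rw [hψ0, hN'2])
  set A : ℝ → Coef := fun t n i => (e t : ℂ) * V t n i with hA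
  have hA0 : A 0 = coeff U₀ := by
    funext n i; simp [hA, he, hV0]
  have hAH : ∀ t, 0 ≤ t → CoefH (A t) := fun t ht => (hV t ht).1.smul (e t)
  have he1 : ∀ t, 0 ≤ t → e t ^ 2 ≤ 1 := fun t ht => by
    have : e t ≤ 1 := by rw [he, Real.exp_le_one_iff]; nlinarith [sq_nonneg ν]
    nlinarith [hepos t]
  have hAc : ∀ t, cterm σ (ψ t) (A t) = fun n => e t ^ 2 * cterm σ (ψ t) (V t) n := fun t =>
    funext fun n => cterm_smul _ _ _ _ _
  have hAs : ∀ t, 0 ≤ t → Summable (cterm σ (ψ t) (A t)) := fun t ht => by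
    rw [hAc]; exact (hV t ht).2.1.mul_left _
  have hAle : ∀ t, 0 ≤ t → ∑' n, cterm σ (ψ t) (A t) n ≤ N' ^ 2 := fun t ht => by
    rw [hAc, tsum_mul_left]
    refine (mul_le_of_le_one_left ?_ (he1 t ht)).trans (hV t ht).2.2.1
    exact tsum_nonneg (cterm_nonneg _ _ _)
  have hAd : ∀ t, 0 ≤ t → ∀ n i, HasDerivWithinAt (fun s => A s n i)
      (-(((Gam ν ω t)⁻¹ : ℝ) : ℂ) * nl (A t) n i - ((1 / 2 * ν ^ 2 : ℝ) : ℂ) * A t n i)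
      (Set.Ici 0) t := fun t ht n i => by
    have h := ((hd2 t).exp.ofReal_comp.hasDerivWithinAt (s := Set.Ici 0)).mul ((hV t ht).2.2.2 n i)
    refine h.congr_deriv ?_
    rw [hA, nl_smul, he]
    push_cast
    ring
  have hsyn : synth (A 0) = U₀ := by
    have hco := coeff_synth (a := A 0) (by rw [hA0]; exact hw₀) (hAH 0 le_rfl).real
    exact field_ext_of_coeff (by rw [hco, hA0]; exact hw₀) hw₀ (by rw [hco, hA0])
  refine ⟨fun t => synth (A t), ?_, ?_⟩
  · refine contGevrey_synth hσ (ψ := ψ) (continuous_radius _ _ _ _ _ _)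
      (continuous_radius _ _ _ _ _ _) hφpos h0 hlt hAH hAs (fun t ht => ?_) fun n i t ht => (hAd t ht n i).continuousWithinAt
    rw [hA0, hψ0, ← hN'2]
    exact hAle t ht
  · rw [← hsyn]
    refine solves_synth hN' hψpos hanti hΓ hAH (fun t ht => ?_) hAd
    exact expDecay_of_cterm (σ := σ) (by linarith) hN' (hAH t ht).zero fun n =>
      ((hAs t ht).le_tsum n fun _ _ => cterm_nonneg _ _ _ _).trans (hAle t ht)

/-! ### Uniqueness for the Fourier coefficients -/

theorem ExpDecay.sub {M ε : ℝ} {a b : Coef} (ha : ExpDecay M ε a) (hb : ExpDecay M ε b) :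
    ExpDecay (2 * M) ε (a - b) := by
  refine ⟨by rw [Pi.sub_apply, ha.zero, hb.zero, sub_zero], fun n => ?_⟩
  rw [Pi.sub_apply]
  linarith [norm_sub_le (a n) (b n), ha.le n, hb.le n]

theorem conv_sub_conv {a b : Coef} (ha : Wt 1 a) (hb : Wt 1 b) (ha0 : a 0 = 0) (hb0 : b 0 = 0)
    (n : Fin 3 → ℤ) : conv a a n - conv b b n = conv (a - b) a n + conv b (a - b) n := by
  have hk : ∀ j l, kern (a - b) j l = kern a j l - kern b j l := fun j l => by
    simp only [kern, wc, hdot, Fin.sum_univ_two, Pi.sub_apply]; ring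
  funext i
  have haa := ha.summable_kern ha ha0 n i
  have hba := hb.summable_kern ha hb0 n i
  have hbb := hb.summable_kern hb hb0 n i
  have h1 : Summable fun j => kern (a - b) j (n - j) * a (n - j) i := by
    simpa only [hk, sub_mul] using haa.sub hba
  have h2 : Summable fun j => kern b j (n - j) * (a (n - j) i - b (n - j) i) := by
    simpa only [mul_sub] using hba.sub hbb
  simp only [Pi.sub_apply, Pi.add_apply, conv]
  rw [← haa.tsum_sub hbb, ← h1.tsum_add h2]
  refine tsum_congr fun j => ?_
  rw [hk]; ring

/-- The loss of one derivative in the quadratic term is shared between two factors. -/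
theorem freq_le_sqrt_mul {j n l : Fin 3 → ℤ} (hn : n ≠ 0) (hl : l ≠ 0)
    (h : freq j ≤ freq n + freq l) : freq j ≤ 2 * (√(freq j) * √(freq n) * freq l) := by
  have hn1 := one_le_freq hn
  have hl1 := one_le_freq hl
  have hj := freq_nonneg j
  have h1 : freq j ≤ (2 * (√(freq n) * freq l)) ^ 2 := by
    rw [mul_pow, mul_pow, Real.sq_sqrt (by linarith)]
    nlinarith [mul_nonneg (sub_nonneg.mpr hn1) (sub_nonneg.mpr hl1),
      mul_nonneg (mul_nonneg (zero_le_one.trans hn1) (zero_le_one.trans hl1)) (sub_nonneg.mpr hl1)]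
  have h2 : √(freq j) ≤ 2 * (√(freq n) * freq l) := Real.sqrt_le_iff.mpr ⟨by positivity, h1⟩
  calc freq j = √(freq j) * √(freq j) := (Real.mul_self_sqrt hj).symm
    _ ≤ √(freq j) * (2 * (√(freq n) * freq l)) := by gcongr
    _ = _ := by ring

/-- The difference of the nonlinear terms is bilinear in the difference and the two states. -/
theorem norm_nl_sub_nl_le {M ε : ℝ} (hε : 0 < ε) {a b : Coef} (ha : ExpDecay M ε a)
    (hb : ExpDecay M ε b) (n : Fin 3 → ℤ) :
    ‖nl a n - nl b n‖ ≤ ∑' j, 9 * ((freq j * ‖(a - b) j‖) * (freq (n - j) * ‖a (n - j)‖)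
      + (freq j * ‖b j‖) * (freq (n - j) * ‖(a - b) (n - j)‖)) := by
  have hD := ha.sub hb
  have hw : ∀ {M : ℝ} {c : Coef}, ExpDecay M ε c → Summable fun n => freq n * ‖c n‖ := fun h => by
    simpa using Wt.summable_freq_mul (p := 0) (h.wt hε 1)
  have hs1 := (summable_mul_sub (hw hD).norm (hw ha).norm).prod_factor n
  have hs2 := (summable_mul_sub (hw hb).norm (hw hD).norm).prod_factor n
  have h1 := norm_conv_le (hD.wt hε 1) (ha.wt hε 1) hD.zero n
  have h2 := norm_conv_le (hb.wt hε 1) (hD.wt hε 1) hb.zero n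
  have h3 : ‖nl a n - nl b n‖ ≤ 3 * ‖conv (a - b) a n + conv b (a - b) n‖ := by
    rw [← conv_sub_conv (ha.wt hε 1) (hb.wt hε 1) ha.zero hb.zero n, nl, nl, ← lerayc_sub]
    exact (pi_norm_le_iff_of_nonneg (by positivity)).mpr fun i => norm_lerayc_le n _ i
  rw [tsum_mul_left, hs1.tsum_add hs2]
  linarith [norm_add_le (conv (a - b) a n) (conv b (a - b) n)]

/-- The difference of the nonlinear terms, tested with the difference of the states in an analytic
norm: only half a derivative is lost on each factor. -/
theorem tsum_pairing_le {M ε ρ : ℝ} (hM : 0 ≤ M) (hε : 0 < ε) (hρ0 : 0 ≤ ρ) (hρ : ρ ≤ ε / 2)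
    {a b : Coef} (ha : ExpDecay M ε a) (hb : ExpDecay M ε b) :
    (Summable fun n => Real.exp (2 * ρ * freq n) * (‖(a - b) n‖ * ‖nl a n - nl b n‖)) ∧
    ∑' n, Real.exp (2 * ρ * freq n) * (‖(a - b) n‖ * ‖nl a n - nl b n‖) ≤
      36 * ((∑' n : Fin 3 → ℤ, 2 * M * ((1 + freq n) ^ 2 * Real.exp (-(ε / 2) * freq n)))
        * ∑' n, freq n * (Real.exp (2 * ρ * freq n) * ‖(a - b) n‖ ^ 2)) := by
  have hD := ha.sub hb
  set A : (Fin 3 → ℤ) → ℝ := fun n => √(freq n) * (Real.exp (ρ * freq n) * ‖(a - b) n‖) with hA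
  set c : (Fin 3 → ℤ) → ℝ := fun n => freq n ^ 2 * (Real.exp (ρ * freq n) * (‖a n‖ + ‖b n‖)) with hc
  have hexp2 : ∀ n : Fin 3 → ℤ, Real.exp (ρ * freq n) ^ 2 = Real.exp (2 * ρ * freq n) := fun n => by
    rw [← Real.exp_nat_mul]; congr 1; push_cast; ring
  have hA2 : ∀ n, A n ^ 2 = freq n * (Real.exp (2 * ρ * freq n) * ‖(a - b) n‖ ^ 2) := fun n => by
    rw [hA, mul_pow, mul_pow, Real.sq_sqrt (freq_nonneg n), hexp2]
  have hdec : ∀ {M : ℝ} {c : Coef}, ExpDecay M ε c → 0 ≤ M → ∀ n,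
      Real.exp (ρ * freq n) * ‖c n‖ ≤ M * Real.exp (-(ε / 2) * freq n) := fun {M c} h hM n => by
    calc _ ≤ Real.exp (ρ * freq n) * (M * Real.exp (-ε * freq n)) := by gcongr; exact h.le n
      _ = M * Real.exp (ρ * freq n + -ε * freq n) := by rw [Real.exp_add]; ring
      _ ≤ _ := by gcongr; nlinarith [freq_nonneg n]
  have hsA : Summable fun n => A n ^ 2 := by
    refine .of_nonneg_of_le (fun n => sq_nonneg _) (fun n => ?_)
      ((summable_exp_freq hε 1).mul_left ((2 * M) ^ 2))
    have h1 := hdec hD (by positivity) n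
    have h2 : (Real.exp (ρ * freq n) * ‖(a - b) n‖) ^ 2 ≤
        (2 * M * Real.exp (-(ε / 2) * freq n)) ^ 2 := by gcongr
    have h3 : Real.exp (-(ε / 2) * freq n) ^ 2 = Real.exp (-ε * freq n) := by
      rw [← Real.exp_nat_mul]; congr 1; push_cast; ring
    rw [hA, mul_pow, Real.sq_sqrt (freq_nonneg n)]
    rw [mul_pow (2 * M), h3] at h2
    calc _ ≤ freq n * ((2 * M) ^ 2 * Real.exp (-ε * freq n)) :=
          mul_le_mul_of_nonneg_left h2 (freq_nonneg n)
      _ ≤ (1 + freq n) * ((2 * M) ^ 2 * Real.exp (-ε * freq n)) := by gcongr; linarith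
      _ = _ := by ring
  have hcle : ∀ n, c n ≤ 2 * M * ((1 + freq n) ^ 2 * Real.exp (-(ε / 2) * freq n)) := fun n => by
    have h1 := hdec ha hM n
    have h2 := hdec hb hM n
    have h3 := freq_nonneg n
    calc c n = freq n ^ 2 * (Real.exp (ρ * freq n) * ‖a n‖ + Real.exp (ρ * freq n) * ‖b n‖) := by
          rw [hc]; ring
      _ ≤ (1 + freq n) ^ 2 * (M * Real.exp (-(ε / 2) * freq n) + M * Real.exp (-(ε / 2) * freq n)) := by
          gcongr; linarith
      _ = _ := by ring
  have hc0 : ∀ n, 0 ≤ c n := fun n => by positivity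
  have hsS := (summable_exp_freq (half_pos hε) 2).mul_left (2 * M)
  have hsc : Summable c := .of_nonneg_of_le hc0 hcle hsS
  have hA0 : ∀ n, 0 ≤ A n := fun n => by positivity
  have hfn : ∀ n : Fin 3 → ℤ, 0 ≤ freq n := freq_nonneg
  -- both products of the trilinear form are of this shape
  have hkey : ∀ {d : Coef}, d 0 = 0 → (∀ n, ‖d n‖ ≤ ‖a n‖ + ‖b n‖) → ∀ n j l : Fin 3 → ℤ,
      freq n ≤ freq j + freq l → freq j ≤ freq n + freq l →
      Real.exp (2 * ρ * freq n) * ‖(a - b) n‖ * ((freq j * ‖(a - b) j‖) * (freq l * ‖d l‖))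
        ≤ 2 * (A n * A j * c l) := by
    intro d hd0 hd n j l h1 h2
    by_cases hn : n = 0
    · subst hn
      rw [hD.zero, norm_zero, mul_zero, zero_mul]
      have := hA0 0; have := hA0 j; have := hc0 l; positivity
    by_cases hl : l = 0
    · subst hl
      rw [hd0, norm_zero, mul_zero, mul_zero, mul_zero]
      have := hA0 n; have := hA0 j; have := hc0 0; positivity
    have h3 := freq_le_sqrt_mul hn hl h2
    have h4 : Real.exp (2 * ρ * freq n) ≤
        Real.exp (ρ * freq n) * (Real.exp (ρ * freq j) * Real.exp (ρ * freq l)) := by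
      rw [← Real.exp_add, ← Real.exp_add]
      exact Real.exp_le_exp.mpr (by nlinarith)
    have := hfn n; have := hfn j; have := hfn l
    calc _ ≤ Real.exp (ρ * freq n) * (Real.exp (ρ * freq j) * Real.exp (ρ * freq l)) * ‖(a - b) n‖ *
          ((2 * (√(freq j) * √(freq n) * freq l) * ‖(a - b) j‖) * (freq l * (‖a l‖ + ‖b l‖))) := by
          gcongr; exact hd l
      _ = _ := by rw [hA, hc]; ring
  have htri := summable_of_le_tri (A := A) (c := c) (M := 18)
    (q := fun n => Real.exp (2 * ρ * freq n) * (‖(a - b) n‖ * ‖nl a n - nl b n‖))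
    (F := fun n j => Real.exp (2 * ρ * freq n) * ‖(a - b) n‖ *
      (9 * ((freq j * ‖(a - b) j‖) * (freq (n - j) * ‖a (n - j)‖)
      + (freq j * ‖b j‖) * (freq (n - j) * ‖(a - b) (n - j)‖))))
    hsA hsc hA0 hc0 (by norm_num)
    (fun n j => by have := hfn n; have := hfn j; have := hfn (n - j); positivity)
    (fun n => by positivity)
    (fun n j => by
      have h1 := hkey ha.zero (fun n => by linarith [norm_nonneg (b n)]) n j (n - j)
        (freq_le_add n j) (by
          have := freq_le_add j n
          rwa [← freq_neg (j - n), neg_sub] at this)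
      have h2 := hkey hb.zero (fun n => by linarith [norm_nonneg (a n)]) n (n - j) j
        (by linarith [freq_le_add n j]) (by
          have := freq_le_add (n - j) n
          rwa [sub_sub_cancel_left, freq_neg] at this)
      nlinarith [h1, h2])
    (fun n => by
      rw [tsum_mul_left, ← mul_assoc]
      exact mul_le_mul_of_nonneg_left (norm_nl_sub_nl_le hε ha hb n) (by positivity))
  refine ⟨htri.1, htri.2.trans ?_⟩
  simp only [hA2]
  have h1 : ∑' n, c n ≤ _ := hsc.tsum_le_tsum hcle hsS
  have h2 : 0 ≤ ∑' n, freq n * (Real.exp (2 * ρ * freq n) * ‖(a - b) n‖ ^ 2) :=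
    tsum_nonneg fun n => by have := hfn n; positivity
  linarith [mul_le_mul_of_nonneg_right h1 h2]

/-- The constant in the bound for the difference of the nonlinear terms of two states with
coefficients bounded by `M e^{-ε|k|}`. -/
def diffConst (M ε : ℝ) : ℝ :=
  ∑' n : Fin 3 → ℤ, 2 * M * ((1 + freq n) ^ 2 * Real.exp (-(ε / 2) * freq n))

/-- Short time uniqueness. The squared norm of the difference at the radius `ε / 2 - K (t - t₀)` is
nonincreasing if the radius shrinks fast enough. -/
theorem eqOn_of_eq_left {M ε μ G K t₀ t₁ : ℝ} {g : ℝ → ℝ} {a b : ℝ → Coef} (hM : 0 ≤ M)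
    (hε : 0 < ε) (hμ : 0 ≤ μ) (hG0 : 0 ≤ G) (hg : ∀ t ∈ Set.Icc t₀ t₁, |g t| ≤ G)
    (ha : ∀ t ∈ Set.Icc t₀ t₁, ExpDecay M ε (a t)) (hb : ∀ t ∈ Set.Icc t₀ t₁, ExpDecay M ε (b t))
    (hac : ∀ n i, ContinuousOn (fun t => a t n i) (Set.Icc t₀ t₁))
    (hbc : ∀ n i, ContinuousOn (fun t => b t n i) (Set.Icc t₀ t₁))
    (had : ∀ t ∈ Set.Ioo t₀ t₁, ∀ n i, HasDerivAt (fun s => a s n i)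
      (-(g t : ℂ) * nl (a t) n i - (μ : ℂ) * a t n i) t)
    (hbd : ∀ t ∈ Set.Ioo t₀ t₁, ∀ n i, HasDerivAt (fun s => b s n i)
      (-(g t : ℂ) * nl (b t) n i - (μ : ℂ) * b t n i) t)
    (h0 : a t₀ = b t₀) (hK0 : 0 ≤ K) (hK : 72 * (G * diffConst M ε) ≤ K)
    (ht : K * (t₁ - t₀) ≤ ε / 2) {t : ℝ} (htm : t ∈ Set.Icc t₀ t₁) : a t = b t := by
  set ρ : ℝ → ℝ := fun t => ε / 2 - K * (t - t₀) with hρ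
  have hρ0 : ∀ s ∈ Set.Icc t₀ t₁, 0 ≤ ρ s := fun s hs => by
    have := mul_le_mul_of_nonneg_left (sub_le_sub_right hs.2 t₀) hK0
    simp only [hρ]; linarith
  have hρ1 : ∀ s ∈ Set.Icc t₀ t₁, ρ s ≤ ε / 2 := fun s hs => by
    have := mul_nonneg hK0 (sub_nonneg.mpr hs.1)
    simp only [hρ]; linarith
  let E : (Fin 3 → ℤ) → ℝ → ℝ := fun n s => Real.exp (2 * ρ s * freq n)
  have hE0 : ∀ n s, 0 < E n s := fun n s => Real.exp_pos _
  have hEd : ∀ n s, HasDerivAt (E n) (E n s * (-(2 * K * freq n))) s := fun n s => by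
    have h : HasDerivAt (fun s => 2 * ρ s * freq n) (-(2 * K * freq n)) s := by
      have h1 := (((((hasDerivAt_id s).sub_const t₀).const_mul K).const_sub (ε / 2)).const_mul
        2).mul_const (freq n)
      exact h1.congr_deriv (by ring)
    exact h.exp
  let D : ℝ → Coef := fun s => a s - b s
  let X : ℝ → Coef := fun s => nl (a s) - nl (b s)
  have hDdec : ∀ s ∈ Set.Icc t₀ t₁, ExpDecay (2 * M) ε (D s) := fun s hs => (ha s hs).sub (hb s hs)
  let D' : ℝ → Coef := fun s n i => (-g s) • X s n i - μ • D s n i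
  have hDd : ∀ s ∈ Set.Ioo t₀ t₁, ∀ n i, HasDerivAt (fun s => D s n i) (D' s n i) s :=
    fun s hs n i => ((had s hs n i).sub (hbd s hs n i)).congr_deriv (by
      simp only [D', X, D, Pi.sub_apply, Complex.real_smul, Complex.ofReal_neg]; ring)
  have hDc : ∀ n i, ContinuousOn (fun s => D s n i) (Set.Icc t₀ t₁) := fun n i =>
    (hac n i).sub (hbc n i)
  let y : (Fin 3 → ℤ) → ℝ → ℝ := fun n s => E n s * ∑ i, ‖D s n i‖ ^ 2
  let y' : (Fin 3 → ℤ) → ℝ → ℝ := fun n s => E n s * (-(2 * K * freq n)) * (∑ i, ‖D s n i‖ ^ 2)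
    + E n s * ∑ i, 2 * inner ℝ (D s n i) (D' s n i)
  have hyd : ∀ n, ∀ s ∈ Set.Ioo t₀ t₁, HasDerivAt (y n) (y' n s) s := fun n s hs =>
    (hEd n s).mul (HasDerivAt.fun_sum fun i _ => (hDd s hs n i).norm_sq)
  have hDi : ∀ s n i, ‖D s n i‖ ≤ ‖D s n‖ := fun s n i => norm_le_pi_norm _ _
  have hXi : ∀ s n i, ‖X s n i‖ ≤ ‖X s n‖ := fun s n i => norm_le_pi_norm _ _
  have hsum2 : ∀ s n, ∑ i, ‖D s n i‖ ^ 2 ≤ 2 * ‖D s n‖ ^ 2 := fun s n => by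
    have h : ∀ i, ‖D s n i‖ ^ 2 ≤ ‖D s n‖ ^ 2 := fun i => by gcongr; exact hDi s n i
    rw [Fin.sum_univ_two]; linarith [h 0, h 1]
  have hEle : ∀ s ∈ Set.Icc t₀ t₁, ∀ n, E n s * ‖D s n‖ ≤ 2 * M := fun s hs n => by
    have h1 : E n s ≤ Real.exp (ε * freq n) :=
      Real.exp_le_exp.mpr (by nlinarith [freq_nonneg n, hρ1 s hs])
    calc _ ≤ Real.exp (ε * freq n) * (2 * M * Real.exp (-ε * freq n)) :=
          mul_le_mul h1 ((hDdec s hs).le n) (norm_nonneg _) (Real.exp_pos _).le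
      _ = 2 * M * Real.exp (ε * freq n + -ε * freq n) := by rw [Real.exp_add]; ring
      _ = _ := by simp
  have hED : ∀ s ∈ Set.Icc t₀ t₁, ∀ n, E n s * ‖D s n‖ ^ 2 ≤ (2 * M) ^ 2 * Real.exp (-ε * freq n) :=
    fun s hs n => by
      calc _ = (E n s * ‖D s n‖) * ‖D s n‖ := by ring
        _ ≤ (2 * M) * (2 * M * Real.exp (-ε * freq n)) :=
          mul_le_mul (hEle s hs n) ((hDdec s hs).le n) (norm_nonneg _) (by positivity)
        _ = _ := by ring
  have hXle : ∀ s ∈ Set.Icc t₀ t₁, ∀ n, ‖X s n‖ ≤ 18 * M ^ 2 * dkk ε n := fun s hs n => by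
    have := norm_sub_le (nl (a s) n) (nl (b s) n)
    have h1 := (ha s hs).norm_nl_le hM hε n
    have h2 := (hb s hs).norm_nl_le hM hε n
    change ‖nl (a s) n - nl (b s) n‖ ≤ _
    linarith
  have hexp : Summable fun n : Fin 3 → ℤ => Real.exp (-ε * freq n) := by
    simpa using summable_exp_freq hε 0
  -- the damping only helps
  have hinner : ∀ s ∈ Set.Icc t₀ t₁, ∀ n,
      ∑ i, 2 * inner ℝ (D s n i) (D' s n i) ≤ 4 * G * (‖D s n‖ * ‖X s n‖) := fun s hs n => by
    have h : ∀ i, inner ℝ (D s n i) (D' s n i) ≤ G * (‖D s n‖ * ‖X s n‖) := fun i => by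
      simp only [D']
      rw [inner_sub_right, real_inner_smul_right, real_inner_smul_right, real_inner_self_eq_norm_sq]
      have h1 : -g s * inner ℝ (D s n i) (X s n i) ≤ G * (‖D s n‖ * ‖X s n‖) := by
        refine (le_abs_self _).trans ?_
        rw [abs_mul, abs_neg]
        refine mul_le_mul (hg s hs) ((abs_real_inner_le_norm _ _).trans ?_) (abs_nonneg _) hG0
        exact mul_le_mul (hDi s n i) (hXi s n i) (norm_nonneg _) (norm_nonneg _)
      have h2 : 0 ≤ μ * ‖D s n i‖ ^ 2 := by positivity
      linarith
    rw [Fin.sum_univ_two]; linarith [h 0, h 1]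
  have hinner_abs : ∀ s ∈ Set.Icc t₀ t₁, ∀ n, |∑ i, 2 * inner ℝ (D s n i) (D' s n i)| ≤
      4 * (‖D s n‖ * (G * ‖X s n‖ + μ * ‖D s n‖)) := fun s hs n => by
    have h : ∀ i, |2 * inner ℝ (D s n i) (D' s n i)| ≤
        2 * (‖D s n‖ * (G * ‖X s n‖ + μ * ‖D s n‖)) := fun i => by
      rw [abs_mul, abs_two]
      refine mul_le_mul_of_nonneg_left ((abs_real_inner_le_norm _ _).trans ?_) (by norm_num)
      refine mul_le_mul (hDi s n i) ((norm_sub_le _ _).trans (add_le_add ?_ ?_)) (norm_nonneg _)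
        (norm_nonneg _)
      · rw [norm_smul, norm_neg, Real.norm_eq_abs]
        exact mul_le_mul (hg s hs) (hXi s n i) (norm_nonneg _) hG0
      · rw [norm_smul, Real.norm_of_nonneg hμ]
        exact mul_le_mul_of_nonneg_left (hDi s n i) hμ
    rw [Fin.sum_univ_two]
    linarith [abs_add_le (2 * inner ℝ (D s n 0) (D' s n 0)) (2 * inner ℝ (D s n 1) (D' s n 1)),
      h 0, h 1]
  have hsumκ : ∀ s ∈ Set.Icc t₀ t₁, ∀ n, freq n * (E n s * ‖D s n‖ ^ 2) ≤
      (2 * M) ^ 2 * ((1 + freq n) ^ 1 * Real.exp (-ε * freq n)) := fun s hs n => by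
    have h3 := freq_nonneg n
    calc _ ≤ (1 + freq n) * ((2 * M) ^ 2 * Real.exp (-ε * freq n)) :=
          mul_le_mul (by linarith) (hED s hs n) (by have := hE0 n s; positivity) (by linarith)
      _ = _ := by ring
  have hu : Summable fun n : Fin 3 → ℤ =>
      4 * K * ((2 * M) ^ 2 * ((1 + freq n) ^ 1 * Real.exp (-ε * freq n)))
      + 8 * M * (G * (18 * M ^ 2 * dkk ε n) + μ * (2 * M * Real.exp (-ε * freq n))) :=
    (((summable_exp_freq hε 1).mul_left _).mul_left _).add
      (((((summable_dkk hε).mul_left _).mul_left _).add ((hexp.mul_left _).mul_left _)).mul_left _)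
  have hy'le : ∀ n, ∀ s ∈ Set.Icc t₀ t₁, ‖y' n s‖ ≤
      4 * K * ((2 * M) ^ 2 * ((1 + freq n) ^ 1 * Real.exp (-ε * freq n)))
      + 8 * M * (G * (18 * M ^ 2 * dkk ε n) + μ * (2 * M * Real.exp (-ε * freq n))) := fun n s hs => by
    have hf := freq_nonneg n
    refine (norm_add_le _ _).trans (add_le_add ?_ ?_)
    · rw [norm_mul, norm_mul, norm_neg, Real.norm_of_nonneg (hE0 n s).le,
        Real.norm_of_nonneg (by positivity), Real.norm_of_nonneg (Finset.sum_nonneg fun _ _ => sq_nonneg _)]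
      calc _ ≤ E n s * (2 * K * freq n) * (2 * ‖D s n‖ ^ 2) := by
            have := (hE0 n s).le
            exact mul_le_mul_of_nonneg_left (hsum2 s n) (by positivity)
        _ = 4 * K * (freq n * (E n s * ‖D s n‖ ^ 2)) := by ring
        _ ≤ _ := mul_le_mul_of_nonneg_left (hsumκ s hs n) (by positivity)
    · rw [norm_mul, Real.norm_of_nonneg (hE0 n s).le, Real.norm_eq_abs]
      calc _ ≤ E n s * (4 * (‖D s n‖ * (G * ‖X s n‖ + μ * ‖D s n‖))) :=
            mul_le_mul_of_nonneg_left (hinner_abs s hs n) (hE0 n s).le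
        _ = 4 * ((E n s * ‖D s n‖) * (G * ‖X s n‖ + μ * ‖D s n‖)) := by ring
        _ ≤ 4 * ((2 * M) * (G * (18 * M ^ 2 * dkk ε n) + μ * (2 * M * Real.exp (-ε * freq n)))) := by
            have h1 := hEle s hs n
            have h2 := hXle s hs n
            have h3 := (hDdec s hs).le n
            gcongr
        _ = _ := by ring
  have hyle : ∀ n, ∀ s ∈ Set.Icc t₀ t₁, ‖y n s‖ ≤ 2 * ((2 * M) ^ 2 * Real.exp (-ε * freq n)) :=
    fun n s hs => by
      rw [Real.norm_of_nonneg (mul_nonneg (hE0 n s).le (Finset.sum_nonneg fun _ _ => sq_nonneg _))]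
      calc _ ≤ E n s * (2 * ‖D s n‖ ^ 2) := mul_le_mul_of_nonneg_left (hsum2 s n) (hE0 n s).le
        _ = 2 * (E n s * ‖D s n‖ ^ 2) := by ring
        _ ≤ _ := by linarith [hED s hs n]
  have hys : ∀ s ∈ Set.Icc t₀ t₁, Summable fun n => y n s := fun s hs =>
    .of_norm_bounded ((hexp.mul_left _).mul_left 2) fun n => hyle n s hs
  have hyc : ContinuousOn (fun s => ∑' n, y n s) (Set.Icc t₀ t₁) := by
    refine continuousOn_tsum (fun n => ?_) ((hexp.mul_left _).mul_left 2) hyle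
    have hEc : ContinuousOn (E n) (Set.Icc t₀ t₁) := fun s _ =>
      (hEd n s).continuousAt.continuousWithinAt
    exact hEc.mul (continuousOn_finsetSum _ fun i _ => (hDc n i).norm.pow 2)
  have hYd : ∀ s ∈ Set.Ioo t₀ t₁, HasDerivAt (fun s => ∑' n, y n s) (∑' n, y' n s) s := fun s hs =>
    hasDerivAt_tsum_of_isPreconnected hu isOpen_Ioo isPreconnected_Ioo hyd
      (fun n r hr => hy'le n r (Set.Ioo_subset_Icc_self hr)) hs
      (hys s (Set.Ioo_subset_Icc_self hs)) hs
  have hneg : ∀ s ∈ Set.Ioo t₀ t₁, ∑' n, y' n s ≤ 0 := fun s hs' => by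
    have hs := Set.Ioo_subset_Icc_self hs'
    obtain ⟨hp, hple⟩ := tsum_pairing_le hM hε (hρ0 s hs) (hρ1 s hs) (ha s hs) (hb s hs)
    replace hp : Summable fun n => E n s * (‖D s n‖ * ‖X s n‖) := hp
    replace hple : ∑' n, E n s * (‖D s n‖ * ‖X s n‖) ≤
      36 * (diffConst M ε * ∑' n, freq n * (E n s * ‖D s n‖ ^ 2)) := hple
    have hκ : Summable fun n => freq n * (E n s * ‖D s n‖ ^ 2) :=
      .of_nonneg_of_le (fun n => by have := freq_nonneg n; have := hE0 n s; positivity)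
        (hsumκ s hs) ((summable_exp_freq hε 1).mul_left _)
    have hκ0 : 0 ≤ ∑' n, freq n * (E n s * ‖D s n‖ ^ 2) :=
      tsum_nonneg fun n => by have := freq_nonneg n; have := hE0 n s; positivity
    have hle : ∀ n, y' n s ≤ -(2 * K) * (freq n * (E n s * ‖D s n‖ ^ 2))
        + 4 * G * (E n s * (‖D s n‖ * ‖X s n‖)) := fun n => by
      have h1 := mul_le_mul_of_nonneg_left (hinner s hs n) (hE0 n s).le
      have h2 : 0 ≤ E n s * (2 * K * freq n) := by
        have := freq_nonneg n; have := hE0 n s; positivity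
      have h3 := mul_le_mul_of_nonneg_left (norm_sq_le_sum (D s n)) h2
      simp only [y']
      linarith
    have h1 := Summable.tsum_le_tsum hle (.of_norm_bounded hu fun n => hy'le n s hs)
      ((hκ.mul_left _).add (hp.mul_left _))
    rw [(hκ.mul_left _).tsum_add (hp.mul_left (4 * G)), tsum_mul_left, tsum_mul_left] at h1
    have h2 := mul_le_mul_of_nonneg_left hple (show 0 ≤ 4 * G by positivity)
    have h3 := mul_le_mul_of_nonneg_right hK hκ0
    linarith
  have hY := antitoneOn_of_deriv_nonpos (convex_Icc t₀ t₁) hyc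
    (fun s hs => by
      rw [interior_Icc] at hs
      exact (hYd s hs).differentiableAt.differentiableWithinAt)
    (fun s hs => by
      rw [interior_Icc] at hs
      rw [(hYd s hs).deriv]; exact hneg s hs)
  have hY0 : ∑' n, y n t₀ = 0 := by
    have : ∀ n, y n t₀ = 0 := fun n => by simp [y, D, h0]
    simp [this]
  have hyn0 : ∀ n s, 0 ≤ y n s := fun n s =>
    mul_nonneg (hE0 n s).le (Finset.sum_nonneg fun _ _ => sq_nonneg _)
  have hYt : ∑' n, y n t ≤ 0 := hY0 ▸ hY ⟨le_rfl, htm.1.trans htm.2⟩ htm htm.1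
  funext n
  have hyn : y n t ≤ 0 := ((hys t htm).le_tsum n fun m _ => hyn0 m t).trans hYt
  have h1 : E n t * ‖D t n‖ ^ 2 ≤ 0 :=
    (mul_le_mul_of_nonneg_left (norm_sq_le_sum _) (hE0 n t).le).trans hyn
  have h2 : ‖D t n‖ ^ 2 ≤ 0 := by
    by_contra h
    exact absurd h1 (not_le.mpr (mul_pos (hE0 n t) (not_le.mp h)))
  have h3 : ‖D t n‖ = 0 := by nlinarith [norm_nonneg (D t n)]
  exact sub_eq_zero.mp (norm_eq_zero.mp h3)

/-- Uniqueness of the Fourier coefficients on a bounded interval. -/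
theorem eqOn_of_eq_zero {M ε μ T : ℝ} {g : ℝ → ℝ} {a b : ℝ → Coef} (hM : 0 ≤ M)
    (hε : 0 < ε) (hμ : 0 ≤ μ) (hg : Continuous g)
    (ha : ∀ t ∈ Set.Icc 0 T, ExpDecay M ε (a t)) (hb : ∀ t ∈ Set.Icc 0 T, ExpDecay M ε (b t))
    (hac : ∀ n i, ContinuousOn (fun t => a t n i) (Set.Icc 0 T))
    (hbc : ∀ n i, ContinuousOn (fun t => b t n i) (Set.Icc 0 T))
    (had : ∀ t ∈ Set.Ioo 0 T, ∀ n i, HasDerivAt (fun s => a s n i)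
      (-(g t : ℂ) * nl (a t) n i - (μ : ℂ) * a t n i) t)
    (hbd : ∀ t ∈ Set.Ioo 0 T, ∀ n i, HasDerivAt (fun s => b s n i)
      (-(g t : ℂ) * nl (b t) n i - (μ : ℂ) * b t n i) t)
    (h0 : a 0 = b 0) {t : ℝ} (htm : t ∈ Set.Icc 0 T) : a t = b t := by
  obtain ⟨G, hG⟩ := (isCompact_Icc (a := (0 : ℝ)) (b := T)).exists_bound_of_continuousOn
    hg.continuousOn
  have hG0 : 0 ≤ G := (norm_nonneg _).trans (hG t htm)
  have hS : 0 ≤ diffConst M ε := tsum_nonneg fun n => by have := freq_nonneg n; positivity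
  set K : ℝ := 72 * (G * diffConst M ε) + 1 with hK
  have hK0 : 0 < K := by positivity
  -- continuous induction, with steps of length `ε / (2K)` as long as they fit
  refine IsClosed.Icc_subset_of_forall_exists_gt (s := {t | a t = b t}) ?_ h0 ?_ htm
  · have : {t | a t = b t} ∩ Set.Icc 0 T
        = Set.Icc 0 T ∩ ⋂ n, ⋂ i, Set.Icc 0 T ∩ {t | a t n i = b t n i} := by
      ext t
      simp only [Set.mem_inter_iff, Set.mem_ofPred_eq, Set.mem_iInter]
      exact ⟨fun h => ⟨h.2, fun n i => ⟨h.2, by rw [h.1]⟩⟩,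
        fun h => ⟨funext fun n => funext fun i => (h.2 n i).2, h.1⟩⟩
    rw [this]
    refine isClosed_Icc.inter (isClosed_iInter fun n => isClosed_iInter fun i => ?_)
    have h := ((hac n i).sub (hbc n i)).preimage_isClosed_of_isClosed isClosed_Icc
      (isClosed_singleton (x := (0 : ℂ)))
    convert h using 2
    ext t
    simp [sub_eq_zero]
  · rintro x ⟨hx, hx0, hxT⟩ z hz
    set t₁ := min (min z T) (x + ε / (2 * K)) with ht₁
    have hx1 : x < t₁ := lt_min (lt_min hz hxT) (by have : 0 < ε / (2 * K) := by positivity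
                                                    linarith)
    have ht1T : t₁ ≤ T := (min_le_left _ _).trans (min_le_right _ _)
    have hsub : Set.Icc x t₁ ⊆ Set.Icc 0 T := Set.Icc_subset_Icc hx0 ht1T
    have hsub' : Set.Ioo x t₁ ⊆ Set.Ioo 0 T := Set.Ioo_subset_Ioo hx0 ht1T
    refine ⟨t₁, ?_, hx1, (min_le_left _ _).trans (min_le_left _ _)⟩
    refine eqOn_of_eq_left hM hε hμ hG0 (fun t ht => hG t (hsub ht)) (fun t ht => ha t (hsub ht))
      (fun t ht => hb t (hsub ht)) (fun n i => (hac n i).mono hsub) (fun n i => (hbc n i).mono hsub)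
      (fun t ht => had t (hsub' ht)) (fun t ht => hbd t (hsub' ht)) hx hK0.le (by rw [hK]; linarith)
      ?_ ⟨hx1.le, le_rfl⟩
    have h : t₁ - x ≤ ε / (2 * K) := by linarith [min_le_right (min z T) (x + ε / (2 * K))]
    calc K * (t₁ - x) ≤ K * (ε / (2 * K)) := by gcongr
      _ = ε / 2 := by field_simp

/-! ### Uniqueness for the partial differential equation -/

theorem ExpDecay.mono_left {M M' ε : ℝ} {a : Coef} (h : ExpDecay M ε a) (hM : M ≤ M') :
    ExpDecay M' ε a :=
  ⟨h.zero, fun n => (h.le n).trans (by gcongr)⟩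

theorem MemGevrey.summable_movingDist {σ a b : ℝ} {F G : Field} (hF : MemGevrey σ a F)
    (hG : MemGevrey σ b G) : Summable fun n : Fin 3 → ℤ => ∑ i : Fin 2,
    (‖((Real.exp (a * freq n) * freq n ^ σ : ℝ) : ℂ) * coeff F n i
        - ((Real.exp (b * freq n) * freq n ^ σ : ℝ) : ℂ) * coeff G n i‖ ^ 2
      + ‖coeff F n i - coeff G n i‖ ^ 2) := by
  refine .of_nonneg_of_le (fun n => Finset.sum_nonneg fun i _ => by positivity) (fun n => ?_)
    ((hF.add hG).mul_left 2)
  have h : ∀ u v : ℂ, ‖u - v‖ ^ 2 ≤ 2 * (‖u‖ ^ 2 + ‖v‖ ^ 2) := fun u v => by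
    nlinarith [norm_sub_le u v, norm_nonneg (u - v), sq_nonneg (‖u‖ - ‖v‖)]
  have hg : ∀ (φ : ℝ) (F : Field), gevreyTerm σ φ F n =
      ∑ i, (‖((Real.exp (φ * freq n) * freq n ^ σ : ℝ) : ℂ) * coeff F n i‖ ^ 2
        + ‖coeff F n i‖ ^ 2) := fun φ F => by
    simp only [norm_weight_mul_sq, gevreyTerm, coeffSq, wgt, Finset.mul_sum]
    exact Finset.sum_congr rfl fun i _ => by ring
  rw [hg, hg, ← Finset.sum_add_distrib, Finset.mul_sum]
  refine Finset.sum_le_sum fun i _ => ?_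
  linarith [h (((Real.exp (a * freq n) * freq n ^ σ : ℝ) : ℂ) * coeff F n i)
    (((Real.exp (b * freq n) * freq n ^ σ : ℝ) : ℂ) * coeff G n i), h (coeff F n i) (coeff G n i)]

/-- Each mode is controlled by the moving-radius distance; the series converges, so that the
distance is a genuine sum. -/
theorem MemGevrey.le_movingDistSq {σ a b : ℝ} {F G : Field} (hF : MemGevrey σ a F)
    (hG : MemGevrey σ b G) (n : Fin 3 → ℤ) (i : Fin 2) :
    ‖((Real.exp (a * freq n) * freq n ^ σ : ℝ) : ℂ) * coeff F n i
        - ((Real.exp (b * freq n) * freq n ^ σ : ℝ) : ℂ) * coeff G n i‖ ^ 2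
      + ‖coeff F n i - coeff G n i‖ ^ 2 ≤ movingDistSq σ a b F G := by
  refine le_trans ?_ ((hF.summable_movingDist hG).le_tsum n fun m _ =>
    Finset.sum_nonneg fun i _ => by positivity)
  exact Finset.single_le_sum (f := fun i =>
    ‖((Real.exp (a * freq n) * freq n ^ σ : ℝ) : ℂ) * coeff F n i
        - ((Real.exp (b * freq n) * freq n ^ σ : ℝ) : ℂ) * coeff G n i‖ ^ 2
      + ‖coeff F n i - coeff G n i‖ ^ 2) (fun i _ => by positivity) (Finset.mem_univ i)

section

variable {σ : ℝ} {φ : ℝ → ℝ} {U : ℝ → Field}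

theorem ContGevrey.wt_one (h : ContGevrey σ φ U) (hσ : 5 / 2 < σ) (hφ : ∀ t, 0 ≤ t → 0 < φ t)
    {t : ℝ} (ht : 0 ≤ t) : Wt 1 (coeff (U t)) :=
  wt_one_of_summable_dotTerm hσ (hφ t ht).le (h.memGevrey t ht).summable_dotTerm

theorem ContGevrey.continuousOn_coeff (h : ContGevrey σ φ U) (n : Fin 3 → ℤ) (i : Fin 2) :
    ContinuousOn (fun t => coeff (U t) n i) (Set.Ici 0) := by
  intro t ht
  have h1 : Tendsto (fun s => ‖coeff (U s) n i - coeff (U t) n i‖ ^ 2) (𝓝[Set.Ici 0] t) (𝓝 0) := by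
    refine squeeze_zero' (.of_forall fun s => sq_nonneg _) ?_ (h.cont t ht)
    filter_upwards [self_mem_nhdsWithin] with s hs
    exact (le_add_of_nonneg_left (sq_nonneg _)).trans
      ((h.memGevrey s hs).le_movingDistSq (h.memGevrey t ht) n i)
  have h2 := h1.sqrt
  simp only [Real.sqrt_sq (norm_nonneg _), Real.sqrt_zero] at h2
  exact tendsto_iff_norm_sub_tendsto_zero.mpr h2

/-- The coefficients decay exponentially, uniformly on bounded time intervals. -/
theorem ContGevrey.exists_expDecay (h : ContGevrey σ φ U) (hσ : 5 / 2 < σ)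
    (hφ : ∀ t, 0 ≤ t → 0 < φ t) (hanti : Antitone φ) (T : ℝ) :
    ∃ M, 0 ≤ M ∧ ∀ t ∈ Set.Icc 0 T, ExpDecay M (φ T) (coeff (U t)) := by
  refine IsCompact.induction_on (isCompact_Icc (a := (0 : ℝ)) (b := T))
    (p := fun S => ∃ M, 0 ≤ M ∧ ∀ t ∈ S, ExpDecay M (φ T) (coeff (U t)))
    ⟨0, le_rfl, fun t ht => ht.elim⟩ (fun S S' hS ⟨M, hM, hE⟩ => ⟨M, hM, fun t ht => hE t (hS ht)⟩)
    (fun S S' ⟨M, hM, hE⟩ ⟨M', hM', hE'⟩ => ⟨max M M', le_max_of_le_left hM, fun t ht =>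
      ht.elim (fun h => (hE t h).mono_left (le_max_left _ _))
        fun h => (hE' t h).mono_left (le_max_right _ _)⟩) fun t ht => ?_
  -- near each time the weighted coefficients stay within distance one of their values at that time
  have hev : ∀ᶠ s in 𝓝[Set.Ici 0] t, movingDistSq σ (φ s) (φ t) (U s) (U t) < 1 :=
    (tendsto_order.mp (h.cont t ht.1)).2 1 one_pos
  set B : ℝ := √(∑' n, cterm σ (φ t) (coeff (U t)) n) with hB
  have hB0 : 0 ≤ B := Real.sqrt_nonneg _
  have hcs : Summable (cterm σ (φ t) (coeff (U t))) := (h.memGevrey t ht.1).summable_dotTerm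
  have hev' : ∀ᶠ s in 𝓝[Set.Icc 0 T] t, movingDistSq σ (φ s) (φ t) (U s) (U t) < 1 :=
    hev.filter_mono (nhdsWithin_mono t Set.Icc_subset_Ici_self)
  refine ⟨{s | movingDistSq σ (φ s) (φ t) (U s) (U t) < 1} ∩ Set.Icc 0 T,
    inter_mem hev' self_mem_nhdsWithin, 2 * (1 + B), by positivity, fun s hs => ?_⟩
  obtain ⟨hs1, hs2⟩ := hs
  obtain ⟨hH, -⟩ := (h.memH s hs2.1).coefH (h.wt_one hσ hφ hs2.1)
  refine (expDecay_of_cterm (σ := σ) (by linarith) (by positivity) hH.zero fun n => ?_).mono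
    (by positivity) (hanti hs2.2)
  have hi : ∀ i, wgt σ (φ s) n * ‖coeff (U s) n i‖ ^ 2 ≤ (1 + B) ^ 2 := fun i => by
    have h1 := ((h.memGevrey s hs2.1).le_movingDistSq (h.memGevrey t ht.1) n i).trans
      (le_of_lt hs1)
    have h2 : wgt σ (φ t) n * ‖coeff (U t) n i‖ ^ 2 ≤ B ^ 2 := by
      rw [hB, Real.sq_sqrt (tsum_nonneg (cterm_nonneg _ _ _))]
      refine le_trans (mul_le_mul_of_nonneg_left ?_ (wgt_nonneg _ _ _))
        (hcs.le_tsum n fun _ _ => cterm_nonneg _ _ _ _)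
      exact Finset.single_le_sum (f := fun i => ‖coeff (U t) n i‖ ^ 2) (fun _ _ => sq_nonneg _)
        (Finset.mem_univ i)
    rw [← norm_weight_mul_sq] at h2 ⊢
    set u := ((Real.exp (φ s * freq n) * freq n ^ σ : ℝ) : ℂ) * coeff (U s) n i
    set v := ((Real.exp (φ t * freq n) * freq n ^ σ : ℝ) : ℂ) * coeff (U t) n i
    have h3 : ‖u - v‖ ≤ 1 := by
      nlinarith [sq_nonneg ‖coeff (U s) n i - coeff (U t) n i‖, norm_nonneg (u - v)]
    have h4 : ‖v‖ ≤ B := abs_le_of_sq_le_sq' h2 hB0 |>.2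
    have h5 : ‖u‖ ≤ 1 + B := by
      calc ‖u‖ = ‖(u - v) + v‖ := by rw [sub_add_cancel]
        _ ≤ _ := (norm_add_le _ _).trans (add_le_add h3 h4)
    gcongr
  rw [cterm, Fin.sum_univ_two, mul_add]
  nlinarith [hi 0, hi 1, sq_nonneg (1 + B)]

/-- The Fourier coefficients of a solution solve the equation mode by mode: differentiation under
the integral sign, with the right-hand side bounded by the sum of its coefficients. -/
theorem Solves.hasDerivAt_coeff {ν : ℝ} {ω : WienerSpace} {U₀ : Field} (hS : Solves ν ω U₀ U)
    (h : ContGevrey σ φ U) (hσ : 5 / 2 < σ) (hφ : ∀ t, 0 ≤ t → 0 < φ t) (hanti : Antitone φ)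
    (hΓ : Continuous fun t => (Gam ν ω t)⁻¹) {t : ℝ} (ht : 0 < t) (n : Fin 3 → ℤ) (i : Fin 2) :
    HasDerivAt (fun s => coeff (U s) n i) (-(((Gam ν ω t)⁻¹ : ℝ) : ℂ) * nl (coeff (U t)) n i
      - ((1 / 2 * ν ^ 2 : ℝ) : ℂ) * coeff (U t) n i) t := by
  obtain ⟨M, hM, hE⟩ := h.exists_expDecay hσ hφ hanti (2 * t)
  have hε : 0 < φ (2 * t) := hφ _ (by linarith)
  set ε := φ (2 * t)
  obtain ⟨G, hG⟩ := (isCompact_Icc (a := (0 : ℝ)) (b := 2 * t)).exists_bound_of_continuousOn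
    hΓ.continuousOn
  have hG0 : 0 ≤ G := (norm_nonneg _).trans (hG t ⟨ht.le, by linarith⟩)
  -- the coefficients of the right-hand side
  let r : ℝ → Coef := fun s n i => -(((Gam ν ω s)⁻¹ : ℝ) : ℂ) * nl (coeff (U s)) n i
      - ((1 / 2 * ν ^ 2 : ℝ) : ℂ) * coeff (U s) n i
  have hsum : Summable fun n : Fin 3 → ℤ =>
      G * (9 * M ^ 2 * dkk ε n) + 1 / 2 * ν ^ 2 * (M * Real.exp (-ε * freq n)) :=
    (((summable_dkk hε).mul_left _).mul_left _).add
      (((by simpa using summable_exp_freq hε 0 :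
        Summable fun n : Fin 3 → ℤ => Real.exp (-ε * freq n)).mul_left _).mul_left _)
  have hr : ∀ s ∈ Set.Icc 0 (2 * t), ∀ n, ‖r s n i‖ ≤
      G * (9 * M ^ 2 * dkk ε n) + 1 / 2 * ν ^ 2 * (M * Real.exp (-ε * freq n)) := fun s hs n => by
    refine (norm_sub_le _ _).trans (add_le_add ?_ ?_)
    · rw [norm_mul, norm_neg, Complex.norm_real]
      exact mul_le_mul (hG s hs) ((norm_le_pi_norm _ i).trans ((hE s hs).norm_nl_le hM hε n))
        (norm_nonneg _) hG0
    · rw [norm_mul, Complex.norm_real, Real.norm_of_nonneg (by positivity)]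
      exact mul_le_mul_of_nonneg_left ((norm_le_pi_norm _ i).trans ((hE s hs).le n)) (by positivity)
  have hrs : ∀ s ∈ Set.Icc 0 (2 * t), Summable fun n => r s n i := fun s hs =>
    .of_norm_bounded hsum (hr s hs)
  have hval : ∀ s ∈ Set.Icc 0 (2 * t), ∀ x,
      ((-((Gam ν ω s)⁻¹ * hydroLeray (Q (U s) (U s)) x i) - 1 / 2 * ν ^ 2 * U s x i : ℝ) : ℂ)
        = fser (r s · i) x := fun s hs x => by
    have hw : ∀ p, Wt p (coeff (U s)) := fun p => (hE s hs).wt hε p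
    obtain ⟨hH, hser⟩ := (h.memH s hs.1).coefH (hw 1)
    have hconv : Wt 1 (conv (coeff (U s)) (coeff (U s))) := (hw 2).conv (hw 2) hH.zero
    have h1 := hydroLeray_eq_fser (Q_eq_fser hser hser (hw 1) hH (hw 1)) hconv x i
    have hnl : Summable fun n => lerayc n (conv (coeff (U s)) (coeff (U s)) n) i * mFourier n x :=
      summable_mul_mFourier (hconv.lerayc.summable i) x
    rw [Complex.ofReal_sub, Complex.ofReal_neg, Complex.ofReal_mul (Gam ν ω s)⁻¹,
      Complex.ofReal_mul (1 / 2 * ν ^ 2), h1, hser x i, fser, fser, fser, ← tsum_mul_left,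
      ← tsum_mul_left, ← tsum_neg, ← Summable.tsum_sub (hnl.mul_left _).neg
        ((summable_mul_mFourier ((hw 1).summable i) x).mul_left _)]
    refine tsum_congr fun n => ?_
    simp only [r, nl]; ring
  let μ : Measure T3 := Measure.pi fun _ => AddCircle.haarAddCircle
  have hnear : Set.Ioo 0 (2 * t) ∈ 𝓝 t := Ioo_mem_nhds ht (by linarith)
  have hcont : ∀ s, Continuous fun x => mFourier (-n) x • (U s x i : ℂ) := fun s => by fun_prop
  have hd := hasDerivAt_integral_of_dominated_loc_of_deriv_le (μ := μ) (x₀ := t)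
    (F := fun s x => mFourier (-n) x • (U s x i : ℂ))
    (F' := fun s x => mFourier (-n) x •
      ((-((Gam ν ω s)⁻¹ * hydroLeray (Q (U s) (U s)) x i) - 1 / 2 * ν ^ 2 * U s x i : ℝ) : ℂ))
    (bound := fun _ => ∑' n : Fin 3 → ℤ,
      (G * (9 * M ^ 2 * dkk ε n) + 1 / 2 * ν ^ 2 * (M * Real.exp (-ε * freq n))))
    hnear (.of_forall fun s => (hcont s).aestronglyMeasurable)
    ((hcont t).integrable_of_hasCompactSupport (HasCompactSupport.of_compactSpace _))
    (by
      have htm : t ∈ Set.Icc 0 (2 * t) := ⟨ht.le, by linarith⟩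
      simp only [hval t htm]
      exact ((map_continuous (mFourier (-n))).smul
        (continuous_fser (hrs t htm))).aestronglyMeasurable)
    (.of_forall fun x s hs => by
      have hs' := Set.Ioo_subset_Icc_self hs
      rw [norm_smul, norm_mFourier_apply, one_mul, hval s hs']
      exact (norm_fser_le (hrs s hs') x).trans
        ((hrs s hs').norm.tsum_le_tsum (hr s hs') hsum))
    (integrable_const _)
    (.of_forall fun x s hs => by
      have h1 := (hS.eqn s hs.1.le x i).hasDerivAt (Ici_mem_nhds hs.1)
      exact h1.ofReal_comp.const_smul (mFourier (-n) x))
  refine hd.2.congr_deriv ?_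
  have htm : t ∈ Set.Icc 0 (2 * t) := ⟨ht.le, by linarith⟩
  simp only [hval t htm]
  exact mFourierCoeff_fser (hrs t htm) n

/-- Uniqueness in the class of fields which are continuous with values in the Gevrey class. -/
theorem Solves.unique {ν : ℝ} {ω : WienerSpace} {U₀ : Field} {V : ℝ → Field}
    (hU : Solves ν ω U₀ U) (hV : Solves ν ω U₀ V) (hUc : ContGevrey σ φ U)
    (hVc : ContGevrey σ φ V) (hσ : 5 / 2 < σ) (hφ : ∀ t, 0 ≤ t → 0 < φ t) (hanti : Antitone φ)
    (hΓ : Continuous fun t => (Gam ν ω t)⁻¹) {t : ℝ} (ht : 0 ≤ t) : U t = V t := by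
  obtain ⟨M, hM, hE⟩ := hUc.exists_expDecay hσ hφ hanti t
  obtain ⟨M', -, hE'⟩ := hVc.exists_expDecay hσ hφ hanti t
  refine field_ext_of_coeff (hUc.wt_one hσ hφ ht) (hVc.wt_one hσ hφ ht) ?_
  exact eqOn_of_eq_zero (a := fun s => coeff (U s)) (b := fun s => coeff (V s)) (T := t)
    (le_max_of_le_left hM) (hφ t ht) (by positivity : (0 : ℝ) ≤ 1 / 2 * ν ^ 2) hΓ
    (fun s hs => (hE s hs).mono_left (le_max_left M M'))
    (fun s hs => (hE' s hs).mono_left (le_max_right M M'))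
    (fun n i => (hUc.continuousOn_coeff n i).mono Set.Icc_subset_Ici_self)
    (fun n i => (hVc.continuousOn_coeff n i).mono Set.Icc_subset_Ici_self)
    (fun s hs n i => hU.hasDerivAt_coeff hUc hσ hφ hanti hΓ hs.1 n i)
    (fun s hs n i => hV.hasDerivAt_coeff hVc hσ hφ hanti hΓ hs.1 n i)
    (by rw [hU.init, hV.init]) ⟨ht, le_rfl⟩

end

end PE

end

theorem proposition4p2 (σ : ℝ) (hσ : 5 / 2 < σ) :
    (∃ C : ℝ, 0 < C ∧ PE.NonlinearEstimate σ C) ∧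
    ∀ C : ℝ, 0 < C → PE.NonlinearEstimate σ C →
    ∀ φ₀ α β ν : ℝ, 0 < φ₀ → 0 < α → 0 < β → 0 < ν →
      4 * C < (ν ^ 2 - 2 * β) * φ₀ →
    ∀ ω ∈ PE.goodSet α β ν,
    ∀ U₀ : PE.Field, PE.MemH U₀ → PE.MemGevrey σ φ₀ U₀ →
      Real.exp α * PE.gevreyNorm σ φ₀ U₀ ≤ (ν ^ 2 - 2 * β) * φ₀ / (4 * C) - 1 →
    (∀ t, 0 ≤ t → 0 < PE.radius φ₀ C α β ν (PE.gevreyNorm σ φ₀ U₀) t) ∧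
    ∃ U : ℝ → PE.Field,
      (PE.ContGevrey σ (PE.radius φ₀ C α β ν (PE.gevreyNorm σ φ₀ U₀)) U ∧
        PE.Solves ν ω U₀ U) ∧
      ∀ U' : ℝ → PE.Field,
        PE.ContGevrey σ (PE.radius φ₀ C α β ν (PE.gevreyNorm σ φ₀ U₀)) U' →
        PE.Solves ν ω U₀ U' →
        ∀ t, 0 ≤ t → U' t = U t := by
  refine ⟨PE.exists_nonlinearEstimate hσ, ?_⟩
  intro C hC hNL φ₀ α β ν hφ₀ _ _ _ hCφ ω hω U₀ hU₀ hG hsmall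
  have hc : 0 < ν ^ 2 - 2 * β := by
    by_contra h
    nlinarith [mul_nonneg (neg_nonneg.mpr (not_lt.mp h)) hφ₀.le]
  have hN : 0 ≤ PE.gevreyNorm σ φ₀ U₀ := Real.sqrt_nonneg _
  have hpos : ∀ t, 0 ≤ t → 0 < PE.radius φ₀ C α β ν (PE.gevreyNorm σ φ₀ U₀) t := fun t _ =>
    PE.radius_pos hc hC hN hsmall
  obtain ⟨U, hUc, hUs⟩ := PE.exists_solution hσ hC hNL hc hω hφ₀ hU₀ hG hsmall
  exact ⟨hpos, U, ⟨hUc, hUs⟩, fun U' hUc' hUs' t ht => hUs'.unique hUs hUc' hUc hσ hpos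
    (PE.antitone_radius hc hC.le hN) (PE.continuous_inv_Gam ν ω) ht⟩
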